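/- Let $G$ be a group of type $F_\infty$ (there is a CW complex $K(G,1)$ with finitely many cells in each dimension), and fix a finite symmetric generating set of $G$ with word length $|\cdot|$. Assume that $G$ has polynomially bounded higher-order Dehn functions: there is a simplicial complex $BG$ with finite skeleta, with universal covering $EG$, such that for every $N\ge 1$ there is a polynomial $P_N$ with $d^N(k)\le P_N(k)$ for all $k\in\mathbb N$. Here $$d^N(k)=\sup_{b}\ \min\{\,|a|_1 : a \text{ an integral simplicial } (N+1)\text{-chain of } EG,\ \partial a=b\,\}\in\mathbb N\cup\{\infty\},$$ where $b$ runs over all integral simplicial $N$-boundaries of $EG$ of $\ell^1$-norm $|b|_1\le k$. For a conjugacy class $x$ of $G$ let $C_\bullet(\mathbb CG)_x$ be the subcomplex of the Hochschild complex $C_n(\mathbb CG)=(\mathbb CG)^{\otimes(n+1)}\cong\mathbb C[G^{n+1}]$ spanned by the tuples $(g_0,\dots,g_n)$ with $g_0\cdots g_n\in x$; its homology is denoted $HH_*(\mathbb CG)_x$. Let $C_n(\ell^1_\infty G)_x$ be the completion of $C_n(\mathbb CG)_x$ with respect to the norms $$\|c\|_k=\sum |c(g_0,\dots,g_n)|\prod_{i=0}^n(1+|g_i|)^k,\qquad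 k\in\mathbb N,$$ that is, the norms induced from the completed projective tensor product $\ell^1_\infty G\,\hat\otimes\cdots\hat\otimes\,\ell^1_\infty G$, where $\ell^1_\infty G$ is the completion of $\mathbb CG$ with respect to the norms $\sum_g|f(g)|(1+|g|)^k$. The homology of the complex $C_\bullet(\ell^1_\infty G)_x$, with the continuously extended Hochschild boundary, is denoted $HH^{\mathrm{cont}}_*(\ell^1_\infty G)_x$. Then for the conjugacy class $[e]$ of the neutral element and every $n\ge 0$ the map $$HH_n(\mathbb CG)_{[e]}\longrightarrow HH^{\mathrm{cont}}_n(\ell^1_\infty G)_{[e]}$$ induced by the inclusion $C_\bullet(\mathbb CG)_{[e]}\to C_\bullet(\ell^1_\infty G)_{[e]}$ is an isomorphism of complex vector spaces. -/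

import Mathlib

open CategoryTheory Topology

universe u

noncomputable section

/-! ## Groups of type F_∞ -/

/-- `G` is of type F_∞: there is an Eilenberg-MacLane space `K(G,1)` that is a CW complex with
finitely many cells in every dimension. -/
def IsTypeFInfty (G : Type u) [Group G] : Prop :=
  ∃ (X : Type u) (_ : TopologicalSpace X) (_ : T2Space X)
    (_ : CWComplex (Set.univ : Set X)),
    RelCWComplex.FiniteType (Set.univ : Set X) ∧ PathConnectedSpace X ∧
    ∃ x : X, Nonempty (FundamentalGroup X x ≃* G) ∧
      ∀ n : ℕ, 2 ≤ n → Subsingleton (HomotopyGroup.Pi n X x)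

/-! ## Simplicial complexes: geometric realization, chains, Dehn functions -/

namespace AbstractSimplicialComplex

/-- The points of the geometric realization of `K`, in barycentric coordinates. -/
def Realization {V : Type u} (K : AbstractSimplicialComplex V) : Type u :=
  {t : V → ℝ // (∀ v, 0 ≤ t v) ∧
    ∃ s ∈ K.faces, (∀ v, v ∉ s → t v = 0) ∧ ∑ v ∈ s, t v = 1}

open Classical in
/-- The inclusion of the closed simplex spanned by the face `s` into the realization. -/
def simplexMap {V : Type u} (K : AbstractSimplicialComplex V) (s : K.faces) :
    stdSimplex ℝ (s : Finset V) → K.Realization := fun t =>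
  ⟨fun v => if h : v ∈ (s : Finset V) then t.1 ⟨v, h⟩ else 0, by
    refine ⟨fun v => ?_, s, s.2, fun v hv => dif_neg hv, ?_⟩
    · by_cases h : v ∈ (s : Finset V)
      · simpa [h] using t.2.1 ⟨v, h⟩
      · simp [h]
    · rw [← Finset.sum_coe_sort]
      simpa using t.2.2⟩

/-- The weak topology of the geometric realization: the finest topology for which the inclusions
of all closed simplices are continuous. -/
instance {V : Type u} (K : AbstractSimplicialComplex V) : TopologicalSpace K.Realization :=
  ⨆ s : K.faces, TopologicalSpace.coinduced (K.simplexMap s) inferInstance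

/-- The `N`-dimensional simplices of `K`. -/
def Simplex {V : Type u} (K : AbstractSimplicialComplex V) (N : ℕ) : Type u :=
  {s : Finset V // s ∈ K.faces ∧ s.card = N + 1}

/-- Integral simplicial `N`-chains. Every simplex is oriented by a linear order on the vertices;
another order changes some signs in the basis and hence not the `ℓ¹`-norm. -/
abbrev Chain {V : Type u} (K : AbstractSimplicialComplex V) (N : ℕ) : Type u :=
  K.Simplex N →₀ ℤ

/-- The codimension one face of a simplex opposite to its vertex `v`. -/
def Simplex.face {V : Type u} [LinearOrder V] {K : AbstractSimplicialComplex V} {N : ℕ}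
    (s : K.Simplex (N + 1)) (v : s.1) : K.Simplex N :=
  ⟨s.1.erase v, by
    have hc : (s.1.erase v).card = N + 1 := by
      rw [Finset.card_erase_of_mem v.2, s.2.2]; rfl
    exact ⟨(K.isRelLowerSet_faces s.2.1).2 (Finset.erase_subset _ _)
      (Finset.card_pos.mp (by omega)), hc⟩⟩

/-- The simplicial boundary operator; the vertex `v` of `s` has the number
`#{w ∈ s | w < v}` in the order of the vertices of `s`. -/
def boundary {V : Type u} [LinearOrder V] (K : AbstractSimplicialComplex V) (N : ℕ) :
    K.Chain (N + 1) →ₗ[ℤ] K.Chain N :=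
  Finsupp.linearCombination ℤ fun s : K.Simplex (N + 1) =>
    ∑ v : s.1, (-1 : ℤ) ^ (s.1.filter (· < (v : V))).card • Finsupp.single (s.face v) (1 : ℤ)

/-- The `ℓ¹`-norm of an integral chain. -/
def chainNorm {V : Type u} {K : AbstractSimplicialComplex V} {N : ℕ} (c : K.Chain N) : ℕ :=
  c.sum fun _ z => z.natAbs

/-- The least `ℓ¹`-norm of an `(N+1)`-chain with boundary `b`. -/
def fillingNorm {V : Type u} [LinearOrder V] (K : AbstractSimplicialComplex V) (N : ℕ)
    (b : K.Chain N) : ℕ∞ :=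
  ⨅ (a : K.Chain (N + 1)) (_ : K.boundary N a = b), (chainNorm a : ℕ∞)

/-- The `N`-th Dehn function `d^N : ℕ → ℕ ∪ {∞}` of a simplicial complex. -/
def dehnFunction {V : Type u} [LinearOrder V] (K : AbstractSimplicialComplex V) (N : ℕ)
    (k : ℕ) : ℕ∞ :=
  ⨆ (b : K.Chain N) (_ : b ∈ LinearMap.range (K.boundary N)) (_ : chainNorm b ≤ k),
    K.fillingNorm N b

end AbstractSimplicialComplex

/-- The simplicial complex `K` with the given action of `G` on its vertices is a simplicial `EG`,
that is, the universal covering (with its deck transformations) of a simplicial complex `BG`.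
The fields `eq_of_smul_eq` and `exists_smul_eq` say that `K / G` is again a simplicial complex, the
simplices of which are the `G`-orbits of simplices of `K`. -/
structure IsSimplicialEG (G : Type u) [Group G] {V : Type u} [MulAction G V]
    (K : AbstractSimplicialComplex V) : Prop where
  smul_mem : ∀ (g : G), ∀ s ∈ K.faces, s.map (MulAction.toPerm g).toEmbedding ∈ K.faces
  free : ∀ (g : G) (v : V), g • v = v → g = 1
  eq_of_smul_eq : ∀ s ∈ K.faces, ∀ v ∈ s, ∀ w ∈ s, ∀ g : G, g • v = w → v = w
  exists_smul_eq : ∀ s ∈ K.faces, ∀ t ∈ K.faces,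
    (∀ v ∈ s, ∃ g : G, g • v ∈ t) → (∀ w ∈ t, ∃ g : G, g • w ∈ s) →
      ∃ g : G, s.map (MulAction.toPerm g).toEmbedding = t
  contractible : ContractibleSpace K.Realization

/-- `K / G` has finitely many simplices in every dimension. -/
def HasFiniteSkeleta (G : Type u) [Group G] {V : Type u} [MulAction G V]
    (K : AbstractSimplicialComplex V) : Prop :=
  ∀ n : ℕ, ∃ F : Finset (Finset V), ∀ s ∈ K.faces, s.card = n + 1 →
    ∃ t ∈ F, ∃ g : G, s = t.map (MulAction.toPerm g).toEmbedding

/-- `G` has polynomially bounded higher-order Dehn functions: there is a simplicial `EG`, coming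
from a simplicial `BG` with finite skeleta, all of whose Dehn functions `d^N`, `N ≥ 1`, are bounded
from above by polynomials. (The function `d^0` measures fillings of pairs of points by paths, it is
infinite for every infinite group, and it is not a higher-order Dehn function.) -/
def HasPolynomiallyBoundedDehnFunctions (G : Type u) [Group G] : Prop :=
  ∃ (V : Type u) (_ : LinearOrder V) (_ : MulAction G V) (K : AbstractSimplicialComplex V),
    IsSimplicialEG G K ∧ HasFiniteSkeleta G K ∧
    ∀ N : ℕ, 1 ≤ N → ∃ P : Polynomial ℕ, ∀ k : ℕ, K.dehnFunction N k ≤ ((P.eval k : ℕ) : ℕ∞)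

/-! ## Word lengths -/

/-- A finite symmetric generating set of `G`. -/
structure FinSymmGenSet (G : Type u) [Group G] where
  carrier : Finset G
  inv_mem : ∀ s ∈ carrier, s⁻¹ ∈ carrier
  closure_eq_top : Subgroup.closure (carrier : Set G) = ⊤

namespace FinSymmGenSet

variable {G : Type u} [Group G] (S : FinSymmGenSet G)

/-- The word length: the least length of a word in the generators that represents `g`. -/
def length (g : G) : ℕ :=
  sInf {n | ∃ l : List G, (∀ s ∈ l, s ∈ S.carrier) ∧ l.prod = g ∧ l.length = n}

theorem exists_word (g : G) :
    ∃ l : List G, (∀ s ∈ l, s ∈ S.carrier) ∧ l.prod = g ∧ l.length = S.length g := by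
  have hne : {n | ∃ l : List G, (∀ s ∈ l, s ∈ S.carrier) ∧ l.prod = g ∧ l.length = n}.Nonempty := by
    have hg : g ∈ Subgroup.closure (S.carrier : Set G) := by
      rw [S.closure_eq_top]; trivial
    rw [← Subgroup.mem_toSubmonoid, Subgroup.closure_toSubmonoid] at hg
    obtain ⟨l, hl, rfl⟩ := Submonoid.exists_list_of_mem_closure hg
    refine ⟨l.length, l, fun s hs => ?_, rfl, rfl⟩
    rcases hl s hs with h | h
    · exact h
    · simpa using S.inv_mem _ h
  exact Nat.sInf_mem hne

theorem length_mul_le (g h : G) : S.length (g * h) ≤ S.length g + S.length h := by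
  obtain ⟨l, hl, hlg, hn⟩ := S.exists_word g
  obtain ⟨m, hm, hmh, hk⟩ := S.exists_word h
  refine Nat.sInf_le ⟨l ++ m, fun s hs => ?_, by simp [hlg, hmh], by simp [hn, hk]⟩
  rcases List.mem_append.mp hs with h' | h'
  · exact hl s h'
  · exact hm s h'

end FinSymmGenSet

/-! ## The faces of the Hochschild complex of a group ring -/

section Faces

variable {G : Type u} [Group G]

/-- The `j`-th term of the Hochschild boundary of `(g₀, …, gₙ₊₁)`: it is
`(g₀, …, gⱼ gⱼ₊₁, …, gₙ₊₁)` for `j ≤ n`, and `(gₙ₊₁ g₀, g₁, …, gₙ)` for `j = n + 1`. -/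
def hochschildFace {n : ℕ} (j : Fin (n + 2)) (g : Fin (n + 2) → G) : Fin (n + 1) → G :=
  if j = Fin.last (n + 1) then
    fun k => if k = 0 then g (Fin.last (n + 1)) * g 0 else g k.castSucc
  else Fin.contractNth j (· * ·) g

theorem hochschildFace_apply {n : ℕ} (j : Fin (n + 2)) (g : Fin (n + 2) → G) (k : Fin (n+1)) :
    hochschildFace j g k = 
     if j = Fin.last (n + 1) then (if k = 0 then g (Fin.last (n + 1)) * g 0 else g k.castSucc)
     else if (k : ℕ) < j then g k.castSucc else if (k:ℕ) = j then g k.castSucc * g k.succ else g k.succ := by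
  unfold hochschildFace Fin.contractNth
  split_ifs <;> simp_all

theorem hochschildFace_comp {n : ℕ} (i j : Fin (n + 2)) (hij : i ≤ j) (g : Fin (n + 3) → G) :
    hochschildFace i (hochschildFace j.succ g) =
      hochschildFace j (hochschildFace i.castSucc g) := by
  obtain ⟨a, ha⟩ : ∃ a : ℕ → G, ∀ m : Fin (n + 3), g m = a m :=
    ⟨fun m => if h : m < n + 3 then g ⟨m, h⟩ else 1, fun m => by simp [m.2]⟩
  funext k
  obtain ⟨i, hi⟩ := i
  obtain ⟨j, hj⟩ := j
  obtain ⟨k, hk⟩ := k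
  simp only [Fin.mk_le_mk] at hij
  simp only [hochschildFace_apply, ha, Fin.ext_iff, Fin.val_last, Fin.val_castSucc, Fin.val_succ,
    Fin.val_zero]
  grind

/-- The product `g₀ ⋯ gₙ`. -/
def tupleProd {n : ℕ} (g : Fin (n + 1) → G) : G := (List.ofFn g).prod

theorem mk_tupleProd_hochschildFace {n : ℕ} (j : Fin (n + 2)) (g : Fin (n + 2) → G) :
    ConjClasses.mk (tupleProd (hochschildFace j g)) = ConjClasses.mk (tupleProd g) := by
  by_cases h : j = Fin.last (n + 1)
  · subst h
    rw [ConjClasses.mk_eq_mk_iff_isConj]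
    have h1 : tupleProd (hochschildFace (Fin.last (n + 1)) g) =
        g (Fin.last (n + 1)) * tupleProd (fun k : Fin (n + 1) => g k.castSucc) := by
      simp [tupleProd, hochschildFace, List.ofFn_succ, mul_assoc]
    have h2 : tupleProd g =
        tupleProd (fun k : Fin (n + 1) => g k.castSucc) * g (Fin.last (n + 1)) := by
      rw [tupleProd, List.ofFn_succ', List.concat_eq_append, List.prod_append]
      simp [tupleProd]
    rw [h1, h2, isConj_iff]
    exact ⟨(g (Fin.last (n + 1)))⁻¹, by group⟩
  · have key : ∀ (m : ℕ) (f : Fin m → G), (List.ofFn f).prod = Fin.partialProd f (Fin.last m) := by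
      intro m f
      rw [Fin.partialProd, Fin.val_last, List.take_of_length_le (by simp)]
    congr 1
    rw [tupleProd, tupleProd, key, key, hochschildFace, if_neg h]
    rw [Fin.partialProd_contractNth, Function.comp_apply]
    congr 1
    obtain ⟨i, rfl⟩ := Fin.exists_castSucc_eq.mpr h
    simp [Fin.ext_iff, Fin.succAbove, Fin.lt_def]
    omega

theorem prod_hochschildFace_le {n : ℕ} (w : G → ℕ)
    (h2 : ∀ g h, w (g * h) ≤ w g * w h) (j : Fin (n + 2)) (g : Fin (n + 2) → G) :
    ∏ i, w (hochschildFace j g i) ≤ ∏ i, w (g i) := by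
  induction j using Fin.lastCases with
  | last =>
    rw [Fin.prod_univ_castSucc (f := fun i => w (g i)), Fin.prod_univ_succ, Fin.prod_univ_succ,
      mul_comm _ (w (g (Fin.last _))), ← mul_assoc]
    have h0 : hochschildFace (Fin.last (n + 1)) g 0 = g (Fin.last (n + 1)) * g 0 := by
      simp [hochschildFace]
    have hs : ∀ i : Fin n, hochschildFace (Fin.last (n + 1)) g i.succ = g i.succ.castSucc := by
      intro i
      simp [hochschildFace]
    simp only [h0, hs, Fin.castSucc_zero]
    exact Nat.mul_le_mul_right _ (h2 _ _)
  | cast j =>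
    rw [Fin.prod_univ_succAbove (fun i => w (g i)) j.succ,
      Fin.prod_univ_succAbove (fun i => w (g (j.succ.succAbove i))) j,
      Fin.prod_univ_succAbove _ j, ← mul_assoc, mul_comm (w (g j.succ))]
    have h0 : hochschildFace j.castSucc g j = g (j.succ.succAbove j) * g j.succ := by
      simp [hochschildFace, Fin.contractNth]
    have hs : ∀ k : Fin n, hochschildFace j.castSucc g (j.succAbove k) =
        g (j.succ.succAbove (j.succAbove k)) := by
      intro k
      rw [hochschildFace, if_neg (Fin.castSucc_ne_last j), Fin.contractNth]
      have hne : ((j.succAbove k : Fin (n + 1)) : ℕ) ≠ j := by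
        simpa [Fin.ext_iff] using Fin.succAbove_ne j k
      rcases lt_or_gt_of_ne hne with h | h
      · rw [if_pos (by simpa using h), Fin.succAbove_of_castSucc_lt j.succ (j.succAbove k) (by
          simp only [Fin.lt_def, Fin.val_castSucc, Fin.val_succ]; omega)]
      · rw [if_neg (by simpa using h.le), if_neg (by simpa using hne),
          Fin.succAbove_of_le_castSucc j.succ (j.succAbove k) (by
            simp only [Fin.le_def, Fin.val_castSucc, Fin.val_succ]; omega)]
    simp only [h0, hs]
    exact Nat.mul_le_mul_right _ (h2 _ _)

/-- The tuples `(g₀, …, gₙ)` with `g₀ ⋯ gₙ ∈ x`. -/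
def ClassTuple (x : ConjClasses G) (n : ℕ) : Type u :=
  {g : Fin (n + 1) → G // ConjClasses.mk (tupleProd g) = x}

/-- The faces on the tuples with product in `x`. -/
def ClassTuple.face {x : ConjClasses G} {n : ℕ} (j : Fin (n + 2)) (g : ClassTuple x (n + 1)) :
    ClassTuple x n :=
  ⟨hochschildFace j g.1, (mk_tupleProd_hochschildFace j g.1).trans g.2⟩

theorem ClassTuple.face_comp {x : ConjClasses G} {n : ℕ} (i j : Fin (n + 2)) (hij : i ≤ j) :
    (ClassTuple.face i ∘ ClassTuple.face j.succ : ClassTuple x (n + 2) → ClassTuple x n) =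
      ClassTuple.face j ∘ ClassTuple.face i.castSucc :=
  funext fun g => Subtype.ext (hochschildFace_comp i j hij g.1)

/-- The weight `∏ᵢ (1 + |gᵢ|)` of a tuple. -/
def ClassTuple.weight (S : FinSymmGenSet G) {x : ConjClasses G} {n : ℕ}
    (g : ClassTuple x n) : ℕ :=
  ∏ i, (1 + S.length (g.1 i))

theorem ClassTuple.weight_face_le (S : FinSymmGenSet G) {x : ConjClasses G} {n : ℕ}
    (j : Fin (n + 2)) (g : ClassTuple x (n + 1)) : (g.face j).weight S ≤ g.weight S := by
  refine prod_hochschildFace_le (fun a => 1 + S.length a) (fun a b => ?_) j g.1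
  have := S.length_mul_le a b
  nlinarith [Nat.zero_le (S.length a * S.length b)]

end Faces

/-! ## Weighted `ℓ¹`-spaces -/

section Weighted

variable {I J L : Type u}

/-- The functions `c` on `I` for which `‖c‖_k = ∑ᵢ |c i| w(i)^k` is finite for every `k`. For
`w ≥ 1` this is the completion of the space of finitely supported functions with respect to the
family of norms `‖-‖_k`. -/
def RapidDecay (w : I → ℕ) : Submodule ℂ (I → ℂ) where
  carrier := {c | ∀ k : ℕ, Summable fun i => ‖c i‖ * (w i : ℝ) ^ k}
  zero_mem' := fun k => by simp
  add_mem' := fun {a b} ha hb k => by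
    refine Summable.of_nonneg_of_le (fun i => by positivity) (fun i => ?_) ((ha k).add (hb k))
    rw [← add_mul]
    exact mul_le_mul_of_nonneg_right (norm_add_le _ _) (by positivity)
  smul_mem' := fun r a ha k => by
    simpa [mul_assoc] using (ha k).mul_left ‖r‖

namespace RapidDecay

theorem summable {w : I → ℕ} (c : RapidDecay w) : Summable c.1 :=
  Summable.of_norm (by simpa using c.2 0)

theorem summable_fiber {w : I → ℕ} (c : RapidDecay w) (f : I → J) (j : J) :
    Summable fun i : {i // f i = j} => c.1 i :=
  (summable c).comp_injective Subtype.val_injective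

theorem push_mem {w : I → ℕ} {w' : J → ℕ} (f : I → J) (hf : ∀ i, w' (f i) ≤ w i)
    (c : RapidDecay w) : (fun j => ∑' i : {i // f i = j}, c.1 i) ∈ RapidDecay w' := by
  intro k
  have hs : Summable fun p : (Σ j : J, {i // f i = j}) => ‖c.1 p.2‖ * (w p.2 : ℝ) ^ k :=
    (Equiv.sigmaFiberEquiv f).summable_iff.mpr (c.2 k)
  have hs0 : ∀ j, Summable fun i : {i // f i = j} => ‖c.1 i‖ := fun j =>
    (summable_fiber c f j).norm
  refine Summable.of_nonneg_of_le (fun j => by positivity) (fun j => ?_) hs.sigma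
  calc ‖∑' i : {i // f i = j}, c.1 i‖ * (w' j : ℝ) ^ k
      ≤ (∑' i : {i // f i = j}, ‖c.1 i‖) * (w' j : ℝ) ^ k :=
        mul_le_mul_of_nonneg_right (norm_tsum_le_tsum_norm (hs0 j)) (by positivity)
    _ = ∑' i : {i // f i = j}, ‖c.1 i‖ * (w' j : ℝ) ^ k := tsum_mul_right.symm
    _ ≤ ∑' i : {i // f i = j}, ‖c.1 i‖ * (w i : ℝ) ^ k := by
        refine Summable.tsum_le_tsum (fun i => ?_) ((hs0 j).mul_right _) (hs.sigma_factor j)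
        obtain ⟨i, rfl⟩ := i
        have := hf i
        gcongr

/-- The continuous linear extension of the map that sends the basis element `i` to the basis
element `f i`, namely the push-forward `j ↦ ∑_{f i = j} c i` of functions. -/
def push {w : I → ℕ} {w' : J → ℕ} (f : I → J) (hf : ∀ i, w' (f i) ≤ w i) :
    RapidDecay w →ₗ[ℂ] RapidDecay w' where
  toFun c := ⟨fun j => ∑' i : {i // f i = j}, c.1 i, push_mem f hf c⟩
  map_add' a b := Subtype.ext <| funext fun j =>
    (summable_fiber a f j).tsum_add (summable_fiber b f j)
  map_smul' _ _ := Subtype.ext <| funext fun _ => tsum_mul_left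

theorem push_comp_push {w : I → ℕ} {w' : J → ℕ} {w'' : L → ℕ} (f : I → J) (g : J → L)
    (hf : ∀ i, w' (f i) ≤ w i) (hg : ∀ i, w'' (g i) ≤ w' i) :
    push g hg ∘ₗ push f hf = push (g ∘ f) (fun i => (hg (f i)).trans (hf i)) := by
  ext c l
  change ∑' j : {j // g j = l}, ∑' i : {i // f i = j}, c.1 i =
    ∑' i : {i // g (f i) = l}, c.1 i
  let e : {i // g (f i) = l} ≃ (Σ j : {j // g j = l}, {i // f i = j}) :=
    { toFun := fun i => ⟨⟨f i.1, i.2⟩, ⟨i.1, rfl⟩⟩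
      invFun := fun p => ⟨p.2.1, by rw [p.2.2]; exact p.1.2⟩
      left_inv := fun i => rfl
      right_inv := by
        rintro ⟨⟨j, hj⟩, ⟨i, hi⟩⟩
        dsimp only at hi
        subst hi
        rfl }
  have hs : Summable fun p : (Σ j : {j // g j = l}, {i // f i = j}) => c.1 p.2 := by
    rw [← e.summable_iff]
    exact summable_fiber c (g ∘ f) l
  rw [← hs.tsum_sigma, ← e.tsum_eq]
  rfl

/-- The inclusion of the finitely supported functions. -/
def incl (w : I → ℕ) : (I →₀ ℂ) →ₗ[ℂ] RapidDecay w where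
  toFun c := ⟨c, fun k => summable_of_ne_finset_zero (s := c.support) fun i hi => by
    simp [Finsupp.notMem_support_iff.mp hi]⟩
  map_add' _ _ := rfl
  map_smul' _ _ := rfl

theorem push_comp_incl {w : I → ℕ} {w' : J → ℕ} (f : I → J) (hf : ∀ i, w' (f i) ≤ w i) :
    push f hf ∘ₗ incl w = incl w' ∘ₗ Finsupp.lmapDomain ℂ ℂ f := by
  classical
  ext i j
  change ∑' i' : {i' // f i' = j}, Finsupp.single i (1 : ℂ) i' =
    Finsupp.mapDomain f (Finsupp.single i (1 : ℂ)) j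
  rw [Finsupp.mapDomain_single]
  by_cases h : f i = j
  · rw [tsum_eq_single ⟨i, h⟩]
    · simp [h]
    · intro b hb
      exact Finsupp.single_eq_of_ne fun hbi => hb (Subtype.ext hbi)
  · rw [Finsupp.single_eq_of_ne (Ne.symm h)]
    rw [tsum_congr (g := fun _ => 0), tsum_zero]
    intro b
    exact Finsupp.single_eq_of_ne fun hbi => h (by rw [← hbi]; exact b.2)

end RapidDecay

end Weighted

/-! ## Complexes with an alternating sum of faces as differential -/

section Alternating
variable {M : ℕ → Type u} [∀ n, AddCommGroup (M n)] [∀ n, Module ℂ (M n)]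

/-- The alternating sum `∑ⱼ (-1)^j δⱼ`. -/
def alternatingSum (δ : ∀ n : ℕ, Fin (n + 2) → M (n + 1) →ₗ[ℂ] M n) (n : ℕ) :
    M (n + 1) →ₗ[ℂ] M n :=
  ∑ j : Fin (n + 2), (-1 : ℂ) ^ (j : ℕ) • δ n j

theorem alternatingSum_comp (δ : ∀ n : ℕ, Fin (n + 2) → M (n + 1) →ₗ[ℂ] M n)
    (hδ : ∀ (n : ℕ) (i j : Fin (n + 2)), i ≤ j →
      δ n i ∘ₗ δ (n + 1) j.succ = δ n j ∘ₗ δ (n + 1) i.castSucc) (n : ℕ) :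
    alternatingSum δ n ∘ₗ alternatingSum δ (n + 1) = 0 := by
  ext c
  simp only [alternatingSum, LinearMap.comp_apply, LinearMap.sum_apply, map_sum,
    LinearMap.smul_apply, map_smul, LinearMap.zero_apply, Finset.smul_sum, smul_smul]
  rw [Finset.sum_comm]
  simp only [← Finset.sum_product']
  let P := Fin (n + 2) × Fin (n + 3)
  let S : Finset P := {ij : P | (ij.2 : ℕ) ≤ (ij.1 : ℕ)}
  rw [Finset.univ_product_univ, ← Finset.sum_add_sum_compl S, ← eq_neg_iff_add_eq_zero,
    ← Finset.sum_neg_distrib]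
  let φ : ∀ ij : P, ij ∈ S → P := fun ij hij =>
    (Fin.castLT ij.2 (lt_of_le_of_lt (Finset.mem_filter.mp hij).right (Fin.is_lt ij.1)), ij.1.succ)
  apply Finset.sum_bij φ
  · intro ij hij
    simp_rw [S, φ, Finset.compl_filter, Finset.mem_filter_univ, Fin.val_succ,
      Fin.val_castLT] at hij ⊢
    lia
  · rintro ⟨i, j⟩ hij ⟨i', j'⟩ hij' h
    rw [Prod.mk_inj]
    exact ⟨by simpa [φ] using! congr_arg Prod.snd h,
      by simpa [φ, Fin.castSucc_castLT] using! congr_arg Fin.castSucc (congr_arg Prod.fst h)⟩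
  · rintro ⟨i', j'⟩ hij'
    simp_rw [S, Finset.compl_filter, Finset.mem_filter_univ, not_le] at hij'
    refine ⟨(j'.pred <| ?_, Fin.castSucc i'), ?_, ?_⟩
    · rintro rfl
      simp only [Fin.val_zero, not_lt_zero] at hij'
    · simpa [S] using! Nat.le_sub_one_of_lt hij'
    · simp only [φ, Fin.castLT_castSucc, Fin.succ_pred]
  · rintro ⟨i, j⟩ hij
    have hij' : (j : ℕ) ≤ i := by simpa [S] using! hij
    have h := LinearMap.congr_fun (hδ n (j.castLT (lt_of_le_of_lt hij' i.2)) i hij') c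
    rw [Fin.castSucc_castLT, LinearMap.comp_apply, LinearMap.comp_apply] at h
    simp only [← neg_smul, φ, h]
    congr 1
    simp only [Fin.val_succ, Fin.val_castLT, pow_succ]
    ring

/-- The chain complex with differentials `∑ⱼ (-1)^j δⱼ`. -/
def alternatingComplex (δ : ∀ n : ℕ, Fin (n + 2) → M (n + 1) →ₗ[ℂ] M n)
    (hδ : ∀ (n : ℕ) (i j : Fin (n + 2)), i ≤ j →
      δ n i ∘ₗ δ (n + 1) j.succ = δ n j ∘ₗ δ (n + 1) i.castSucc) :
    ChainComplex (ModuleCat.{u} ℂ) ℕ :=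
  ChainComplex.of (fun n => ModuleCat.of ℂ (M n)) (fun n => ModuleCat.ofHom (alternatingSum δ n))
    (fun n => by
      rw [← ModuleCat.ofHom_comp, alternatingSum_comp δ hδ]
      rfl)

end Alternating

/-! ## The localized Hochschild complexes and the comparison map -/

section Hochschild

variable {G : Type u} [Group G]

/-- `C_•(ℂG)_x`, the part of the Hochschild complex of the group ring `ℂG` that belongs to the
conjugacy class `x`: under the identification of `ℂG ⊗ ⋯ ⊗ ℂG` with `ℂ[G × ⋯ × G]` it is spanned by
the tuples `(g₀, …, gₙ)` with `g₀ ⋯ gₙ ∈ x`, and the differential is the Hochschild boundary. -/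
def hochschildComplex (x : ConjClasses G) : ChainComplex (ModuleCat.{u} ℂ) ℕ :=
  alternatingComplex (M := fun n => ClassTuple x n →₀ ℂ)
    (fun _ j => Finsupp.lmapDomain ℂ ℂ (ClassTuple.face j))
    (fun n i j hij => by
      rw [← Finsupp.lmapDomain_comp, ← Finsupp.lmapDomain_comp, ClassTuple.face_comp i j hij])

/-- `C_•(ℓ¹_∞ G)_x`, the completion of `C_•(ℂG)_x` with respect to the norms induced from the
completed projective tensor product `ℓ¹_∞ G ⊗ ⋯ ⊗ ℓ¹_∞ G`. The projective tensor product of the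
norms `∑_g |f g| (1 + |g|)^k` is the norm `∑ |c(g₀, …, gₙ)| ∏ᵢ (1 + |gᵢ|)^k` on functions on
`G × ⋯ × G`. The differential is the continuous extension of the Hochschild boundary. -/
def rdHochschildComplex (S : FinSymmGenSet G) (x : ConjClasses G) :
    ChainComplex (ModuleCat.{u} ℂ) ℕ :=
  alternatingComplex (M := fun n => RapidDecay (fun g : ClassTuple x n => g.weight S))
    (fun _ j => RapidDecay.push (ClassTuple.face j) (ClassTuple.weight_face_le S j))
    (fun n i j hij => by
      simp only [RapidDecay.push_comp_push, ClassTuple.face_comp i j hij])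

/-- The chain map `C_•(ℂG)_x → C_•(ℓ¹_∞ G)_x` given by the inclusion into the completion. -/
def hochschildComparison (S : FinSymmGenSet G) (x : ConjClasses G) :
    hochschildComplex x ⟶ rdHochschildComplex S x :=
  ChainComplex.ofHom (fun n => ModuleCat.ofHom (RapidDecay.incl fun g : ClassTuple x n =>
    g.weight S)) fun n => by
      simp only [hochschildComplex, rdHochschildComplex, alternatingComplex, ChainComplex.of_d]
      rw [← ModuleCat.ofHom_comp, ← ModuleCat.ofHom_comp]
      congr 1
      refine LinearMap.ext fun c => ?_
      simp only [alternatingSum, LinearMap.comp_apply, LinearMap.sum_apply, LinearMap.smul_apply,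
        map_sum, map_smul]
      refine Finset.sum_congr rfl fun j _ => ?_
      congr 1
      exact LinearMap.congr_fun
        (RapidDecay.push_comp_incl (ClassTuple.face j) (ClassTuple.weight_face_le S j)) c

/-- The Hochschild homology `HH_n(ℂG)_x`. -/
abbrev HH (x : ConjClasses G) (n : ℕ) : ModuleCat.{u} ℂ :=
  (hochschildComplex x).homology n

/-- The continuous Hochschild homology `HH^cont_n(ℓ¹_∞ G)_x`. -/
abbrev HHcont (S : FinSymmGenSet G) (x : ConjClasses G) (n : ℕ) : ModuleCat.{u} ℂ :=
  (rdHochschildComplex S x).homology n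

/-- The map `HH_n(ℂG)_x → HH^cont_n(ℓ¹_∞ G)_x` induced by the inclusion. -/
def HHcomparison (S : FinSymmGenSet G) (x : ConjClasses G) (n : ℕ) :
    HH x n ⟶ HHcont S x n :=
  HomologicalComplex.homologyMap (hochschildComparison S x) n

end Hochschild

end

/-!
The tuples of class `[e]` are the `G`-orbits of homogeneous tuples `(t₀, …, tₙ)`, so the Hochschild
complex of class `[e]` is the complex of coinvariants of the ordered chains `C_•(G)`. An equivariant
operator on `C_•(G)` that increases norm and diameter at most polynomially extends to the
completion.

Filling inductively by simplicial chains gives a chain map `C_•(G) → C_•(EG)`; compose it with the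
map induced by an equivariant map from the vertices of `EG` to `G`. Since `EG` has finite skeleta,
the values of this composite involve finitely many orbits in each degree, so its extension sends
rapidly decaying chains to finitely supported ones. It is homotopic to the identity by coning, with
a homotopy of polynomial growth; hence it is a homotopy inverse of the inclusion.

That every cycle has a filling follows from the contractibility of `EG`: cut up a cone over the
cycle by barycentric subdivision, and map it back to the complex. The Dehn functions bound the norm
of a filling. To bound its support too, discard the part of the filling beyond a level set of the
distance that crosses none of its simplices: such a level exists within a distance of the boundary
bounded by the norm. In the lowest degree, where no Dehn function is available, fill along words in
the generators.
-/

noncomputable section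

/-! ## `ℓ¹`-norms of integral chains -/

section LOneNorm

variable {I J : Type*}

/-- The `ℓ¹`-norm of a finitely supported integral function. -/
def lOne (c : I →₀ ℤ) : ℕ := c.sum fun _ z => z.natAbs

theorem lOne_eq_sum (c : I →₀ ℤ) : lOne c = ∑ i ∈ c.support, (c i).natAbs := rfl

theorem lOne_eq_sum_of_subset {c : I →₀ ℤ} {s : Finset I} (h : c.support ⊆ s) :
    lOne c = ∑ i ∈ s, (c i).natAbs :=
  Finsupp.sum_of_support_subset _ h _ (by simp)

@[simp] theorem lOne_zero : lOne (0 : I →₀ ℤ) = 0 := by simp [lOne]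

@[simp] theorem lOne_single (i : I) (z : ℤ) : lOne (Finsupp.single i z) = z.natAbs := by
  simp [lOne]

theorem lOne_add_le (a b : I →₀ ℤ) : lOne (a + b) ≤ lOne a + lOne b := by
  classical
  rw [lOne_eq_sum_of_subset (Finsupp.support_add (g₁ := a) (g₂ := b)),
    lOne_eq_sum_of_subset (Finset.subset_union_left (s₁ := a.support) (s₂ := b.support)),
    lOne_eq_sum_of_subset (Finset.subset_union_right (s₁ := a.support) (s₂ := b.support)),
    ← Finset.sum_add_distrib]
  exact Finset.sum_le_sum fun i _ => Int.natAbs_add_le _ _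

theorem lOne_smul (r : ℤ) (a : I →₀ ℤ) : lOne (r • a) = r.natAbs * lOne a := by
  rw [lOne_eq_sum_of_subset (Finsupp.support_smul (b := r) (g := a)), lOne_eq_sum,
    Finset.mul_sum]
  simp [Int.natAbs_mul]

@[simp] theorem lOne_neg (a : I →₀ ℤ) : lOne (-a) = lOne a := by
  simpa using lOne_smul (-1) a

theorem lOne_sub_le (a b : I →₀ ℤ) : lOne (a - b) ≤ lOne a + lOne b := by
  simpa [sub_eq_add_neg] using lOne_add_le a (-b)

theorem lOne_sum_le {K : Type*} (s : Finset K) (f : K → I →₀ ℤ) :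
    lOne (∑ k ∈ s, f k) ≤ ∑ k ∈ s, lOne (f k) := by
  classical
  induction s using Finset.induction_on with
  | empty => simp
  | insert a s ha ih =>
    rw [Finset.sum_insert ha, Finset.sum_insert ha]
    exact (lOne_add_le _ _).trans (by omega)

theorem card_support_le_lOne (c : I →₀ ℤ) : c.support.card ≤ lOne c := by
  rw [lOne_eq_sum, Finset.card_eq_sum_ones]
  exact Finset.sum_le_sum fun i hi =>
    Nat.one_le_iff_ne_zero.mpr (by simpa using hi)

theorem lOne_linearMap_le (F : (I →₀ ℤ) →ₗ[ℤ] (J →₀ ℤ)) (c : I →₀ ℤ) (C : ℕ)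
    (h : ∀ i ∈ c.support, lOne (F (Finsupp.single i 1)) ≤ C) : lOne (F c) ≤ C * lOne c := by
  have hc : F c = ∑ i ∈ c.support, c i • F (Finsupp.single i 1) := by
    conv_lhs => rw [← Finsupp.sum_single c]
    rw [Finsupp.sum, map_sum]
    refine Finset.sum_congr rfl fun i _ => ?_
    rw [← map_smul, Finsupp.smul_single_one]
  rw [hc, lOne_eq_sum c, Finset.mul_sum]
  refine (lOne_sum_le _ _).trans (Finset.sum_le_sum fun i hi => ?_)
  rw [lOne_smul, mul_comm]
  exact Nat.mul_le_mul_right _ (h i hi)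

theorem lOne_mapDomain_le (f : I → J) (c : I →₀ ℤ) : lOne (c.mapDomain f) ≤ lOne c := by
  simpa using lOne_linearMap_le (Finsupp.lmapDomain ℤ ℤ f) c 1 (by simp)

theorem map_mem_of_mem_supported {R M : Type*} [Semiring R] [AddCommMonoid M] [Module R M]
    {S : Set I} {N : Submodule R M} (F : (I →₀ R) →ₗ[R] M)
    (h : ∀ i ∈ S, F (Finsupp.single i 1) ∈ N) {c : I →₀ R}
    (hc : c ∈ Finsupp.supported R R S) : F c ∈ N := by
  rw [Finsupp.supported_eq_span_single] at hc
  exact (Submodule.span_le (p := N.comap F)).mpr (Set.forall_mem_image.mpr h) hc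

theorem linearMap_eq_of_mem_supported {R M : Type*} [Semiring R] [AddCommMonoid M] [Module R M]
    {S : Set I} {F F' : (I →₀ R) →ₗ[R] M}
    (h : ∀ i ∈ S, F (Finsupp.single i 1) = F' (Finsupp.single i 1)) {c : I →₀ R}
    (hc : c ∈ Finsupp.supported R R S) : F c = F' c :=
  map_mem_of_mem_supported (N := LinearMap.eqLocus F F') LinearMap.id h hc

theorem mapDomain_mem_supported {R M : Type*} [Semiring R] [AddCommMonoid M] [Module R M]
    {S : Set I} {T : Set J} {f : I → J} (h : ∀ i ∈ S, f i ∈ T) {c : I →₀ M}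
    (hc : c ∈ Finsupp.supported M R S) : c.mapDomain f ∈ Finsupp.supported M R T :=
  Finsupp.supported_comap_lmapDomain M R f T (Finsupp.supported_mono h hc)

end LOneNorm

/-! ## Augmented ordered chains -/

/-- The integral ordered chains on tuples of `n` elements of `X`, that is, in dimension `n - 1`. The
chains on the empty tuple make this the augmented complex. -/
abbrev OrdChain (X : Type*) (n : ℕ) : Type _ := (Fin n → X) →₀ ℤ

namespace OrdChain

variable {X Y Z : Type*} {n : ℕ}

/-- The basis element of a tuple. -/
abbrev of (t : Fin n → X) : OrdChain X n := Finsupp.single t 1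

/-- The boundary operator. -/
def bd (n : ℕ) : OrdChain X (n + 1) →ₗ[ℤ] OrdChain X n :=
  ∑ i : Fin (n + 1), (-1 : ℤ) ^ (i : ℕ) • Finsupp.lmapDomain ℤ ℤ (fun t => i.removeNth t)

theorem bd_of (t : Fin (n + 1) → X) :
    bd n (of t) = ∑ i : Fin (n + 1), (-1 : ℤ) ^ (i : ℕ) • of (i.removeNth t) := by
  simp [bd]

/-- The cone with apex `p`. -/
def cone (p : X) : OrdChain X n →ₗ[ℤ] OrdChain X (n + 1) :=
  Finsupp.lmapDomain ℤ ℤ fun t => Fin.cons p t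

@[simp] theorem cone_of (p : X) (t : Fin n → X) : cone p (of t) = of (Fin.cons p t) := by
  simp [cone]

/-- The functoriality of ordered chains. -/
def map (f : X → Y) : OrdChain X n →ₗ[ℤ] OrdChain Y n :=
  Finsupp.lmapDomain ℤ ℤ (f ∘ ·)

@[simp] theorem map_of (f : X → Y) (t : Fin n → X) : map f (of t) = of (f ∘ t) := by
  simp [map]

@[ext] theorem hom_ext {M : Type*} [AddCommGroup M] {F F' : OrdChain X n →ₗ[ℤ] M}
    (h : ∀ t, F (of t) = F' (of t)) : F = F' := by
  ext t
  exact h t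

theorem bd_cone_of (p : X) (t : Fin (n + 1) → X) :
    bd (n + 1) (cone p (of t)) = of t - cone p (bd n (of t)) := by
  rw [cone_of, bd_of, bd_of, Fin.sum_univ_succ, map_sum, sub_eq_add_neg, ← Finset.sum_neg_distrib]
  congr 1
  · simp
  · refine Finset.sum_congr rfl fun i _ => ?_
    rw [map_smul, cone_of, Fin.val_succ, pow_succ, mul_neg_one, neg_smul]
    congr 3
    funext j
    refine Fin.cases ?_ (fun j => ?_) j <;> simp [Fin.removeNth]

theorem bd_cone (p : X) (c : OrdChain X (n + 1)) :
    bd (n + 1) (cone p c) = c - cone p (bd n c) := by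
  have : bd (n + 1) ∘ₗ cone p = LinearMap.id - cone p ∘ₗ bd n :=
    hom_ext fun t => bd_cone_of p t
  exact LinearMap.congr_fun this c

theorem bd_cone_zero (p : X) (c : OrdChain X 0) : bd 0 (cone p c) = c := by
  have : bd 0 ∘ₗ cone p = LinearMap.id := hom_ext fun t => by
    rw [LinearMap.comp_apply, cone_of, bd_of]
    simp
  exact LinearMap.congr_fun this c

theorem bd_cone_of_bd_eq_zero (p : X) {c : OrdChain X (n + 1)} (h : bd n c = 0) :
    bd (n + 1) (cone p c) = c := by
  rw [bd_cone, h, map_zero, sub_zero]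

theorem bd_bd (c : OrdChain X (n + 2)) : bd n (bd (n + 1) c) = 0 := by
  suffices h : ∀ n, (bd n ∘ₗ bd (n + 1) : OrdChain X (n + 2) →ₗ[ℤ] OrdChain X n) = 0 from
    LinearMap.congr_fun (h n) c
  intro n
  induction n with
  | zero =>
    refine hom_ext fun t => ?_
    rw [← Fin.cons_self_tail t, ← cone_of, LinearMap.comp_apply, bd_cone, map_sub, bd_cone_zero,
      sub_self, LinearMap.zero_apply]
  | succ n ih =>
    refine hom_ext fun t => ?_
    have := LinearMap.congr_fun ih (of (Fin.tail t))
    rw [LinearMap.comp_apply] at this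
    rw [← Fin.cons_self_tail t, ← cone_of, LinearMap.comp_apply, bd_cone, map_sub, bd_cone,
      this]
    simp

theorem map_bd (f : X → Y) (c : OrdChain X (n + 1)) : map f (bd n c) = bd n (map f c) := by
  have : map f ∘ₗ bd n = bd n ∘ₗ map f := hom_ext fun t => by
    simp only [LinearMap.comp_apply, bd_of, map_sum, map_smul, map_of]
    rfl
  exact LinearMap.congr_fun this c

theorem map_cone (f : X → Y) (p : X) (c : OrdChain X n) :
    map f (cone p c) = cone (f p) (map f c) := by
  have : map f ∘ₗ cone p = cone (f p) ∘ₗ map (n := n) f := hom_ext fun t => by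
    simp only [LinearMap.comp_apply, cone_of, map_of]
    congr 1
    funext j
    refine Fin.cases ?_ (fun j => ?_) j <;> simp
  exact LinearMap.congr_fun this c

theorem map_map (f : X → Y) (g : Y → Z) (c : OrdChain X n) :
    map g (map f c) = map (g ∘ f) c := by
  have : map g ∘ₗ map f = map (n := n) (g ∘ f) := hom_ext fun t => by
    simp [Function.comp_assoc]
  exact LinearMap.congr_fun this c

theorem map_id (c : OrdChain X n) : map id c = c := by
  have : map (n := n) (id : X → X) = LinearMap.id := hom_ext fun t => by simp
  exact LinearMap.congr_fun this c

theorem lOne_bd_le (c : OrdChain X (n + 1)) : lOne (bd n c) ≤ (n + 1) * lOne c := by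
  refine lOne_linearMap_le _ _ _ fun t _ => ?_
  rw [bd_of]
  refine (lOne_sum_le _ _).trans ?_
  simp [Int.natAbs_pow]

theorem lOne_cone_le (p : X) (c : OrdChain X n) : lOne (cone p c) ≤ lOne c :=
  lOne_mapDomain_le _ _

theorem lOne_map_le (f : X → Y) (c : OrdChain X n) : lOne (map f c) ≤ lOne c :=
  lOne_mapDomain_le _ _

/-- The linear extension of a map defined on tuples; it is used to define operators on chains by
recursion on the dimension. -/
def lift {M : Type*} [AddCommGroup M] (F : (Fin n → X) → M) : OrdChain X n →ₗ[ℤ] M :=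
  Finsupp.linearCombination ℤ F

@[simp] theorem lift_of {M : Type*} [AddCommGroup M] (F : (Fin n → X) → M) (t : Fin n → X) :
    lift F (of t) = F t := by
  simp [lift]

/-- The chains on tuples in `S`. -/
abbrev supp (S : Set (Fin n → X)) : Submodule ℤ (OrdChain X n) := Finsupp.supported ℤ ℤ S

theorem of_mem {S : Set (Fin n → X)} {t : Fin n → X} (h : t ∈ S) : of t ∈ supp S :=
  Finsupp.single_mem_supported ℤ 1 h

theorem supp_mono {S T : Set (Fin n → X)} {c : OrdChain X n} (hc : c ∈ supp S)
    (h : ∀ t ∈ S, t ∈ T) : c ∈ supp T :=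
  Finsupp.supported_mono h hc

theorem map_mem {S : Set (Fin n → X)} {T : Set (Fin n → Y)} {f : X → Y}
    (h : ∀ t ∈ S, f ∘ t ∈ T) {c : OrdChain X n} (hc : c ∈ supp S) : map f c ∈ supp T :=
  mapDomain_mem_supported h hc

theorem cone_mem {S : Set (Fin n → X)} {T : Set (Fin (n + 1) → X)} {p : X}
    (h : ∀ t ∈ S, Fin.cons p t ∈ T) {c : OrdChain X n} (hc : c ∈ supp S) : cone p c ∈ supp T :=
  mapDomain_mem_supported h hc

theorem bd_mem {S : Set (Fin (n + 1) → X)} {T : Set (Fin n → X)}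
    (h : ∀ t ∈ S, ∀ i : Fin (n + 1), i.removeNth t ∈ T) {c : OrdChain X (n + 1)}
    (hc : c ∈ supp S) : bd n c ∈ supp T := by
  refine map_mem_of_mem_supported _ (fun t ht => ?_) hc
  rw [show Finsupp.single t (1 : ℤ) = of t from rfl, bd_of]
  exact Submodule.sum_mem _ fun i _ => Submodule.smul_mem _ _ (of_mem (h t ht i))

/-- The tuples with entries in `U`. -/
def tuples (U : Set X) (n : ℕ) : Set (Fin n → X) := {t | ∀ i, t i ∈ U}

theorem removeNth_mem_tuples {U : Set X} {t : Fin (n + 1) → X} (h : t ∈ tuples U (n + 1))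
    (i : Fin (n + 1)) : i.removeNth t ∈ tuples U n := fun _ => h _

theorem cons_mem_tuples {U : Set X} {t : Fin n → X} {p : X} (hp : p ∈ U) (h : t ∈ tuples U n) :
    (Fin.cons p t : Fin (n + 1) → X) ∈ tuples U (n + 1) :=
  Fin.cases hp h

theorem tuples_mono {U U' : Set X} (h : U ⊆ U') : tuples U n ⊆ tuples U' n :=
  fun _ ht i => h (ht i)

theorem bd_mem_tuples {U : Set X} {c : OrdChain X (n + 1)} (hc : c ∈ supp (tuples U (n + 1))) :
    bd n c ∈ supp (tuples U n) :=
  bd_mem (fun _ ht i => removeNth_mem_tuples ht i) hc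

theorem cone_mem_tuples {U : Set X} {p : X} (hp : p ∈ U) {c : OrdChain X n}
    (hc : c ∈ supp (tuples U n)) : cone p c ∈ supp (tuples U (n + 1)) :=
  cone_mem (fun _ ht => cons_mem_tuples hp ht) hc

/-- The chain homotopy between the identity and a chain map `f` that is defined inductively by
cones: the apex used for a tuple `t` of `n + 1` points is `p n t`. -/
def coneHomotopy (f : ∀ n, OrdChain X n →ₗ[ℤ] OrdChain X n) (p : ∀ n, (Fin (n + 1) → X) → X) :
    ∀ n : ℕ, OrdChain X n →ₗ[ℤ] OrdChain X (n + 1)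
  | 0 => 0
  | n + 1 => lift fun t =>
      cone (p n t) (of t - f (n + 1) (of t) - coneHomotopy f p n (bd n (of t)))

section ConeHomotopy

variable {f : ∀ n, OrdChain X n →ₗ[ℤ] OrdChain X n} {p : ∀ n, (Fin (n + 1) → X) → X}

theorem coneHomotopy_of (t : Fin (n + 1) → X) : coneHomotopy f p (n + 1) (of t) =
    cone (p n t) (of t - f (n + 1) (of t) - coneHomotopy f p n (bd n (of t))) := by
  rw [coneHomotopy, lift_of]

theorem bd_coneHomotopy (hf₀ : f 0 = LinearMap.id)
    (hf : ∀ n c, bd n (f (n + 1) c) = f n (bd n c)) (c : OrdChain X (n + 1)) :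
    bd (n + 1) (coneHomotopy f p (n + 1) c) =
      c - f (n + 1) c - coneHomotopy f p n (bd n c) := by
  suffices h : ∀ n, bd (n + 1) ∘ₗ coneHomotopy f p (n + 1) =
      LinearMap.id - f (n + 1) - coneHomotopy f p n ∘ₗ bd n from LinearMap.congr_fun (h n) c
  have key : ∀ n (t : Fin (n + 1) → X),
      bd n (coneHomotopy f p n (bd n (of t))) = bd n (of t) - f n (bd n (of t)) →
      (bd (n + 1) ∘ₗ coneHomotopy f p (n + 1)) (of t) =
        of t - f (n + 1) (of t) - coneHomotopy f p n (bd n (of t)) := by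
    intro n t h
    simp only [LinearMap.comp_apply, coneHomotopy_of, bd_cone, map_sub, h, hf]
    abel
  intro n
  induction n with
  | zero => exact hom_ext fun t => key 0 t (by simp [coneHomotopy, hf₀])
  | succ n ih =>
    refine hom_ext fun t => key (n + 1) t ?_
    have := LinearMap.congr_fun ih (bd (n + 1) (of t))
    simpa only [LinearMap.comp_apply, LinearMap.sub_apply, LinearMap.id_apply, bd_bd, map_zero,
      sub_zero] using this

theorem coneHomotopy_mem_tuples {U : Set X} (hp : ∀ n, ∀ t ∈ tuples U (n + 1), p n t ∈ U)
    (hf : ∀ n, ∀ c ∈ supp (tuples U n), f n c ∈ supp (tuples U n)) {c : OrdChain X n}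
    (hc : c ∈ supp (tuples U n)) : coneHomotopy f p n c ∈ supp (tuples U (n + 1)) := by
  induction n with
  | zero => exact Submodule.zero_mem _
  | succ n ih =>
    refine map_mem_of_mem_supported _ (fun t ht => ?_) hc
    have ht' := of_mem ht
    rw [coneHomotopy_of]
    exact cone_mem_tuples (hp n t ht)
      (Submodule.sub_mem _ (Submodule.sub_mem _ ht' (hf _ _ ht')) (ih (bd_mem_tuples ht')))

theorem exists_lOne_coneHomotopy_le {A : ℕ → ℕ} (hf : ∀ n c, lOne (f n c) ≤ A n * lOne c)
    (n : ℕ) : ∃ C, ∀ c, lOne (coneHomotopy f p n c) ≤ C * lOne c := by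
  induction n with
  | zero => exact ⟨0, fun c => by simp [coneHomotopy]⟩
  | succ n ih =>
    obtain ⟨C, hC⟩ := ih
    refine ⟨1 + A (n + 1) + C * (n + 1), fun c => lOne_linearMap_le _ _ _ fun t _ => ?_⟩
    have hlOne_f : lOne (f (n + 1) (of t)) ≤ A (n + 1) := by simpa using hf (n + 1) (of t)
    have hlOne_bd : lOne (bd n (of t)) ≤ n + 1 := by simpa using lOne_bd_le (of t)
    have hlOne_h := (hC (bd n (of t))).trans (Nat.mul_le_mul_left C hlOne_bd)
    rw [show Finsupp.single t (1 : ℤ) = of t from rfl, coneHomotopy_of]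
    refine (lOne_cone_le _ _).trans ((lOne_sub_le _ _).trans (Nat.add_le_add ?_ hlOne_h))
    exact (lOne_sub_le _ _).trans (Nat.add_le_add (by simp) hlOne_f)

end ConeHomotopy

/-- The cycles of the augmented complex. In the lowest degree `0` every chain is a cycle. -/
def IsCycle : ∀ {n : ℕ}, OrdChain X n → Prop
  | 0, _ => True
  | n + 1, c => bd n c = 0

theorem isCycle_bd (c : OrdChain X (n + 1)) : IsCycle (bd n c) := by
  cases n with
  | zero => trivial
  | succ n => exact bd_bd c

theorem bd_cone_of_isCycle (p : X) {c : OrdChain X n} (h : IsCycle c) : bd n (cone p c) = c := by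
  cases n with
  | zero => exact bd_cone_zero p c
  | succ n => exact bd_cone_of_bd_eq_zero p h

end OrdChain

/-! ## Barycentric subdivision of ordered chains in a vector space -/

namespace OrdChain

/-- The tuples all entries of which lie in a common member of `𝒞`. -/
def carried {X : Type*} (𝒞 : Set (Set X)) (n : ℕ) : Set (Fin n → X) :=
  {t | ∃ C ∈ 𝒞, ∀ i, t i ∈ C}

theorem tuples_subset_carried {X : Type*} {𝒞 : Set (Set X)} {C : Set X} (hC : C ∈ 𝒞) (n : ℕ) :
    tuples C n ⊆ carried 𝒞 n :=
  fun _ ht => ⟨C, hC, ht⟩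

theorem map_mem_carried {X : Type*} {𝒞 : Set (Set X)} {n m : ℕ}
    {F : OrdChain X n →ₗ[ℤ] OrdChain X m}
    (hF : ∀ C ∈ 𝒞, ∀ c ∈ supp (tuples C n), F c ∈ supp (tuples C m)) {c : OrdChain X n}
    (hc : c ∈ supp (carried 𝒞 n)) : F c ∈ supp (carried 𝒞 m) := by
  refine map_mem_of_mem_supported _ (fun t ht => ?_) hc
  obtain ⟨C, hC, ht⟩ := ht
  exact Finsupp.supported_mono (tuples_subset_carried hC m) (hF C hC _ (of_mem ht))

variable {E : Type*} [AddCommGroup E] [Module ℝ E] {n : ℕ}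

/-- The barycenter of a nonempty tuple. -/
def bary (t : Fin (n + 1) → E) : E := ((n : ℝ) + 1)⁻¹ • ∑ i, t i

theorem bary_mem {C : Set E} (hC : Convex ℝ C) {t : Fin (n + 1) → E} (ht : ∀ i, t i ∈ C) :
    bary t ∈ C := by
  rw [bary, Finset.smul_sum]
  refine hC.sum_mem (fun i _ => by positivity) ?_ (fun i _ => ht i)
  rw [Finset.sum_const, Finset.card_univ, Fintype.card_fin, nsmul_eq_mul]
  push_cast
  field_simp

/-- The barycentric subdivision. -/
def sd : ∀ n : ℕ, OrdChain E n →ₗ[ℤ] OrdChain E n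
  | 0 => LinearMap.id
  | n + 1 => lift fun t => cone (bary t) (sd n (bd n (of t)))

theorem sd_of (t : Fin (n + 1) → E) :
    sd (n + 1) (of t) = cone (bary t) (sd n (bd n (of t))) := by
  rw [sd, lift_of]

theorem bd_sd (c : OrdChain E (n + 1)) : bd n (sd (n + 1) c) = sd n (bd n c) := by
  suffices h : ∀ n, bd n ∘ₗ sd (n + 1) = sd n ∘ₗ bd (X := E) n from LinearMap.congr_fun (h n) c
  intro n
  induction n with
  | zero => exact hom_ext fun t => by simp only [LinearMap.comp_apply, sd_of, bd_cone_zero]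
  | succ n ih =>
    refine hom_ext fun t => ?_
    have h := LinearMap.congr_fun ih (bd (n + 1) (of t))
    simp only [LinearMap.comp_apply, bd_bd, map_zero] at h
    simp only [LinearMap.comp_apply, sd_of, bd_cone, h, map_zero, sub_zero]

theorem sd_mem_tuples {C : Set E} (hC : Convex ℝ C) {c : OrdChain E n}
    (hc : c ∈ supp (tuples C n)) : sd n c ∈ supp (tuples C n) := by
  induction n with
  | zero => exact hc
  | succ n ih =>
    refine map_mem_of_mem_supported _ (fun t ht => ?_) hc
    rw [sd_of]
    exact cone_mem_tuples (bary_mem hC ht) (ih (bd_mem_tuples (of_mem ht)))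

/-- The chain homotopy between the identity and the barycentric subdivision. -/
abbrev sdHomotopy : ∀ n : ℕ, OrdChain E n →ₗ[ℤ] OrdChain E (n + 1) :=
  coneHomotopy sd fun _ => bary

theorem iterate_sd_mem_tuples {C : Set E} (hC : Convex ℝ C) {c : OrdChain E n}
    (hc : c ∈ supp (tuples C n)) (m : ℕ) : (sd n ^ m) c ∈ supp (tuples C n) := by
  induction m with
  | zero => simpa using hc
  | succ m ih => rw [pow_succ', Module.End.mul_apply]; exact sd_mem_tuples hC ih

theorem iterate_sd_mem_carried {𝒞 : Set (Set E)} (h𝒞 : ∀ C ∈ 𝒞, Convex ℝ C) {c : OrdChain E n}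
    (hc : c ∈ supp (carried 𝒞 n)) (m : ℕ) : (sd n ^ m) c ∈ supp (carried 𝒞 n) :=
  map_mem_carried (fun C hC _ h => iterate_sd_mem_tuples (h𝒞 C hC) h m) hc

theorem sdHomotopy_mem_carried {𝒞 : Set (Set E)} (h𝒞 : ∀ C ∈ 𝒞, Convex ℝ C) {c : OrdChain E n}
    (hc : c ∈ supp (carried 𝒞 n)) : sdHomotopy n c ∈ supp (carried 𝒞 (n + 1)) :=
  map_mem_carried (fun C hC _ h => coneHomotopy_mem_tuples (fun _ _ ht => bary_mem (h𝒞 C hC) ht)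
    (fun _ _ h' => sd_mem_tuples (h𝒞 C hC) h') h) hc

theorem bd_iterate_sd (c : OrdChain E (n + 1)) (m : ℕ) :
    bd n ((sd (n + 1) ^ m) c) = (sd n ^ m) (bd n c) := by
  induction m with
  | zero => simp
  | succ m ih => rw [pow_succ', pow_succ', Module.End.mul_apply, Module.End.mul_apply, bd_sd, ih]

theorem exists_bd_eq_sub_iterate_sd {𝒞 : Set (Set E)} (h𝒞 : ∀ C ∈ 𝒞, Convex ℝ C)
    {c : OrdChain E (n + 1)} (hc : c ∈ supp (carried 𝒞 (n + 1))) (h : bd n c = 0) (m : ℕ) :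
    ∃ a ∈ supp (carried 𝒞 (n + 2)), bd (n + 1) a = c - (sd (n + 1) ^ m) c := by
  induction m with
  | zero => exact ⟨0, Submodule.zero_mem _, by simp⟩
  | succ m ih =>
    obtain ⟨a, ha, hac⟩ := ih
    refine ⟨a + sdHomotopy (n + 1) ((sd (n + 1) ^ m) c), Submodule.add_mem _ ha
      (sdHomotopy_mem_carried h𝒞 (iterate_sd_mem_carried h𝒞 hc m)), ?_⟩
    rw [map_add, hac, bd_coneHomotopy rfl fun _ => bd_sd, bd_iterate_sd, h, map_zero, map_zero,
      pow_succ', Module.End.mul_apply]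
    abel

/-- The tuples on which the functional `l` varies by at most `d`. -/
def thin (l : E →ₗ[ℝ] ℝ) (d : ℝ) (n : ℕ) : Set (Fin n → E) :=
  {t | ∀ i j, |l (t i) - l (t j)| ≤ d}

theorem abs_bary_sub_le {l : E →ₗ[ℝ] ℝ} {d : ℝ} {t : Fin (n + 1) → E}
    (ht : t ∈ thin l d (n + 1)) (i : Fin (n + 1)) :
    |l (bary t) - l (t i)| ≤ n / (n + 1) * d := by
  have hdiff : l (bary t) - l (t i) = ((n : ℝ) + 1)⁻¹ * ∑ j, (l (t j) - l (t i)) := by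
    rw [bary, map_smul, map_sum, Finset.sum_sub_distrib]
    simp only [smul_eq_mul, Finset.sum_const, Finset.card_univ, Fintype.card_fin, nsmul_eq_mul,
      Nat.cast_add, Nat.cast_one]
    field_simp
  have hsum : |∑ j, (l (t j) - l (t i))| ≤ n * d := by
    rw [Fin.sum_univ_succAbove _ i, sub_self, zero_add]
    refine (Finset.abs_sum_le_sum_abs _ _).trans
      ((Finset.sum_le_sum fun j _ => ht (i.succAbove j) i).trans ?_)
    simp
  rw [hdiff, abs_mul, abs_of_nonneg (by positivity : (0 : ℝ) ≤ ((n : ℝ) + 1)⁻¹),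
    div_eq_inv_mul, mul_assoc]
  exact mul_le_mul_of_nonneg_left hsum (by positivity)

theorem abs_bary_sub_le_of_mem_convexHull {l : E →ₗ[ℝ] ℝ} {d : ℝ} {t : Fin (n + 1) → E}
    (ht : t ∈ thin l d (n + 1)) {x : E} (hx : x ∈ convexHull ℝ (Set.range t)) :
    |l (bary t) - l x| ≤ n / (n + 1) * d := by
  have hconv : Convex ℝ (l ⁻¹' Metric.closedBall (l (bary t)) (n / (n + 1) * d)) :=
    (convex_closedBall _ _).linear_preimage l
  have hsub : Set.range t ⊆ l ⁻¹' Metric.closedBall (l (bary t)) (n / (n + 1) * d) := by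
    rintro _ ⟨i, rfl⟩
    simpa [Real.dist_eq, abs_sub_comm] using abs_bary_sub_le ht i
  simpa [Real.dist_eq, abs_sub_comm] using convexHull_min hsub hconv hx

theorem thin_mono {l : E →ₗ[ℝ] ℝ} {d d' : ℝ} (h : d ≤ d') : thin l d n ⊆ thin l d' n :=
  fun _ ht i j => (ht i j).trans h

theorem bd_mem_thin {l : E →ₗ[ℝ] ℝ} {d : ℝ} {c : OrdChain E (n + 1)}
    (hc : c ∈ supp (thin l d (n + 1))) : bd n c ∈ supp (thin l d n) :=
  bd_mem (S := thin l d (n + 1)) (T := thin l d n) (fun _ ht _ _ _ => ht _ _) hc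

theorem cons_mem_thin {l : E →ₗ[ℝ] ℝ} {d : ℝ} (hd : 0 ≤ d) {p : E} {t : Fin n → E}
    (hp : ∀ i, |l p - l (t i)| ≤ d) (ht : t ∈ thin l d n) :
    (Fin.cons p t : Fin (n + 1) → E) ∈ thin l d (n + 1) := by
  intro i j
  refine Fin.cases ?_ (fun i => ?_) i <;> refine Fin.cases ?_ (fun j => ?_) j
  · simpa using hd
  · simpa using hp j
  · simpa [abs_sub_comm] using hp i
  · simpa using ht i j

theorem sd_of_mem_thin_of_sd_bd {l : E →ₗ[ℝ] ℝ} {d : ℝ} (hd : 0 ≤ d) {t : Fin (n + 1) → E}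
    (ht : t ∈ thin l d (n + 1)) (h : sd n (bd n (of t)) ∈ supp (thin l (n / (n + 1) * d) n)) :
    sd (n + 1) (of t) ∈ supp (thin l (n / (n + 1) * d) (n + 1)) := by
  have hhull : sd n (bd n (of t)) ∈ supp (tuples (convexHull ℝ (Set.range t)) n) :=
    sd_mem_tuples (convex_convexHull ℝ _)
      (bd_mem_tuples (of_mem fun i => subset_convexHull ℝ _ ⟨i, rfl⟩))
  have hboth : sd n (bd n (of t)) ∈
      supp (tuples (convexHull ℝ (Set.range t)) n ∩ thin l (n / (n + 1) * d) n) :=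
    (Finsupp.mem_supported _ _).mpr (Set.subset_inter hhull h)
  rw [sd_of]
  exact cone_mem (fun t' ht' => cons_mem_thin (by positivity)
    (fun i => abs_bary_sub_le_of_mem_convexHull ht (ht'.1 i)) ht'.2) hboth

theorem sd_mem_thin {l : E →ₗ[ℝ] ℝ} {d : ℝ} (hd : 0 ≤ d) {c : OrdChain E (n + 1)}
    (hc : c ∈ supp (thin l d (n + 1))) :
    sd (n + 1) c ∈ supp (thin l (n / (n + 1) * d) (n + 1)) := by
  induction n with
  | zero =>
    exact map_mem_of_mem_supported _ (fun t ht => sd_of_mem_thin_of_sd_bd hd ht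
      fun _ _ i => i.elim0) hc
  | succ n ih =>
    have hratio : (n : ℝ) / (n + 1) * d ≤ (n + 1 : ℕ) / ((n + 1 : ℕ) + 1) * d := by
      refine mul_le_mul_of_nonneg_right ?_ hd
      rw [div_le_div_iff₀ (by positivity) (by positivity)]
      push_cast
      nlinarith
    exact map_mem_of_mem_supported _ (fun t ht => sd_of_mem_thin_of_sd_bd hd ht
      (Finsupp.supported_mono (thin_mono hratio) (ih (bd_mem_thin (of_mem ht))))) hc

theorem iterate_sd_mem_thin {l : E →ₗ[ℝ] ℝ} {d : ℝ} (hd : 0 ≤ d) {c : OrdChain E (n + 1)}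
    (hc : c ∈ supp (thin l d (n + 1))) (m : ℕ) :
    (sd (n + 1) ^ m) c ∈ supp (thin l ((n / (n + 1)) ^ m * d) (n + 1)) := by
  induction m with
  | zero => simpa using hc
  | succ m ih =>
    rw [pow_succ', pow_succ', Module.End.mul_apply, mul_assoc]
    exact sd_mem_thin (by positivity) ih

end OrdChain

/-! ## Acyclicity of simplicial complexes with contractible realization -/

/-- The tuples of vertices of `K` that lie in a common face; the ordered chains supported on them
are the ordered simplicial chains of `K`. -/
def OrdChain.faceTuples {V : Type u} (K : AbstractSimplicialComplex V) (n : ℕ) : Set (Fin n → V) :=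
  {t | ∃ s ∈ K.faces, ∀ i, t i ∈ s}

namespace Realization

open OrdChain

variable {V : Type u} {K : AbstractSimplicialComplex V}

theorem nonneg (y : K.Realization) (v : V) : 0 ≤ y.1 v := y.2.1 v

theorem sum_le_one (y : K.Realization) (u : Finset V) : ∑ v ∈ u, y.1 v ≤ 1 := by
  classical
  obtain ⟨s, -, h0, h1⟩ := y.2.2
  calc ∑ v ∈ u, y.1 v ≤ ∑ v ∈ u ∪ s, y.1 v :=
        Finset.sum_le_sum_of_subset_of_nonneg Finset.subset_union_left fun v _ _ => (nonneg y) v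
    _ = ∑ v ∈ s, y.1 v :=
        (Finset.sum_subset Finset.subset_union_right fun v _ hv => h0 v hv).symm
    _ = 1 := h1

theorem continuous_coord (v : V) : Continuous fun y : K.Realization => y.1 v := by
  refine continuous_iSup_dom.mpr fun s => continuous_coinduced_dom.mpr ?_
  by_cases h : v ∈ (s : Finset V)
  · have : ((fun y : K.Realization => y.1 v) ∘ K.simplexMap s) =
        fun t : stdSimplex ℝ (s : Finset V) => t.1 ⟨v, h⟩ := by
      funext t
      simp [AbstractSimplicialComplex.simplexMap, h]
    rw [this]
    exact (continuous_apply _).comp continuous_subtype_val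
  · have : ((fun y : K.Realization => y.1 v) ∘ K.simplexMap s) = fun _ => 0 := by
      funext t
      simp [AbstractSimplicialComplex.simplexMap, h]
    rw [this]
    exact continuous_const

theorem exists_maximal_coord (y : K.Realization) : ∃ v, 0 < y.1 v ∧ ∀ w, y.1 w ≤ y.1 v := by
  obtain ⟨s, hs, h0, h1⟩ := y.2.2
  obtain ⟨v, -, hmax⟩ := s.exists_max_image y.1 (K.isRelLowerSet_faces hs).1
  have hmax' : ∀ w, y.1 w ≤ y.1 v := by
    intro w
    by_cases hw : w ∈ s
    · exact hmax w hw
    · rw [h0 w hw]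
      exact (nonneg y) v
  refine ⟨v, ((nonneg y) v).lt_of_ne fun h => ?_, hmax'⟩
  have : ∑ v ∈ s, y.1 v = 0 :=
    Finset.sum_eq_zero fun w _ => le_antisymm ((hmax' w).trans h.ge) ((nonneg y) w)
  linarith

/-- A vertex with maximal barycentric coordinate. -/
def topVertex (y : K.Realization) : V := (exists_maximal_coord y).choose

theorem topVertex_pos (y : K.Realization) : 0 < y.1 (topVertex y) :=
  (exists_maximal_coord y).choose_spec.1

theorem le_topVertex (y : K.Realization) (w : V) : y.1 w ≤ y.1 (topVertex y) :=
  (exists_maximal_coord y).choose_spec.2 w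

theorem exists_isOpen_topVertex_mem (y : K.Realization) :
    ∃ U : Set K.Realization, IsOpen U ∧ y ∈ U ∧ ∃ s ∈ K.faces, ∀ y' ∈ U, (topVertex y') ∈ s := by
  classical
  obtain ⟨s, hs, -, h1⟩ := y.2.2
  refine ⟨{y' | 1 - 1 / ((s.card : ℝ) + 1) < ∑ v ∈ s, y'.1 v},
    isOpen_lt continuous_const (continuous_finsetSum s fun v _ => continuous_coord v), ?_,
    s, hs, fun y' hy' => ?_⟩
  · rw [Set.mem_ofPred_eq, h1]
    have : 0 < 1 / ((s.card : ℝ) + 1) := by positivity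
    linarith
  · by_contra hw
    rw [Set.mem_ofPred_eq] at hy'
    have ha := (sum_le_one y') (insert (topVertex y') s)
    rw [Finset.sum_insert hw] at ha
    have hb : ∑ v ∈ s, y'.1 v ≤ s.card * y'.1 (topVertex y') := by
      simpa using Finset.sum_le_card_nsmul s y'.1 _ fun v _ => (le_topVertex y') v
    have hc : y'.1 (topVertex y') < 1 / ((s.card : ℝ) + 1) := by linarith
    have hd : (s.card : ℝ) * y'.1 (topVertex y') ≤ s.card * (1 / ((s.card : ℝ) + 1)) :=
      mul_le_mul_of_nonneg_left hc.le (by positivity)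
    have he : (s.card : ℝ) * (1 / ((s.card : ℝ) + 1)) = 1 - 1 / ((s.card : ℝ) + 1) := by
      field_simp
      ring
    linarith

/-- The cone with apex `0` over the simplex spanned by `s`. -/
def coneSet (s : Finset V) : Set (V →₀ ℝ) :=
  {x | (∀ v, 0 ≤ x v) ∧ (∀ v ∉ s, x v = 0) ∧ ∑ v ∈ s, x v ≤ 1}

/-- The simplex spanned by `s`. -/
def simplexSet (s : Finset V) : Set (V →₀ ℝ) :=
  {x | (∀ v, 0 ≤ x v) ∧ (∀ v ∉ s, x v = 0) ∧ ∑ v ∈ s, x v = 1}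

theorem convex_setOf_sum_mem (s : Finset V) {T : Set ℝ} (hT : Convex ℝ T) :
    Convex ℝ {x : V →₀ ℝ | (∀ v, 0 ≤ x v) ∧ (∀ v ∉ s, x v = 0) ∧ ∑ v ∈ s, x v ∈ T} := by
  intro x hx y hy a b ha hb hab
  refine ⟨fun v => ?_, fun v hv => ?_, ?_⟩
  · have := hx.1 v
    have := hy.1 v
    simp only [Finsupp.add_apply, Finsupp.smul_apply, smul_eq_mul]
    positivity
  · simp [hx.2.1 v hv, hy.2.1 v hv]
  · simpa [Finset.sum_add_distrib, Finset.mul_sum] using hT hx.2.2 hy.2.2 ha hb hab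

theorem convex_coneSet (s : Finset V) : Convex ℝ (coneSet s) :=
  convex_setOf_sum_mem s (convex_Iic 1)

theorem convex_simplexSet (s : Finset V) : Convex ℝ (simplexSet s) :=
  convex_setOf_sum_mem s (convex_singleton 1)

theorem simplexSet_subset_coneSet (s : Finset V) : simplexSet s ⊆ coneSet s :=
  fun _ hx => ⟨hx.1, hx.2.1, hx.2.2.le⟩

theorem zero_mem_coneSet (s : Finset V) : 0 ∈ coneSet s := by simp [coneSet]

theorem single_mem_simplexSet {s : Finset V} {v : V} (hv : v ∈ s) :
    Finsupp.single v 1 ∈ simplexSet s := by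
  classical
  refine ⟨fun w => ?_, fun w hw => ?_, ?_⟩
  · rw [Finsupp.single_apply]
    split_ifs <;> norm_num
  · exact Finsupp.single_eq_of_ne fun h => hw (h ▸ hv)
  · simp [Finsupp.single_apply, hv]

theorem tuples_coneSet_subset_thin (s : Finset V) (v : V) (n : ℕ) :
    tuples (coneSet s) n ⊆ thin (Finsupp.lapply v) 1 n := by
  have hmem : ∀ x ∈ coneSet s, x v ∈ Set.Icc (0 : ℝ) 1 := by
    intro x hx
    refine ⟨hx.1 v, ?_⟩
    by_cases hv : v ∈ s
    · exact (Finset.single_le_sum (fun w _ => hx.1 w) hv).trans hx.2.2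
    · rw [hx.2.1 v hv]
      exact zero_le_one
  intro t ht i j
  exact Real.dist_le_of_mem_Icc_01 (hmem _ (ht i)) (hmem _ (ht j))

theorem degree_eq_sum_of_forall_notMem {x : V →₀ ℝ} {s : Finset V} (h : ∀ v ∉ s, x v = 0) :
    x.degree = ∑ v ∈ s, x v :=
  Finset.sum_subset (fun _ hv => by_contra fun hvs => Finsupp.mem_support_iff.mp hv (h _ hvs))
    fun _ _ hv => Finsupp.notMem_support_iff.mp hv

open Classical in
/-- The point of the realization with barycentric coordinates `x`, or `p` if there is none. -/
def toRealization (p : K.Realization) (x : V →₀ ℝ) : K.Realization :=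
  if h : ∃ y : K.Realization, y.1 = x then h.choose else p

theorem toRealization_val {p : K.Realization} {s : Finset V} (hs : s ∈ K.faces) {x : V →₀ ℝ}
    (hx : x ∈ simplexSet s) : (toRealization p x).1 = x := by
  have h : ∃ y : K.Realization, y.1 = x := ⟨⟨x, hx.1, s, hs, hx.2⟩, rfl⟩
  rw [toRealization, dif_pos h, h.choose_spec]

section Contraction

variable {p : K.Realization}
  (H : (ContinuousMap.id K.Realization).Homotopy (ContinuousMap.const _ p))

/-- The map from the cone over the realization to the realization given by a contraction. -/
def coneMap (x : V →₀ ℝ) : K.Realization :=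
  H (Set.projIcc 0 1 zero_le_one (1 - x.degree), toRealization p (x.degree⁻¹ • x))

theorem coneMap_of_mem_simplexSet {s : Finset V} (hs : s ∈ K.faces) {x : V →₀ ℝ}
    (hx : x ∈ simplexSet s) : (coneMap H x).1 = x := by
  have hdeg : x.degree = 1 := by rw [degree_eq_sum_of_forall_notMem hx.2.1, hx.2.2]
  have hproj : Set.projIcc (0 : ℝ) 1 zero_le_one 0 = 0 := Set.projIcc_left _
  rw [coneMap, hdeg, sub_self, inv_one, one_smul, hproj]
  simpa using toRealization_val hs hx

/-- The vertex assigned to a point of the cone. -/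
def coneVertex (x : V →₀ ℝ) : V := topVertex (coneMap H x)

theorem coneVertex_mem {s : Finset V} (hs : s ∈ K.faces) {x : V →₀ ℝ} (hx : x ∈ simplexSet s) :
    coneVertex H x ∈ s := by
  by_contra h
  have := topVertex_pos (coneMap H x)
  rw [coneMap_of_mem_simplexSet H hs hx] at this
  exact this.ne' (hx.2.1 _ h)

theorem coneVertex_single (v : V) : coneVertex H (Finsupp.single v 1) = v := by
  simpa using coneVertex_mem H (K.singleton_mem v)
    (single_mem_simplexSet (Finset.mem_singleton_self v))

open Classical in
/-- The extension by zero of a function on a finite set. -/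
def extend (s : Finset V) (x : s → ℝ) : V →₀ ℝ :=
  Finsupp.onFinset s (fun v => if h : v ∈ s then x ⟨v, h⟩ else 0) fun v hv => by
    by_contra h
    simp [h] at hv

theorem extend_apply_mem (s : Finset V) (x : s → ℝ) (v : s) : extend s x v = x v := by
  simp [extend]

theorem extend_apply_of_notMem (s : Finset V) (x : s → ℝ) {v : V} (hv : v ∉ s) :
    extend s x v = 0 := by
  simp [extend, hv]

theorem sum_extend (s : Finset V) (x : s → ℝ) : ∑ v ∈ s, extend s x v = ∑ v, x v := by
  rw [← Finset.sum_coe_sort]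
  exact Finset.sum_congr rfl fun v _ => extend_apply_mem s x v

theorem extend_restrict {s : Finset V} {x : V →₀ ℝ} (hx : ∀ v ∉ s, x v = 0) :
    extend s (fun v => x v) = x := by
  ext v
  by_cases hv : v ∈ s
  · exact extend_apply_mem s _ ⟨v, hv⟩
  · rw [extend_apply_of_notMem s _ hv, hx v hv]

theorem extend_mem_simplexSet {s : Finset V} {x : s → ℝ} (hx : x ∈ stdSimplex ℝ s) :
    extend s x ∈ simplexSet s := by
  refine ⟨fun v => ?_, fun v hv => extend_apply_of_notMem s x hv, by rw [sum_extend, hx.2]⟩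
  by_cases hv : v ∈ s
  · rw [extend_apply_mem s x ⟨v, hv⟩]
    exact hx.1 _
  · rw [extend_apply_of_notMem s x hv]

theorem coneMap_smul_extend (s : K.faces) (r : unitInterval) (x : stdSimplex ℝ (s : Finset V)) :
    coneMap H (extend (s : Finset V) ((r : ℝ) • x.1)) =
      H (unitInterval.symm r, K.simplexMap s x) := by
  have hsm : extend (s : Finset V) ((r : ℝ) • x.1) = (r : ℝ) • extend (s : Finset V) x.1 := by
    ext v
    by_cases hv : v ∈ (s : Finset V)
    · simp [extend, hv]
    · simp [extend, hv]
  have ht : (extend (s : Finset V) ((r : ℝ) • x.1)).degree = r := by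
    rw [degree_eq_sum_of_forall_notMem fun v hv => extend_apply_of_notMem _ _ hv, sum_extend]
    simp only [Pi.smul_apply, smul_eq_mul, ← Finset.mul_sum]
    rw [x.2.2, mul_one]
  have hp : Set.projIcc (0 : ℝ) 1 zero_le_one (1 - r) = unitInterval.symm r :=
    Set.projIcc_of_mem zero_le_one (unitInterval.symm r).2
  rw [coneMap, ht, hp]
  by_cases hr : (r : ℝ) = 0
  · have : r = 0 := Subtype.ext hr
    subst this
    simp
  · congr 2
    rw [hsm, smul_smul, inv_mul_cancel₀ hr, one_smul]
    refine Subtype.ext ?_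
    rw [toRealization_val s.2 (extend_mem_simplexSet x.2)]
    rfl

/-- The cone over a simplex as a space. -/
abbrev ConeSpace (s : Finset V) : Type u := {x : s → ℝ // (∀ v, 0 ≤ x v) ∧ ∑ v, x v ≤ 1}

/-- The quotient map from the cylinder to the cone. -/
def cylinderToCone (s : Finset V) (y : unitInterval × stdSimplex ℝ s) : ConeSpace s :=
  ⟨(y.1 : ℝ) • y.2.1, fun v => mul_nonneg y.1.2.1 (y.2.2.1 v), by
    simp only [Pi.smul_apply, smul_eq_mul, ← Finset.mul_sum]
    rw [y.2.2.2, mul_one]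
    exact y.1.2.2⟩

theorem continuous_cylinderToCone (s : Finset V) : Continuous (cylinderToCone s) := by
  unfold cylinderToCone
  fun_prop

theorem surjective_cylinderToCone {s : Finset V} (hs : s.Nonempty) :
    Function.Surjective (cylinderToCone s) := by
  classical
  intro x
  by_cases h : ∑ v, x.1 v = 0
  · obtain ⟨v, hv⟩ := hs
    refine ⟨(0, ⟨Pi.single ⟨v, hv⟩ 1, single_mem_stdSimplex ℝ _⟩), Subtype.ext (funext fun w => ?_)⟩
    have := (Finset.sum_eq_zero_iff_of_nonneg fun w _ => x.2.1 w).mp h w (Finset.mem_univ w)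
    simp [cylinderToCone, this]
  · have hpos : 0 < ∑ v, x.1 v := (Finset.sum_nonneg fun v _ => x.2.1 v).lt_of_ne (Ne.symm h)
    refine ⟨(⟨∑ v, x.1 v, hpos.le, x.2.2⟩, ⟨(∑ v, x.1 v)⁻¹ • x.1, fun v => ?_, ?_⟩),
      Subtype.ext ?_⟩
    · exact mul_nonneg (inv_nonneg.mpr hpos.le) (x.2.1 v)
    · simp only [Pi.smul_apply, smul_eq_mul, ← Finset.mul_sum]
      exact inv_mul_cancel₀ h
    · change (∑ v, x.1 v) • (∑ v, x.1 v)⁻¹ • x.1 = x.1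
      rw [smul_smul, mul_inv_cancel₀ h, one_smul]

theorem compactSpace_coneSpace {s : Finset V} (hs : s.Nonempty) : CompactSpace (ConeSpace s) :=
  (surjective_cylinderToCone hs).compactSpace (continuous_cylinderToCone s)

theorem continuous_coneMap_extend (s : K.faces) :
    Continuous fun x : ConeSpace (s : Finset V) => coneMap H (extend (s : Finset V) x.1) := by
  have hs := (K.isRelLowerSet_faces s.2).1
  have hq : IsQuotientMap (cylinderToCone (s : Finset V)) :=
    (continuous_cylinderToCone _).isClosedMap.isQuotientMap (continuous_cylinderToCone _)
      (surjective_cylinderToCone hs)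
  rw [hq.continuous_iff]
  have : (fun x : ConeSpace (s : Finset V) => coneMap H (extend (s : Finset V) x.1)) ∘
      cylinderToCone (s : Finset V) = fun y => H (unitInterval.symm y.1, K.simplexMap s y.2) :=
    funext fun y => coneMap_smul_extend H s y.1 y.2
  rw [this]
  have hc : Continuous (K.simplexMap s) :=
    continuous_iff_coinduced_le.mpr (le_iSup
      (fun s : K.faces => TopologicalSpace.coinduced (K.simplexMap s) inferInstance) s)
  fun_prop

theorem exists_coneVertex_comp_mem_faceTuples {s : Finset V} (hs : s ∈ K.faces) :
    ∃ δ > 0, ∀ (n : ℕ) (t : Fin n → V →₀ ℝ), (∀ i, t i ∈ coneSet s) →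
      (∀ v i j, |t i v - t j v| < δ) → coneVertex H ∘ t ∈ faceTuples K n := by
  have hne := (K.isRelLowerSet_faces hs).1
  have := compactSpace_coneSpace hne
  choose U hUo hUmem σ hσ hUσ using fun y : K.Realization => (exists_isOpen_topVertex_mem y)
  have hc := continuous_coneMap_extend H ⟨s, hs⟩
  obtain ⟨δ, hδ, hL⟩ := lebesgue_number_lemma_of_metric
    (c := fun y => (fun x : ConeSpace s => coneMap H (extend (s : Finset V) x.1)) ⁻¹' U y)
    isCompact_univ (fun y => (hUo y).preimage hc)
    (fun x _ => Set.mem_iUnion.mpr ⟨_, hUmem _⟩)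
  refine ⟨δ, hδ, fun n t ht hd => ?_⟩
  cases n with
  | zero => exact ⟨s, hs, fun i => i.elim0⟩
  | succ n =>
    let x : Fin (n + 1) → ConeSpace s := fun i => ⟨fun v => t i v, fun v => (ht i).1 v, by
      rw [Finset.sum_coe_sort s fun v => t i v]
      exact (ht i).2.2⟩
    obtain ⟨y, hy⟩ := hL (x 0) trivial
    refine ⟨σ y, hσ y, fun i => ?_⟩
    have hxi : x i ∈ Metric.ball (x 0) δ := by
      rw [Metric.mem_ball, Subtype.dist_eq, dist_pi_lt_iff hδ]
      exact fun v => hd v i 0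
    have := hUσ y _ (hy hxi)
    change topVertex (coneMap H (extend s fun v => t i v)) ∈ σ y at this
    rwa [extend_restrict (ht i).2.1] at this

theorem eventually_map_coneVertex_iterate_sd_mem {s : Finset V} (hs : s ∈ K.faces) {n : ℕ}
    {c : OrdChain (V →₀ ℝ) (n + 1)} (hc : c ∈ supp (tuples (coneSet s) (n + 1))) :
    ∀ᶠ m in Filter.atTop,
      map (coneVertex H) ((sd (n + 1) ^ m) c) ∈ supp (faceTuples K (n + 1)) := by
  obtain ⟨δ, hδ, hface⟩ := exists_coneVertex_comp_mem_faceTuples H hs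
  have hlt : (n : ℝ) / (n + 1) < 1 := (div_lt_one (by positivity)).mpr (lt_add_one _)
  have hpow := tendsto_pow_atTop_nhds_zero_of_lt_one (by positivity) hlt
  filter_upwards [hpow.eventually_lt_const hδ] with m hm
  have hcone : (sd (n + 1) ^ m) c ∈ supp (tuples (coneSet s) (n + 1)) :=
    iterate_sd_mem_tuples (convex_coneSet s) hc m
  have hthin : ∀ v, (sd (n + 1) ^ m) c ∈
      supp (thin (Finsupp.lapply v) (((n : ℝ) / (n + 1)) ^ m * 1) (n + 1)) := fun v =>
    iterate_sd_mem_thin zero_le_one (supp_mono hc (tuples_coneSet_subset_thin s v _)) m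
  refine map_mem (S := ((sd (n + 1) ^ m) c).support) (fun t ht => ?_)
    (Finsupp.mem_supported_support ℤ _)
  exact hface _ t (hcone ht) fun v i j => (hthin v ht i j).trans_lt (by rwa [mul_one])

theorem eventually_map_coneVertex_iterate_sd_mem_of_carried {n : ℕ}
    {c : OrdChain (V →₀ ℝ) (n + 1)} (hc : c ∈ supp (carried (coneSet '' K.faces) (n + 1))) :
    ∀ᶠ m in Filter.atTop,
      map (coneVertex H) ((sd (n + 1) ^ m) c) ∈ supp (faceTuples K (n + 1)) := by
  have h : ∀ t ∈ c.support, ∀ᶠ m in Filter.atTop,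
      map (coneVertex H) ((sd (n + 1) ^ m) (of t)) ∈ supp (faceTuples K (n + 1)) := by
    intro t ht
    obtain ⟨_, ⟨s, hs, rfl⟩, hts⟩ := hc ht
    exact eventually_map_coneVertex_iterate_sd_mem H hs (of_mem hts)
  filter_upwards [(Finset.eventually_all _).mpr h] with m hm
  exact map_mem_of_mem_supported (map (coneVertex H) ∘ₗ (sd (n + 1) ^ m)) hm
    (Finsupp.mem_supported_support ℤ c)

theorem map_coneVertex_mem {n : ℕ} {c : OrdChain (V →₀ ℝ) n}
    (hc : c ∈ supp (carried (simplexSet '' K.faces) n)) :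
    map (coneVertex H) c ∈ supp (faceTuples K n) := by
  refine map_mem ?_ hc
  rintro t ⟨_, ⟨s, hs, rfl⟩, ht⟩
  exact ⟨s, hs, fun i => coneVertex_mem H hs (ht i)⟩

theorem map_coneVertex_map_single {n : ℕ} (c : OrdChain V n) :
    map (coneVertex H) (map (Finsupp.single · 1) c) = c := by
  rw [map_map, show coneVertex H ∘ (Finsupp.single · 1) = id from funext (coneVertex_single H),
    map_id]

end Contraction

theorem map_single_mem_carried {n : ℕ} {c : OrdChain V n} (hc : c ∈ supp (faceTuples K n)) :
    map (Finsupp.single · (1 : ℝ)) c ∈ supp (carried (simplexSet '' K.faces) n) := by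
  refine map_mem ?_ hc
  rintro t ⟨s, hs, ht⟩
  exact ⟨_, ⟨s, hs, rfl⟩, fun i => single_mem_simplexSet (ht i)⟩

theorem cone_zero_mem_carried {n : ℕ} {c : OrdChain (V →₀ ℝ) n}
    (hc : c ∈ supp (carried (simplexSet '' K.faces) n)) :
    cone 0 c ∈ supp (carried (coneSet '' K.faces) (n + 1)) := by
  refine cone_mem ?_ hc
  rintro t ⟨_, ⟨s, hs, rfl⟩, ht⟩
  exact ⟨_, ⟨s, hs, rfl⟩, Fin.cases (zero_mem_coneSet s) fun i =>
    simplexSet_subset_coneSet s (ht i)⟩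

end Realization

namespace OrdChain

open Realization

-- Cone off `z` linearly, subdivide until every simplex of the cone is mapped by the contraction
-- into a vertex star, and push the cone back to the vertices.
theorem exists_bd_eq_of_contractible {V : Type u} {K : AbstractSimplicialComplex V}
    (hK : ContractibleSpace K.Realization) {n : ℕ} {z : OrdChain V (n + 1)}
    (hz : z ∈ supp (faceTuples K (n + 1))) (hbd : bd n z = 0) :
    ∃ a ∈ supp (faceTuples K (n + 2)), bd (n + 1) a = z := by
  obtain ⟨p, ⟨H⟩⟩ := id_nullhomotopic K.Realization
  let z' : OrdChain (V →₀ ℝ) (n + 1) := map (Finsupp.single · 1) z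
  have hz' : z' ∈ supp (carried (simplexSet '' K.faces) (n + 1)) := map_single_mem_carried hz
  have hbd' : bd n z' = 0 := by rw [← map_bd, hbd, map_zero]
  obtain ⟨m, hm⟩ := (eventually_map_coneVertex_iterate_sd_mem_of_carried H
    (cone_zero_mem_carried hz')).exists
  obtain ⟨a, ha, hab⟩ := exists_bd_eq_sub_iterate_sd
    (Set.forall_mem_image.mpr fun s _ => convex_simplexSet s) hz' hbd' m
  refine ⟨map (coneVertex H) ((sd (n + 2) ^ m) (cone 0 z')) + map (coneVertex H) a,
    Submodule.add_mem _ hm (map_coneVertex_mem H ha), ?_⟩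
  rw [map_add, ← map_bd, ← map_bd, bd_iterate_sd, bd_cone_of_bd_eq_zero 0 hbd', hab, map_sub,
    map_coneVertex_map_single, add_sub_cancel]

end OrdChain

/-! ## Sorting the vertices of ordered chains -/

namespace OrdChain

variable {V : Type*} [LinearOrder V] {n : ℕ}

/-- The smallest entry of a tuple. -/
def minEntry (t : Fin (n + 1) → V) : V := Finset.univ.inf' Finset.univ_nonempty t

theorem minEntry_le (t : Fin (n + 1) → V) (i : Fin (n + 1)) : minEntry t ≤ t i :=
  Finset.inf'_le _ (Finset.mem_univ i)

theorem minEntry_mem {U : Set V} {t : Fin (n + 1) → V} (ht : t ∈ tuples U (n + 1)) :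
    minEntry t ∈ U := by
  obtain ⟨i, -, hi⟩ := Finset.exists_mem_eq_inf' (Finset.univ_nonempty (α := Fin (n + 1))) t
  rw [minEntry, hi]
  exact ht i

open Classical in
/-- The cone with apex `m` on the tuples with entries greater than `m`, and `0` on all others. -/
def minCone (m : V) : OrdChain V n →ₗ[ℤ] OrdChain V (n + 1) :=
  lift fun t => if t ∈ tuples (Set.Ioi m) n then of (Fin.cons m t) else 0

theorem minCone_of_mem {m : V} {t : Fin n → V} (h : t ∈ tuples (Set.Ioi m) n) :
    minCone m (of t) = cone m (of t) := by
  rw [minCone, lift_of, if_pos h, cone_of]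

theorem minCone_eq_cone {m : V} {c : OrdChain V n} (hc : c ∈ supp (tuples (Set.Ioi m) n)) :
    minCone m c = cone m c :=
  linearMap_eq_of_mem_supported (fun _ => minCone_of_mem) hc

theorem minCone_cone (m : V) (c : OrdChain V n) : minCone m (cone m c) = 0 := by
  have : minCone m ∘ₗ cone m = (0 : OrdChain V n →ₗ[ℤ] OrdChain V (n + 2)) := hom_ext fun t => by
    rw [LinearMap.comp_apply, cone_of, minCone, lift_of, if_neg]
    · rfl
    · intro h
      exact lt_irrefl m (h 0)
  exact LinearMap.congr_fun this c

theorem lOne_minCone_le (m : V) (c : OrdChain V n) : lOne (minCone m c) ≤ lOne c := by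
  simpa using lOne_linearMap_le (minCone m) c 1 fun t _ => by
    rw [show Finsupp.single t (1 : ℤ) = of t from rfl, minCone, lift_of]
    split_ifs <;> simp

/-- The strictly increasing tuples with entries in `U`. -/
def sortedTuples (U : Set V) (n : ℕ) : Set (Fin n → V) := {t | StrictMono t ∧ t ∈ tuples U n}

theorem minCone_mem_sortedTuples {U : Set V} {m : V} (hm : m ∈ U) {c : OrdChain V n}
    (hc : c ∈ supp (sortedTuples U n)) : minCone m c ∈ supp (sortedTuples U (n + 1)) := by
  refine map_mem_of_mem_supported _ (fun t ht => ?_) hc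
  rw [show Finsupp.single t (1 : ℤ) = of t from rfl, minCone, lift_of]
  split_ifs with h
  · refine of_mem ⟨?_, cons_mem_tuples hm ht.2⟩
    intro i j
    refine Fin.cases ?_ (fun i => ?_) i <;> refine Fin.cases ?_ (fun j => ?_) j
    · simp
    · intro _
      simpa using h j
    · simp
    · simpa using fun hij => ht.1 hij
  · exact Submodule.zero_mem _

theorem bd_minCone_of {m : V} {t : Fin (n + 1) → V} (ht : t ∈ sortedTuples (Set.Ici m) (n + 1)) :
    bd (n + 1) (minCone m (of t)) = of t - minCone m (bd n (of t)) := by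
  rcases (ht.2 0 : m ≤ t 0).lt_or_eq with h0 | h0
  · have htm : t ∈ tuples (Set.Ioi m) (n + 1) := fun i =>
      h0.trans_le (ht.1.monotone (Fin.zero_le i))
    rw [minCone_of_mem htm, minCone_eq_cone (bd_mem_tuples (of_mem htm)), bd_cone]
  · have htail : Fin.tail t ∈ tuples (Set.Ioi m) n := fun i => by
      rw [Set.mem_Ioi, h0]
      exact ht.1 (Fin.succ_pos i)
    have hcons : of t = cone m (of (Fin.tail t)) := by
      rw [cone_of, h0, Fin.cons_self_tail]
    rw [hcons, minCone_cone, map_zero]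
    cases n with
    | zero => rw [bd_cone_zero, minCone_of_mem htail, sub_self]
    | succ n => rw [bd_cone, map_sub, minCone_cone, minCone_of_mem htail, sub_zero, sub_self]

theorem bd_minCone {m : V} {c : OrdChain V n}
    (hc : c ∈ supp (sortedTuples (Set.Ici m) n)) (h : IsCycle c) : bd n (minCone m c) = c := by
  cases n with
  | zero =>
    rw [minCone_eq_cone (Finsupp.supported_mono (fun t _ i => i.elim0) hc)]
    exact bd_cone_zero m c
  | succ n =>
    have hbd : bd (n + 1) (minCone m c) = c - minCone m (bd n c) :=
      linearMap_eq_of_mem_supported (F := bd (n + 1) ∘ₗ minCone m)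
        (F' := LinearMap.id - minCone m ∘ₗ bd n) (fun _ => bd_minCone_of) hc
    rw [hbd, show bd n c = 0 from h, map_zero, sub_zero]

/-- The chain map that replaces a tuple by a signed strictly increasing tuple. -/
def sort : ∀ n : ℕ, OrdChain V n →ₗ[ℤ] OrdChain V n
  | 0 => LinearMap.id
  | n + 1 => lift fun t => minCone (minEntry t) (sort n (bd n (of t)))

theorem sort_of (t : Fin (n + 1) → V) :
    sort (n + 1) (of t) = minCone (minEntry t) (sort n (bd n (of t))) := by
  rw [sort, lift_of]

theorem sort_mem {U : Set V} {c : OrdChain V n} (hc : c ∈ supp (tuples U n)) :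
    sort n c ∈ supp (sortedTuples U n) := by
  induction n with
  | zero => exact supp_mono hc fun t ht => ⟨fun i => i.elim0, ht⟩
  | succ n ih =>
    refine map_mem_of_mem_supported _ (fun t ht => ?_) hc
    rw [sort_of]
    exact minCone_mem_sortedTuples (minEntry_mem ht) (ih (bd_mem_tuples (of_mem ht)))

theorem sort_mem_tuples {U : Set V} {c : OrdChain V n} (hc : c ∈ supp (tuples U n)) :
    sort n c ∈ supp (tuples U n) :=
  Finsupp.supported_mono (fun _ ht => ht.2) (sort_mem hc)

theorem bd_sort_of {t : Fin (n + 1) → V} (h : IsCycle (sort n (bd n (of t)))) :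
    bd n (sort (n + 1) (of t)) = sort n (bd n (of t)) := by
  have ht : t ∈ tuples (Set.Ici (minEntry t)) (n + 1) := minEntry_le t
  rw [sort_of]
  exact bd_minCone (sort_mem (bd_mem_tuples (of_mem ht))) h

theorem bd_comp_sort (n : ℕ) : bd n ∘ₗ sort (n + 1) = sort n ∘ₗ bd (X := V) n := by
  induction n with
  | zero => exact hom_ext fun _ => bd_sort_of trivial
  | succ n ih =>
    refine hom_ext fun t => bd_sort_of ((LinearMap.congr_fun ih (bd (n + 1) (of t))).trans ?_)
    rw [LinearMap.comp_apply, bd_bd, map_zero]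

theorem bd_sort (c : OrdChain V (n + 1)) : bd n (sort (n + 1) c) = sort n (bd n c) :=
  LinearMap.congr_fun (bd_comp_sort n) c

theorem lOne_sort_le (c : OrdChain V n) : lOne (sort n c) ≤ n.factorial * lOne c := by
  induction n with
  | zero => simp [sort]
  | succ n ih =>
    refine lOne_linearMap_le _ _ _ fun t _ => ?_
    rw [show Finsupp.single t (1 : ℤ) = of t from rfl, sort_of]
    have h : lOne (bd n (of t)) ≤ n + 1 := by simpa using lOne_bd_le (of t)
    calc _ ≤ n.factorial * lOne (bd n (of t)) := (lOne_minCone_le _ _).trans (ih _)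
      _ ≤ n.factorial * (n + 1) := Nat.mul_le_mul_left _ h
      _ = (n + 1).factorial := by rw [Nat.factorial_succ, mul_comm]

/-- The chain homotopy between the identity and `sort`. -/
abbrev sortHomotopy : ∀ n : ℕ, OrdChain V n →ₗ[ℤ] OrdChain V (n + 1) :=
  coneHomotopy sort fun _ t => t 0

/-! ## Oriented and ordered simplicial chains -/

section Simplicial

open AbstractSimplicialComplex

variable {V : Type u} [LinearOrder V] {K : AbstractSimplicialComplex V} {N n : ℕ}

/-- The strictly increasing tuple of the vertices of a simplex. -/
def vertexTuple (s : K.Simplex N) : Fin (N + 1) → V :=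
  s.1.orderEmbOfFin s.2.2

theorem vertexTuple_injective :
    Function.Injective (vertexTuple : K.Simplex N → Fin (N + 1) → V) := fun s t h =>
  Subtype.ext (by simpa [vertexTuple] using congrArg Set.range h)

/-- The inclusion of the oriented chains into the ordered chains. -/
def toOrdChain : K.Chain N →ₗ[ℤ] OrdChain V (N + 1) :=
  Finsupp.lmapDomain ℤ ℤ vertexTuple

theorem toOrdChain_single (s : K.Simplex N) :
    toOrdChain (Finsupp.single s 1) = of (vertexTuple s) := by
  simp [toOrdChain]

theorem toOrdChain_injective :
    Function.Injective (toOrdChain : K.Chain N → OrdChain V (N + 1)) :=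
  Finsupp.mapDomain_injective vertexTuple_injective

theorem removeNth_vertexTuple (s : K.Simplex (N + 1)) (i : Fin (N + 2)) :
    i.removeNth (vertexTuple s) =
      vertexTuple (s.face ⟨vertexTuple s i, Finset.orderEmbOfFin_mem _ _ _⟩) := by
  refine Finset.orderEmbOfFin_unique _ (fun j => ?_) ?_
  · refine Finset.mem_erase.mpr ⟨fun h => ?_, Finset.orderEmbOfFin_mem _ _ _⟩
    exact Fin.succAbove_ne i j ((s.1.orderEmbOfFin s.2.2).injective h)
  · exact (s.1.orderEmbOfFin s.2.2).strictMono.comp (Fin.strictMono_succAbove i)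

theorem card_filter_lt_vertexTuple (s : K.Simplex N) (i : Fin (N + 1)) :
    (s.1.filter (· < vertexTuple s i)).card = i := by
  have : s.1.filter (· < vertexTuple s i) =
      (Finset.Iio i).map (s.1.orderEmbOfFin s.2.2).toEmbedding := by
    ext v
    simp only [Finset.mem_filter, Finset.mem_map, Finset.mem_Iio]
    constructor
    · rintro ⟨hv, hlt⟩
      have hv' : v ∈ Set.range (s.1.orderEmbOfFin s.2.2) := by simpa using hv
      obtain ⟨j, rfl⟩ := hv'
      exact ⟨j, (s.1.orderEmbOfFin s.2.2).lt_iff_lt.mp hlt, rfl⟩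
    · rintro ⟨j, hj, rfl⟩
      exact ⟨Finset.orderEmbOfFin_mem _ _ _, (s.1.orderEmbOfFin s.2.2).lt_iff_lt.mpr hj⟩
  rw [this, Finset.card_map, Fin.card_Iio]

theorem toOrdChain_boundary (c : K.Chain (N + 1)) :
    toOrdChain (K.boundary N c) = bd (N + 1) (toOrdChain c) := by
  suffices h : toOrdChain ∘ₗ K.boundary N = bd (N + 1) ∘ₗ toOrdChain from
    LinearMap.congr_fun h c
  refine Finsupp.lhom_ext' fun s => LinearMap.ext_ring ?_
  simp only [LinearMap.comp_apply, Finsupp.lsingle_apply, toOrdChain_single, bd_of, boundary,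
    Finsupp.linearCombination_single, one_smul, map_sum, map_smul]
  refine (Fintype.sum_equiv (s.1.orderIsoOfFin s.2.2).toEquiv _ _ fun i => ?_).symm
  rw [removeNth_vertexTuple]
  congr 2
  exact (card_filter_lt_vertexTuple s i).symm

/-- The tuples of vertices of a face in increasing order. -/
def sortedFaceTuples (K : AbstractSimplicialComplex V) (n : ℕ) : Set (Fin n → V) :=
  {t | ∃ s ∈ K.faces, t ∈ sortedTuples ↑s n}

theorem exists_toOrdChain_eq {c : OrdChain V (N + 1)}
    (hc : c ∈ supp (sortedFaceTuples K (N + 1))) : ∃ β : K.Chain N, toOrdChain β = c := by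
  suffices h : c ∈ LinearMap.range toOrdChain from h
  refine map_mem_of_mem_supported (M := OrdChain V (N + 1)) LinearMap.id (fun t ht => ?_) hc
  obtain ⟨s, hs, ht, hts⟩ := ht
  let s' : K.Simplex N := ⟨Finset.univ.map ⟨t, ht.injective⟩,
    (K.isRelLowerSet_faces hs).2 (fun v hv => by
      obtain ⟨i, -, rfl⟩ := Finset.mem_map.mp hv
      exact hts i) (Finset.univ_nonempty.map), by simp⟩
  refine ⟨Finsupp.single s' 1, ?_⟩
  rw [toOrdChain_single, LinearMap.id_apply]
  congr 1
  exact (Finset.orderEmbOfFin_unique _ (fun i => by simp [s']) ht).symm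

theorem chainNorm_eq_lOne (c : K.Chain N) : chainNorm c = lOne (toOrdChain c) := by
  change (c.sum fun _ z => z.natAbs) = (c.mapDomain vertexTuple).sum fun _ z => z.natAbs
  rw [Finsupp.sum_mapDomain_index_inj vertexTuple_injective]

theorem sort_mem_sortedFaceTuples {c : OrdChain V n} (hc : c ∈ supp (faceTuples K n)) :
    sort n c ∈ supp (sortedFaceTuples K n) := by
  refine map_mem_of_mem_supported _ (fun t ht => ?_) hc
  obtain ⟨s, hs, hts⟩ := ht
  exact supp_mono (sort_mem (U := (s : Set V)) (of_mem hts)) fun t ht => ⟨s, hs, ht⟩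

theorem sortHomotopy_mem_faceTuples {c : OrdChain V n} (hc : c ∈ supp (faceTuples K n)) :
    sortHomotopy n c ∈ supp (faceTuples K (n + 1)) := by
  refine map_mem_of_mem_supported _ (fun t ht => ?_) hc
  obtain ⟨s, hs, hts⟩ := ht
  exact supp_mono (coneHomotopy_mem_tuples (U := (s : Set V)) (fun _ _ ht' => ht' 0)
    (fun _ _ hc' => sort_mem_tuples hc') (of_mem hts)) fun t ht => ⟨s, hs, ht⟩

theorem toOrdChain_mem_faceTuples (c : K.Chain N) :
    toOrdChain c ∈ supp (faceTuples K (N + 1)) :=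
  mapDomain_mem_supported (S := Set.univ) (T := faceTuples K (N + 1))
    (fun s _ => ⟨s.1, s.2.1, fun _ => Finset.orderEmbOfFin_mem _ _ _⟩) (by simp)

theorem exists_boundary_eq_chainNorm_le {k M : ℕ} (h : K.dehnFunction N k ≤ M) {b : K.Chain N}
    (hb : b ∈ LinearMap.range (K.boundary N)) (hbk : chainNorm b ≤ k) :
    ∃ a, K.boundary N a = b ∧ chainNorm a ≤ M := by
  by_contra! hcon
  have hle : K.fillingNorm N b ≤ M :=
    (le_iSup₂_of_le b hb (le_iSup (fun _ => K.fillingNorm N b) hbk)).trans h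
  have hge : ((M + 1 : ℕ) : ℕ∞) ≤ K.fillingNorm N b :=
    le_iInf₂ fun a ha => by exact_mod_cast hcon a ha
  exact absurd (hge.trans hle) (by norm_cast; omega)

theorem exists_polynomial_filling (hK : ContractibleSpace K.Realization) {P : Polynomial ℕ}
    (hP : ∀ k : ℕ, K.dehnFunction N k ≤ ((P.eval k : ℕ) : ℕ∞)) :
    ∃ Q : Polynomial ℕ, ∀ k, ∀ b ∈ supp (faceTuples K (N + 1)), bd N b = 0 → lOne b ≤ k →
      ∃ a ∈ supp (faceTuples K (N + 2)), bd (N + 1) a = b ∧ lOne a ≤ Q.eval k := by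
  obtain ⟨C, hC⟩ := exists_lOne_coneHomotopy_le (f := sort (V := V)) (p := fun _ t => t 0)
    (fun n c => lOne_sort_le c) (N + 1)
  refine ⟨P.comp (Polynomial.C (N + 1).factorial * Polynomial.X) +
    Polynomial.C C * Polynomial.X, fun k b hb hbd hbk => ?_⟩
  obtain ⟨z, hz, hzb⟩ := exists_bd_eq_of_contractible hK hb hbd
  obtain ⟨β, hβ⟩ := exists_toOrdChain_eq (sort_mem_sortedFaceTuples hb)
  obtain ⟨ζ, hζ⟩ := exists_toOrdChain_eq (sort_mem_sortedFaceTuples hz)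
  have hβζ : K.boundary N ζ = β := toOrdChain_injective (by
    rw [toOrdChain_boundary, hζ, hβ, bd_sort, hzb])
  have hβk : chainNorm β ≤ (N + 1).factorial * k := by
    rw [chainNorm_eq_lOne, hβ]
    exact (lOne_sort_le b).trans (Nat.mul_le_mul_left _ hbk)
  obtain ⟨α, hα, hαM⟩ := exists_boundary_eq_chainNorm_le (hP _) ⟨ζ, hβζ⟩ hβk
  refine ⟨toOrdChain α + sortHomotopy (N + 1) b,
    Submodule.add_mem _ (toOrdChain_mem_faceTuples α) (sortHomotopy_mem_faceTuples hb), ?_, ?_⟩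
  · rw [map_add, ← toOrdChain_boundary, hα, hβ, bd_coneHomotopy rfl fun _ => bd_sort, hbd,
      map_zero]
    abel
  · rw [chainNorm_eq_lOne] at hαM
    simp only [Polynomial.eval_add, Polynomial.eval_comp, Polynomial.eval_mul, Polynomial.eval_C,
      Polynomial.eval_X]
    exact (lOne_add_le _ _).trans
      (Nat.add_le_add hαM ((hC b).trans (Nat.mul_le_mul_left _ hbk)))

end Simplicial

end OrdChain

/-! ## Chains with controlled support -/

namespace OrdChain

section Restrict

variable {X : Type*} {n : ℕ}

open Classical in
/-- The restriction of chains to the tuples with entries in `U`. -/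
def restrict (U : Set X) : OrdChain X n →ₗ[ℤ] OrdChain X n :=
  lift fun t => if t ∈ tuples U n then of t else 0

theorem restrict_eq_self {U : Set X} {c : OrdChain X n} (hc : c ∈ supp (tuples U n)) :
    restrict U c = c :=
  linearMap_eq_of_mem_supported (F' := LinearMap.id) (fun t ht => by
    rw [restrict, lift_of, if_pos ht, LinearMap.id_apply]) hc

theorem restrict_eq_zero {U : Set X} {c : OrdChain X (n + 1)}
    (hc : c ∈ supp (tuples Uᶜ (n + 1))) : restrict U c = 0 :=
  linearMap_eq_of_mem_supported (F' := 0) (fun t ht => by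
    rw [restrict, lift_of, if_neg fun h => ht 0 (h 0), LinearMap.zero_apply]) hc

theorem restrict_mem_tuples (U : Set X) (c : OrdChain X n) : restrict U c ∈ supp (tuples U n) := by
  refine map_mem_of_mem_supported (S := Set.univ) _ (fun t _ => ?_) (by simp)
  rw [restrict, lift_of]
  split_ifs with h
  exacts [of_mem h, Submodule.zero_mem _]

theorem restrict_mem {S : Set (Fin n → X)} (U : Set X) {c : OrdChain X n} (hc : c ∈ supp S) :
    restrict U c ∈ supp S := by
  refine map_mem_of_mem_supported _ (fun t ht => ?_) hc
  rw [restrict, lift_of]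
  split_ifs
  exacts [of_mem ht, Submodule.zero_mem _]

theorem lOne_restrict_le (U : Set X) (c : OrdChain X n) : lOne (restrict U c) ≤ lOne c := by
  simpa using lOne_linearMap_le (restrict U) c 1 fun t _ => by
    rw [restrict, lift_of]
    split_ifs <;> simp

theorem bd_restrict {U : Set X} {c : OrdChain X (n + 2)}
    (hc : ∀ t ∈ c.support, t ∈ tuples U (n + 2) ∨ t ∈ tuples Uᶜ (n + 2)) :
    bd (n + 1) (restrict U c) = restrict U (bd (n + 1) c) := by
  refine linearMap_eq_of_mem_supported (F := bd (n + 1) ∘ₗ restrict U)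
    (F' := restrict U ∘ₗ bd (n + 1)) (fun t ht => ?_) (Finsupp.mem_supported_support ℤ c)
  simp only [LinearMap.comp_apply]
  rcases hc t ht with h | h
  · rw [restrict_eq_self (of_mem h), restrict_eq_self (bd_mem_tuples (of_mem h))]
  · rw [restrict_eq_zero (of_mem h), restrict_eq_zero (bd_mem_tuples (of_mem h)), map_zero]

/-- The points of length at most `r`. -/
def ball (ℓ : X → ℕ) (r : ℕ) : Set X := {x | ℓ x ≤ r}

theorem ball_mono (ℓ : X → ℕ) {r r' : ℕ} (h : r ≤ r') : ball ℓ r ⊆ ball ℓ r' :=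
  fun _ hx => le_trans hx h

theorem exists_mem_tuples_ball (ℓ : X → ℕ) (c : OrdChain X n) :
    ∃ r, c ∈ supp (tuples (ball ℓ r) n) := by
  refine ⟨c.support.sup fun t => Finset.univ.sup fun i => ℓ (t i), fun t ht i => ?_⟩
  exact (Finset.le_sup (f := fun i => ℓ (t i)) (Finset.mem_univ i)).trans
    (Finset.le_sup (f := fun t : Fin n → X => Finset.univ.sup fun i => ℓ (t i)) ht)

/-- A tuple of diameter at most `R` is cut by at most one of the levels `r + j * R`, and `c` has
fewer tuples than there are levels to choose from. -/
theorem exists_unmixed_level {ℓ : X → ℕ} {R r : ℕ} {c : OrdChain X n}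
    (hc : ∀ t ∈ c.support, ∀ i j, ℓ (t i) ≤ ℓ (t j) + R) :
    ∃ j ≤ c.support.card, ∀ t ∈ c.support, t ∈ tuples (ball ℓ (r + j * R)) n ∨
      t ∈ tuples (ball ℓ (r + j * R))ᶜ n := by
  by_contra! hcon
  have h : ∀ j : Fin (c.support.card + 1), ∃ t : c.support,
      (∃ i, r + j * R < ℓ (t.1 i)) ∧ ∃ i, ℓ (t.1 i) ≤ r + j * R := by
    intro j
    obtain ⟨t, ht, hout, hin⟩ := hcon j (Nat.lt_succ_iff.mp j.2)
    exact ⟨⟨t, ht⟩, by simpa [tuples, ball] using hout, by simpa [tuples, ball] using hin⟩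
  choose T hlt hle using h
  obtain ⟨j, j', hne, heq⟩ := Fintype.exists_ne_map_eq_of_card_lt T (by simp)
  wlog hjj : j < j' generalizing j j'
  · exact this j' j hne.symm heq.symm (lt_of_le_of_ne (not_lt.mp hjj) hne.symm)
  obtain ⟨i, hi⟩ := hle j
  obtain ⟨i', hi'⟩ := hlt j'
  rw [← heq] at hi'
  have hdiam := hc _ (T j).2 i' i
  have hlevel : ((j : ℕ) + 1) * R ≤ j' * R := Nat.mul_le_mul_right R hjj
  rw [add_mul, one_mul] at hlevel
  omega

theorem exists_bd_eq_mem_tuples {S : Set (Fin (n + 2) → X)} {ℓ : X → ℕ} {R r : ℕ}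
    (hS : ∀ t ∈ S, ∀ i j, ℓ (t i) ≤ ℓ (t j) + R) {a : OrdChain X (n + 2)} (ha : a ∈ supp S)
    (hb : bd (n + 1) a ∈ supp (tuples (ball ℓ r) (n + 1))) :
    ∃ a' ∈ supp S, bd (n + 1) a' = bd (n + 1) a ∧ lOne a' ≤ lOne a ∧
      a' ∈ supp (tuples (ball ℓ (r + lOne a * R)) (n + 2)) := by
  obtain ⟨j, hj, hU⟩ := exists_unmixed_level (r := r) fun t ht => hS t (ha ht)
  refine ⟨restrict (ball ℓ (r + j * R)) a, restrict_mem _ ha, ?_, lOne_restrict_le _ a,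
    supp_mono (restrict_mem_tuples _ a) (tuples_mono (ball_mono ℓ ?_))⟩
  · rw [bd_restrict hU, restrict_eq_self]
    exact supp_mono hb (tuples_mono (ball_mono ℓ (Nat.le_add_right _ _)))
  · exact Nat.add_le_add_left (Nat.mul_le_mul_right R (hj.trans (card_support_le_lOne a))) r

end Restrict

section BoundedChains

variable {X Y : Type*} {n m : ℕ} {ℓ : X → ℕ} {ℓ' : Y → ℕ} {r r' R : ℕ}

/-- The chains whose `ℓ¹`-norm and whose support radius are at most `r`; a single number controls
both sizes, since only their polynomial growth matters. -/
def boundedChains (ℓ : X → ℕ) (n r : ℕ) : Set (OrdChain X n) :=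
  {c | lOne c ≤ r ∧ c ∈ supp (tuples (ball ℓ r) n)}

theorem boundedChains_mono (h : r ≤ r') : boundedChains ℓ n r ⊆ boundedChains ℓ n r' :=
  fun _ hc => ⟨hc.1.trans h, supp_mono hc.2 (tuples_mono (ball_mono ℓ h))⟩

theorem exists_mem_boundedChains (ℓ : X → ℕ) (c : OrdChain X n) : ∃ r, c ∈ boundedChains ℓ n r := by
  obtain ⟨r, hr⟩ := exists_mem_tuples_ball ℓ c
  exact ⟨lOne c + r, Nat.le_add_right _ _,
    supp_mono hr (tuples_mono (ball_mono ℓ (Nat.le_add_left _ _)))⟩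

theorem zero_mem_boundedChains : (0 : OrdChain X n) ∈ boundedChains ℓ n r :=
  ⟨by simp, Submodule.zero_mem _⟩

theorem of_mem_boundedChains {t : Fin n → X} (ht : t ∈ tuples (ball ℓ r) n) :
    of t ∈ boundedChains ℓ n (1 + r) :=
  ⟨by simp, of_mem (tuples_mono (ball_mono ℓ (Nat.le_add_left _ _)) ht)⟩

theorem add_mem_boundedChains {a b : OrdChain X n} (ha : a ∈ boundedChains ℓ n r)
    (hb : b ∈ boundedChains ℓ n r') : a + b ∈ boundedChains ℓ n (r + r') :=
  ⟨(lOne_add_le a b).trans (Nat.add_le_add ha.1 hb.1), Submodule.add_mem _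
    (boundedChains_mono (Nat.le_add_right _ _) ha).2
    (boundedChains_mono (Nat.le_add_left _ _) hb).2⟩

theorem sub_mem_boundedChains {a b : OrdChain X n} (ha : a ∈ boundedChains ℓ n r)
    (hb : b ∈ boundedChains ℓ n r') : a - b ∈ boundedChains ℓ n (r + r') :=
  ⟨(lOne_sub_le a b).trans (Nat.add_le_add ha.1 hb.1), Submodule.sub_mem _
    (boundedChains_mono (Nat.le_add_right _ _) ha).2
    (boundedChains_mono (Nat.le_add_left _ _) hb).2⟩

theorem cone_mem_boundedChains {p : X} (hp : ℓ p ≤ r) {c : OrdChain X n}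
    (hc : c ∈ boundedChains ℓ n r) : cone p c ∈ boundedChains ℓ (n + 1) r :=
  ⟨(lOne_cone_le p c).trans hc.1, cone_mem_tuples (U := ball ℓ r) hp hc.2⟩

theorem map_mem_boundedChains {f : X → Y} (hf : ∀ x ∈ ball ℓ r, f x ∈ ball ℓ' r') (h : r ≤ r')
    {c : OrdChain X n} (hc : c ∈ boundedChains ℓ n r) : map f c ∈ boundedChains ℓ' n r' :=
  ⟨(lOne_map_le f c).trans (hc.1.trans h),
    map_mem (S := tuples (ball ℓ r) n) (T := tuples (ball ℓ' r') n)
      (fun _ ht i => hf _ (ht i)) hc.2⟩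

theorem linearMap_mem_boundedChains {F : OrdChain X n →ₗ[ℤ] OrdChain Y m}
    (hF : ∀ t ∈ tuples (ball ℓ r) n, F (of t) ∈ boundedChains ℓ' m R) {c : OrdChain X n}
    (hc : c ∈ supp (tuples (ball ℓ r) n)) : F c ∈ boundedChains ℓ' m (R * (lOne c + 1)) :=
  ⟨(lOne_linearMap_le F c R fun t ht => (hF t (hc ht)).1).trans
      (Nat.mul_le_mul_left _ (Nat.le_succ _)),
    map_mem_of_mem_supported F (fun t ht => (boundedChains_mono
      (Nat.le_mul_of_pos_right R (Nat.succ_pos _)) (hF t ht)).2) hc⟩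

theorem linearMap_bd_mem_boundedChains {F : OrdChain X n →ₗ[ℤ] OrdChain Y m}
    (hF : ∀ t ∈ tuples (ball ℓ r) n, F (of t) ∈ boundedChains ℓ' m R) {t : Fin (n + 1) → X}
    (ht : t ∈ tuples (ball ℓ r) (n + 1)) :
    F (bd n (of t)) ∈ boundedChains ℓ' m (R * (n + 2)) := by
  have hbd : lOne (bd n (of t)) ≤ n + 1 := by simpa using lOne_bd_le (of t)
  exact boundedChains_mono (Nat.mul_le_mul_left R (Nat.succ_le_succ hbd))
    (linearMap_mem_boundedChains hF (bd_mem_tuples (of_mem ht)))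

end BoundedChains

end OrdChain

/-! ## Word lengths and cocompact free actions -/

namespace FinSymmGenSet

variable {G : Type u} [Group G] (S : FinSymmGenSet G)

theorem length_list_prod_le {l : List G} (h : ∀ s ∈ l, s ∈ S.carrier) :
    S.length l.prod ≤ l.length :=
  Nat.sInf_le ⟨l, h, rfl, rfl⟩

theorem length_one : S.length 1 = 0 :=
  Nat.le_zero.mp (S.length_list_prod_le (l := []) (by simp))

theorem length_le_one {s : G} (hs : s ∈ S.carrier) : S.length s ≤ 1 := by
  simpa using S.length_list_prod_le (l := [s]) (by simpa using hs)

theorem length_inv_le (g : G) : S.length g⁻¹ ≤ S.length g := by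
  obtain ⟨l, hl, rfl, hn⟩ := S.exists_word g
  rw [← hn, List.prod_inv_reverse]
  refine (S.length_list_prod_le fun s hs => ?_).trans (by simp)
  obtain ⟨s, hs', rfl⟩ := List.mem_map.mp (List.mem_reverse.mp hs)
  exact S.inv_mem _ (hl _ hs')

theorem length_le_length_mul_add (g h : G) : S.length g ≤ S.length (g * h) + S.length h := by
  have hmul := S.length_mul_le (g * h) h⁻¹
  rw [mul_inv_cancel_right] at hmul
  exact hmul.trans (Nat.add_le_add_left (S.length_inv_le h) _)

end FinSymmGenSet

theorem exists_equivariant_map {G V : Type*} [Group G] [MulAction G V]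
    (h : ∀ (g : G) (v : V), g • v = v → g = 1) : ∃ φ : V → G, ∀ g v, φ (g • v) = g * φ v := by
  let rep : V → V := fun v => (Quotient.mk (MulAction.orbitRel G V) v).out
  have exists_smul_rep : ∀ v, ∃ g : G, g • rep v = v := fun v =>
    MulAction.orbitRel_apply.mp ((MulAction.orbitRel G V).symm (Quotient.mk_out v))
  choose φ hφ using exists_smul_rep
  refine ⟨φ, fun g v => ?_⟩
  have rep_smul : rep (g • v) = rep v := congrArg Quotient.out
    (Quotient.sound (s := MulAction.orbitRel G V) (MulAction.orbitRel_apply.mpr ⟨g, rfl⟩))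
  have hgv := hφ (g • v)
  rw [rep_smul] at hgv
  have hfix : ((g * φ v)⁻¹ * φ (g • v)) • rep v = rep v := by
    rw [mul_smul, hgv, inv_smul_eq_iff, mul_smul, hφ]
  exact (inv_mul_eq_one.mp (h _ _ hfix)).symm

namespace OrdChain

variable {G : Type u} [Group G] {V : Type u} [MulAction G V] {K : AbstractSimplicialComplex V}

theorem smul_comp_mem_faceTuples (hK : IsSimplicialEG G K) (g : G) {n : ℕ} {t : Fin n → V}
    (ht : t ∈ faceTuples K n) : (g • ·) ∘ t ∈ faceTuples K n := by
  obtain ⟨s, hs, hts⟩ := ht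
  exact ⟨_, hK.smul_mem g s hs, fun i => Finset.mem_map.mpr ⟨t i, hts i, rfl⟩⟩

theorem const_mem_faceTuples (v : V) (n : ℕ) : (fun _ => v) ∈ faceTuples K n :=
  ⟨_, K.singleton_mem v, by simp⟩

theorem exists_finset_faceTuples (hF : HasFiniteSkeleta G K) (n : ℕ) :
    ∃ F : Finset (Fin n → V), ∀ t ∈ faceTuples K n, ∃ t' ∈ F, ∃ g : G, t = (g • ·) ∘ t' := by
  classical
  choose F hF using hF
  let U : Finset V := (Finset.range n).biUnion fun m => (F m).biUnion id
  refine ⟨Fintype.piFinset fun _ => U, fun t ht => ?_⟩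
  cases n with
  | zero => exact ⟨t, Fintype.mem_piFinset.mpr fun i => i.elim0, 1, funext fun i => i.elim0⟩
  | succ n =>
    obtain ⟨s, hs, hts⟩ := ht
    let s' := Finset.univ.image t
    have hne : s'.Nonempty := Finset.univ_nonempty.image t
    have hs' : s' ∈ K.faces := (K.isRelLowerSet_faces hs).2 (fun v hv => by
      obtain ⟨i, -, rfl⟩ := Finset.mem_image.mp hv
      exact hts i) hne
    have hcard : s'.card ≤ n + 1 := Finset.card_image_le.trans (by simp)
    have hpos := hne.card_pos
    obtain ⟨τ, hτ, g, hg⟩ := hF (s'.card - 1) s' hs' (by omega)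
    refine ⟨(g⁻¹ • ·) ∘ t, Fintype.mem_piFinset.mpr fun i => ?_, g, by ext; simp⟩
    have hti : t i ∈ s' := Finset.mem_image_of_mem t (Finset.mem_univ i)
    rw [hg] at hti
    obtain ⟨v, hv, hvt⟩ := Finset.mem_map.mp hti
    have hvt' : g • v = t i := hvt
    refine Finset.mem_biUnion.mpr ⟨s'.card - 1, Finset.mem_range.mpr (by omega),
      Finset.mem_biUnion.mpr ⟨τ, hτ, ?_⟩⟩
    simpa [← hvt'] using hv

theorem exists_finset_vertices (hF : HasFiniteSkeleta G K) :
    ∃ F : Finset V, ∀ v, ∃ w ∈ F, ∃ g : G, v = g • w := by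
  classical
  obtain ⟨F, hF⟩ := exists_finset_faceTuples hF 1
  refine ⟨F.image (· 0), fun v => ?_⟩
  obtain ⟨t, ht, g, hg⟩ := hF _ (const_mem_faceTuples v 1)
  exact ⟨t 0, Finset.mem_image_of_mem _ ht, g, congrFun hg 0⟩

/-! ## Polynomial fillings of simplicial cycles -/

variable {S : FinSymmGenSet G} {φ : V → G}

theorem smul_mem_ball (hφ : ∀ g v, φ (g • v) = g * φ v) (g : G) {r : ℕ} {v : V}
    (hv : v ∈ ball (S.length ∘ φ) r) : g • v ∈ ball (S.length ∘ φ) (S.length g + r) := by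
  change S.length _ ≤ _
  rw [hφ]
  exact (S.length_mul_le _ _).trans (Nat.add_le_add_left hv _)

theorem map_smul_mem_boundedChains (hφ : ∀ g v, φ (g • v) = g * φ v) (g : G) {r n : ℕ}
    {c : OrdChain V n} (hc : c ∈ boundedChains (S.length ∘ φ) n r) :
    map (g • ·) c ∈ boundedChains (S.length ∘ φ) n (S.length g + r) :=
  map_mem_boundedChains (fun _ hv => smul_mem_ball hφ g hv) (Nat.le_add_left _ _) hc

theorem exists_length_le_add (S : FinSymmGenSet G) (hφ : ∀ g v, φ (g • v) = g * φ v)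
    (hF : HasFiniteSkeleta G K) :
    ∃ R, ∀ (n : ℕ), ∀ t ∈ faceTuples K n, ∀ i j,
      S.length (φ (t i)) ≤ S.length (φ (t j)) + R := by
  obtain ⟨F, hF⟩ := exists_finset_faceTuples hF 2
  refine ⟨F.sup fun t => S.length ((φ (t 1))⁻¹ * φ (t 0)), fun n t ht i j => ?_⟩
  obtain ⟨s, hs, hts⟩ := ht
  obtain ⟨t', ht', g, hg⟩ := hF ![t i, t j] ⟨s, hs, fun k => by fin_cases k <;> simp [hts]⟩
  have hi : t i = g • t' 0 := congrFun hg 0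
  have hj : t j = g • t' 1 := congrFun hg 1
  have hij : φ (t i) = φ (t j) * ((φ (t' 1))⁻¹ * φ (t' 0)) := by
    rw [hi, hj, hφ, hφ]
    group
  rw [hij]
  exact (S.length_mul_le _ _).trans (Nat.add_le_add_left
    (Finset.le_sup (f := fun t : Fin 2 → V => S.length ((φ (t 1))⁻¹ * φ (t 0))) ht') _)

/-- The `0`-chain of a vertex. -/
abbrev pt {X : Type*} (v : X) : OrdChain X 1 := of fun _ => v

theorem of_eq_pt {X : Type*} (t : Fin 1 → X) : of t = pt (t 0) := by
  congr 1
  exact funext (Fin.cases rfl fun i => i.elim0)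

theorem cone_bd_of_eq_pt {X : Type*} (p : X) (t : Fin 1 → X) : cone p (bd 0 (of t)) = pt p := by
  rw [bd_of, Fin.sum_univ_one, Fin.val_zero, pow_zero, one_smul, cone_of]
  congr 1
  exact funext (Fin.cases rfl fun i => i.elim0)

theorem exists_bd_eq_pt_sub_pt (hK : ContractibleSpace K.Realization) (v w : V) :
    ∃ c ∈ supp (faceTuples K 2), bd 1 c = pt v - pt w := by
  refine exists_bd_eq_of_contractible hK (Submodule.sub_mem _
    (of_mem (const_mem_faceTuples v 1)) (of_mem (const_mem_faceTuples w 1))) ?_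
  rw [map_sub, bd_of, bd_of, sub_eq_zero]
  exact Finset.sum_congr rfl fun i _ => by congr 2; funext j; exact j.elim0

theorem map_smul_add_mem_path (hK : IsSimplicialEG G K) (g : G) {v w x : V} {a b : OrdChain V 2}
    (ha : a ∈ supp (faceTuples K 2)) (hab : bd 1 a = pt v - pt w)
    (hb : b ∈ supp (faceTuples K 2)) (hbb : bd 1 b = pt (g • w) - pt x) :
    map (g • ·) a + b ∈ supp (faceTuples K 2) ∧
      bd 1 (map (g • ·) a + b) = pt (g • v) - pt x := by
  refine ⟨Submodule.add_mem _ (map_mem (fun t ht => smul_comp_mem_faceTuples hK g ht) ha) hb, ?_⟩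
  rw [map_add, ← map_bd, hab, hbb, map_sub, map_of, map_of]
  simp only [pt, Function.comp_def]
  abel

theorem exists_path_list_prod (hφ : ∀ g v, φ (g • v) = g * φ v)
    (hK : IsSimplicialEG G K) (v₀ : V) :
    ∃ B, ∀ l : List G, (∀ s ∈ l, s ∈ S.carrier) → ∃ c ∈ supp (faceTuples K 2),
      bd 1 c = pt (l.prod • v₀) - pt v₀ ∧ c ∈ boundedChains (S.length ∘ φ) 2 (B * l.length) := by
  choose C hC hCbd using fun v => exists_bd_eq_pt_sub_pt hK.contractible v v₀
  choose ρ hρ using fun v => exists_mem_boundedChains (S.length ∘ φ) (C v)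
  let D := S.carrier.sup fun s => ρ (s • v₀)
  refine ⟨D + 1, fun l => ?_⟩
  induction l with
  | nil => exact fun _ => ⟨0, Submodule.zero_mem _, by simp, zero_mem_boundedChains⟩
  | cons s l ih =>
    intro hl
    have hs : s ∈ S.carrier := hl s List.mem_cons_self
    have hD : ρ (s • v₀) ≤ D := Finset.le_sup (f := fun s => ρ (s • v₀)) hs
    have hs1 := S.length_le_one hs
    obtain ⟨c, hc, hcbd, hcB⟩ := ih fun s' hs' => hl s' (List.mem_cons_of_mem _ hs')
    obtain ⟨hmem, hbd⟩ := map_smul_add_mem_path hK s hc hcbd (hC _) (hCbd _)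
    refine ⟨map (s • ·) c + C (s • v₀), hmem, by rw [hbd, List.prod_cons, mul_smul],
      boundedChains_mono ?_
        (add_mem_boundedChains (map_smul_mem_boundedChains hφ s hcB) (hρ _))⟩
    rw [List.length_cons, mul_add_one]
    omega

theorem exists_path (hφ : ∀ g v, φ (g • v) = g * φ v)
    (hK : IsSimplicialEG G K) (hF : HasFiniteSkeleta G K) (v₀ : V) :
    ∃ B, ∀ v, ∃ c ∈ supp (faceTuples K 2), bd 1 c = pt v - pt v₀ ∧
      c ∈ boundedChains (S.length ∘ φ) 2 (B * (S.length (φ v) + 1)) := by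
  choose C hC hCbd using fun v => exists_bd_eq_pt_sub_pt hK.contractible v v₀
  choose ρ hρ using fun v => exists_mem_boundedChains (S.length ∘ φ) (C v)
  obtain ⟨F, hF⟩ := exists_finset_vertices hF
  obtain ⟨B, hB⟩ := exists_path_list_prod (S := S) hφ hK v₀
  let D := F.sup fun w => ρ w + S.length (φ w)
  refine ⟨B + B * D + 2 * D + 1, fun v => ?_⟩
  obtain ⟨w, hw, g, rfl⟩ := hF v
  have hD : ρ w + S.length (φ w) ≤ D := Finset.le_sup (f := fun w => ρ w + S.length (φ w)) hw
  have hg : S.length g ≤ S.length (φ (g • w)) + D := by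
    rw [hφ]
    exact (S.length_le_length_mul_add g (φ w)).trans (by omega)
  obtain ⟨l, hl, hlg, hll⟩ := S.exists_word g
  obtain ⟨c, hc, hcbd, hcB⟩ := hB l hl
  rw [hlg] at hcbd
  rw [hll] at hcB
  obtain ⟨hmem, hbd⟩ := map_smul_add_mem_path hK g (hC w) (hCbd w) hc hcbd
  refine ⟨_, hmem, hbd, boundedChains_mono ?_
    (add_mem_boundedChains (map_smul_mem_boundedChains hφ g (hρ w)) hcB)⟩
  generalize S.length (φ (g • w)) = k at *
  calc S.length g + ρ w + B * S.length g ≤ (k + D) + D + B * (k + D) := by gcongr; omega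
    _ ≤ (k + D) + D + B * (k + D) + (B * D * k + 2 * D * k + B + 1) := Nat.le_add_right _ _
    _ = (B + B * D + 2 * D + 1) * (k + 1) := by ring

/-- Every simplicial cycle of size `k` (in the augmented complex, with the sizes measured by
`boundedChains`) bounds a simplicial chain of size polynomial in `k`. -/
def HasPolynomialFillings {V : Type u} (K : AbstractSimplicialComplex V) (ℓ : V → ℕ) (n : ℕ) :
    Prop :=
  ∃ P : Polynomial ℕ, ∀ k, ∀ b ∈ supp (faceTuples K n), IsCycle b → b ∈ boundedChains ℓ n k →
    ∃ a ∈ supp (faceTuples K (n + 1)), bd n a = b ∧ a ∈ boundedChains ℓ (n + 1) (P.eval k)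

section Fillings

variable {V : Type u} {K : AbstractSimplicialComplex V} {ℓ : V → ℕ}

theorem hasPolynomialFillings_zero (v₀ : V) : HasPolynomialFillings K ℓ 0 := by
  refine ⟨Polynomial.X + Polynomial.C (ℓ v₀), fun k b _ hbc hbk =>
    ⟨cone v₀ b, cone_mem (S := Set.univ) (fun t _ => ?_) (by simp), bd_cone_of_isCycle v₀ hbc, ?_⟩⟩
  · exact ⟨_, K.singleton_mem v₀, Fin.cases (by simp) fun i => i.elim0⟩
  · simp only [Polynomial.eval_add, Polynomial.eval_X, Polynomial.eval_C]
    exact cone_mem_boundedChains (Nat.le_add_left _ _)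
      (boundedChains_mono (Nat.le_add_right _ _) hbk)

theorem bd_lift_path {v₀ : V} {c : V → OrdChain V 2} (hc : ∀ v, bd 1 (c v) = pt v - pt v₀)
    {b : OrdChain V 1} (hb : IsCycle b) : bd 1 (lift (fun t => c (t 0)) b) = b := by
  have h : bd 1 ∘ₗ lift (fun t : Fin 1 → V => c (t 0)) = LinearMap.id - cone v₀ ∘ₗ bd 0 := by
    refine hom_ext fun t => ?_
    simp only [LinearMap.comp_apply, LinearMap.sub_apply, LinearMap.id_apply, lift_of, hc,
      cone_bd_of_eq_pt, of_eq_pt t]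
  have hb0 : bd 0 b = 0 := hb
  simpa only [LinearMap.comp_apply, LinearMap.sub_apply, LinearMap.id_apply, hb0, map_zero,
    sub_zero] using LinearMap.congr_fun h b

theorem hasPolynomialFillings_one {v₀ : V} {B : ℕ}
    (h : ∀ v, ∃ c ∈ supp (faceTuples K 2), bd 1 c = pt v - pt v₀ ∧
      c ∈ boundedChains ℓ 2 (B * (ℓ v + 1))) : HasPolynomialFillings K ℓ 1 := by
  choose c hc hcbd hcB using h
  refine ⟨Polynomial.C B * (Polynomial.X + 1) * (Polynomial.X + 1), fun k b _ hbc hbk =>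
    ⟨lift (fun t => c (t 0)) b, ?_, bd_lift_path hcbd hbc, ?_⟩⟩
  · refine map_mem_of_mem_supported (S := Set.univ) _ (fun t _ => ?_) (by simp)
    rw [lift_of]
    exact hc _
  · simp only [Polynomial.eval_mul, Polynomial.eval_add, Polynomial.eval_X, Polynomial.eval_C,
      Polynomial.eval_one]
    refine boundedChains_mono (Nat.mul_le_mul_left _ (Nat.succ_le_succ hbk.1))
      (linearMap_mem_boundedChains (fun t ht => ?_) hbk.2)
    rw [lift_of]
    exact boundedChains_mono (Nat.mul_le_mul_left B (Nat.succ_le_succ (ht 0))) (hcB (t 0))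

theorem hasPolynomialFillings_add_two [LinearOrder V] (hK : ContractibleSpace K.Realization)
    {n R : ℕ} (hR : ∀ t ∈ faceTuples K (n + 3), ∀ i j, ℓ (t i) ≤ ℓ (t j) + R) {P : Polynomial ℕ}
    (hP : ∀ k : ℕ, K.dehnFunction (n + 1) k ≤ ((P.eval k : ℕ) : ℕ∞)) :
    HasPolynomialFillings K ℓ (n + 2) := by
  obtain ⟨Q, hQ⟩ := exists_polynomial_filling hK hP
  refine ⟨Q + Polynomial.X + Q * Polynomial.C R, fun k b hb hbc hbk => ?_⟩
  obtain ⟨a, ha, rfl, hal⟩ := hQ k b hb hbc hbk.1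
  obtain ⟨a', ha', hab, hal', hball⟩ := exists_bd_eq_mem_tuples hR ha hbk.2
  have hmul := Nat.mul_le_mul_right R hal
  simp only [Polynomial.eval_mul, Polynomial.eval_add, Polynomial.eval_X, Polynomial.eval_C]
  exact ⟨a', ha', hab, by omega, supp_mono hball (tuples_mono (ball_mono ℓ (by omega)))⟩

end Fillings

theorem hasPolynomialFillings [LinearOrder V] (hφ : ∀ g v, φ (g • v) = g * φ v)
    (hK : IsSimplicialEG G K) (hF : HasFiniteSkeleta G K)
    (hD : ∀ N : ℕ, 1 ≤ N → ∃ P : Polynomial ℕ, ∀ k : ℕ,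
      K.dehnFunction N k ≤ ((P.eval k : ℕ) : ℕ∞)) (v₀ : V) :
    ∀ n, HasPolynomialFillings K (S.length ∘ φ) n
  | 0 => hasPolynomialFillings_zero v₀
  | 1 => hasPolynomialFillings_one (exists_path hφ hK hF v₀).choose_spec
  | n + 2 => hasPolynomialFillings_add_two hK.contractible
      ((exists_length_le_add S hφ hF).choose_spec _) (hD (n + 1) (by omega)).choose_spec

end OrdChain

/-! ## Polynomially bounded equivariant maps of chains on a group -/

theorem natPolynomial_eval_mono (P : Polynomial ℕ) : Monotone fun k : ℕ => P.eval k := by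
  intro a b hab
  simp only [Polynomial.eval_eq_sum, Polynomial.sum]
  exact Finset.sum_le_sum fun i _ => Nat.mul_le_mul_left _ (Nat.pow_le_pow_left hab i)

namespace OrdChain

section ConeHomotopy

variable {X : Type*} {n : ℕ} {f : ∀ n, OrdChain X n →ₗ[ℤ] OrdChain X n}
  {p : ∀ n, (Fin (n + 1) → X) → X}

theorem map_coneHomotopy {a : X → X} (hf : ∀ n c, map a (f n c) = f n (map a c))
    (hp : ∀ n t, p n (a ∘ t) = a (p n t)) (c : OrdChain X n) :
    map a (coneHomotopy f p n c) = coneHomotopy f p n (map a c) := by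
  suffices h : ∀ n, map a ∘ₗ coneHomotopy f p n = coneHomotopy f p n ∘ₗ map a from
    LinearMap.congr_fun (h n) c
  intro n
  induction n with
  | zero => simp [coneHomotopy]
  | succ n ih =>
    refine hom_ext fun t => ?_
    have hbd := LinearMap.congr_fun ih (bd n (of t))
    simp only [LinearMap.comp_apply] at hbd
    simp only [LinearMap.comp_apply, map_of, coneHomotopy_of, map_cone, map_sub, hbd, hf, hp,
      map_bd]

end ConeHomotopy

/-- A linear map that sends the tuples of points of length at most `d` to chains whose size is
polynomial in `d`. -/
def PolyBounded {X Y : Type*} (ℓ : X → ℕ) (ℓ' : Y → ℕ) {n m : ℕ}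
    (F : OrdChain X n →ₗ[ℤ] OrdChain Y m) : Prop :=
  ∃ P : Polynomial ℕ, ∀ d, ∀ t ∈ tuples (ball ℓ d) n, F (of t) ∈ boundedChains ℓ' m (P.eval d)

theorem polyBounded_coneHomotopy {X : Type*} {ℓ : X → ℕ}
    {f : ∀ n, OrdChain X n →ₗ[ℤ] OrdChain X n} (hf : ∀ n, PolyBounded ℓ ℓ (f n)) (n : ℕ) :
    PolyBounded ℓ ℓ (coneHomotopy f (fun _ t => t 0) n) := by
  induction n with
  | zero => exact ⟨0, fun _ _ _ => zero_mem_boundedChains⟩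
  | succ n ih =>
    obtain ⟨P, hP⟩ := hf (n + 1)
    obtain ⟨Q, hQ⟩ := ih
    refine ⟨1 + Polynomial.X + P + Q * Polynomial.C (n + 2), fun d t ht => ?_⟩
    simp only [Polynomial.eval_add, Polynomial.eval_mul, Polynomial.eval_X, Polynomial.eval_C,
      Polynomial.eval_one]
    rw [coneHomotopy_of]
    have hapex : ℓ (t 0) ≤ d := ht 0
    exact cone_mem_boundedChains (by omega) (sub_mem_boundedChains
      (sub_mem_boundedChains (of_mem_boundedChains ht) (hP d t ht))
      (linearMap_bd_mem_boundedChains (hQ d) ht))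

section EquivariantExtension

variable {G : Type u} [Group G] {V : Type u} [MulAction G V] {n m : ℕ}

/-- The equivariant linear map that agrees with `A` on the tuples starting at `1`. -/
def equivariantExtension (A : (Fin (n + 1) → G) → OrdChain V m) :
    OrdChain G (n + 1) →ₗ[ℤ] OrdChain V m :=
  lift fun t => map (t 0 • ·) (A (((t 0)⁻¹ * ·) ∘ t))

theorem equivariantExtension_of (A : (Fin (n + 1) → G) → OrdChain V m) (t : Fin (n + 1) → G) :
    equivariantExtension A (of t) = map (t 0 • ·) (A (((t 0)⁻¹ * ·) ∘ t)) := by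
  rw [equivariantExtension, lift_of]

theorem map_smul_equivariantExtension (A : (Fin (n + 1) → G) → OrdChain V m) (g : G)
    (c : OrdChain G (n + 1)) :
    map (g • ·) (equivariantExtension A c) = equivariantExtension A (map (g * ·) c) := by
  suffices h : map (g • ·) ∘ₗ equivariantExtension A = equivariantExtension A ∘ₗ map (g * ·) from
    LinearMap.congr_fun h c
  refine hom_ext fun t => ?_
  have hsmul : (g • ·) ∘ (t 0 • ·) = fun v : V => (g * t 0) • v :=
    funext fun v => (mul_smul g (t 0) v).symm
  have hnormalize : ((g * t 0)⁻¹ * ·) ∘ (g * ·) ∘ t = ((t 0)⁻¹ * ·) ∘ t :=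
    funext fun i => by simp [mul_assoc]
  simp only [LinearMap.comp_apply, equivariantExtension_of, map_of, map_map]
  rw [hsmul, Function.comp_apply, hnormalize]

theorem bd_equivariantExtension {A : (Fin (n + 1) → G) → OrdChain V (n + 1)}
    {ψ : OrdChain G n →ₗ[ℤ] OrdChain V n}
    (hψ : ∀ (g : G) c, map (g • ·) (ψ c) = ψ (map (g * ·) c))
    (hA : ∀ t, bd n (A t) = ψ (bd n (of t))) (c : OrdChain G (n + 1)) :
    bd n (equivariantExtension A c) = ψ (bd n c) := by
  suffices h : bd n ∘ₗ equivariantExtension A = ψ ∘ₗ bd n from LinearMap.congr_fun h c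
  refine hom_ext fun t => ?_
  have hnormalize : (t 0 * ·) ∘ ((t 0)⁻¹ * ·) ∘ t = t := funext fun i => by simp
  simp only [LinearMap.comp_apply, equivariantExtension_of]
  rw [← map_bd, hA, hψ, map_bd, map_of, hnormalize]

theorem equivariantExtension_mem_faceTuples {K : AbstractSimplicialComplex V}
    (hK : IsSimplicialEG G K) {A : (Fin (n + 1) → G) → OrdChain V m}
    (hA : ∀ t, A t ∈ supp (faceTuples K m)) (c : OrdChain G (n + 1)) :
    equivariantExtension A c ∈ supp (faceTuples K m) := by
  refine map_mem_of_mem_supported (S := Set.univ) _ (fun t _ => ?_) (by simp)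
  rw [equivariantExtension_of]
  exact map_mem (fun t' ht' => smul_comp_mem_faceTuples hK _ ht') (hA _)

theorem polyBounded_equivariantExtension {S : FinSymmGenSet G} {φ : V → G}
    (hφ : ∀ g v, φ (g • v) = g * φ v) {A : (Fin (n + 1) → G) → OrdChain V m} {P : Polynomial ℕ}
    (hA : ∀ d, ∀ t ∈ tuples (ball S.length d) (n + 1),
      A t ∈ boundedChains (S.length ∘ φ) m (P.eval d)) :
    PolyBounded S.length (S.length ∘ φ) (equivariantExtension A) := by
  refine ⟨Polynomial.X + P.comp (2 * Polynomial.X), fun d t ht => ?_⟩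
  have hnormalized : ((t 0)⁻¹ * ·) ∘ t ∈ tuples (ball S.length (2 * d)) (n + 1) := fun i => by
    have h₀ : S.length (t 0) ≤ d := ht 0
    have hᵢ : S.length (t i) ≤ d := ht i
    have hmul := S.length_mul_le (t 0)⁻¹ (t i)
    have hinv := S.length_inv_le (t 0)
    change S.length ((t 0)⁻¹ * t i) ≤ 2 * d
    omega
  simp only [equivariantExtension_of, Polynomial.eval_add, Polynomial.eval_X, Polynomial.eval_comp,
    Polynomial.eval_mul, Polynomial.eval_ofNat]
  exact boundedChains_mono (Nat.add_le_add_right (ht 0) _)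
    (map_smul_mem_boundedChains hφ (t 0) (hA _ _ hnormalized))

end EquivariantExtension

section FillingMap

variable {G : Type u} [Group G] {V : Type u} [MulAction G V] {K : AbstractSimplicialComplex V}
  {S : FinSymmGenSet G} {φ : V → G} {n : ℕ}

/-- The conditions on the component in degree `n` of an equivariant chain map from the chains on
`G` to the simplicial chains of `K` under which the component in degree `n + 1` can be built from
polynomial fillings; `φ` is used to measure the vertices of `K`. -/
structure IsFillingMap (S : FinSymmGenSet G) (K : AbstractSimplicialComplex V) (φ : V → G) {n : ℕ}
    (ψ : OrdChain G n →ₗ[ℤ] OrdChain V n) : Prop where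
  equivariant : ∀ (g : G) c, map (g • ·) (ψ c) = ψ (map (g * ·) c)
  mem_faceTuples : ∀ c, ψ c ∈ supp (faceTuples K n)
  isCycle : ∀ c, IsCycle c → IsCycle (ψ c)
  polyBounded : PolyBounded S.length (S.length ∘ φ) ψ

theorem isFillingMap_zero (v₀ : V) :
    IsFillingMap S K φ (map (· • v₀) : OrdChain G 0 →ₗ[ℤ] OrdChain V 0) where
  equivariant g c := by
    simp only [map_map, Function.comp_def, mul_smul]
  mem_faceTuples _ := map_mem (S := Set.univ) (T := faceTuples K 0)
    (fun t _ => ⟨_, K.singleton_mem v₀, fun i => i.elim0⟩) (by simp)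
  isCycle _ _ := trivial
  polyBounded := ⟨1, fun d t _ => by
    rw [map_of, Polynomial.eval_one]
    exact of_mem_boundedChains (r := 0) fun i => i.elim0⟩

theorem IsFillingMap.exists_filling_bd {ψ : OrdChain G n →ₗ[ℤ] OrdChain V n}
    (hψ : IsFillingMap S K φ ψ) (hfill : HasPolynomialFillings K (S.length ∘ φ) n) :
    ∃ (A : (Fin (n + 1) → G) → OrdChain V (n + 1)) (P : Polynomial ℕ),
      (∀ t, A t ∈ supp (faceTuples K (n + 1))) ∧ (∀ t, bd n (A t) = ψ (bd n (of t))) ∧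
      ∀ d, ∀ t ∈ tuples (ball S.length d) (n + 1),
        A t ∈ boundedChains (S.length ∘ φ) (n + 1) (P.eval d) := by
  obtain ⟨P, hP⟩ := hψ.polyBounded
  obtain ⟨Q, hQ⟩ := hfill
  let size : (Fin (n + 1) → G) → ℕ := fun t => Finset.univ.sup fun i => S.length (t i)
  have hsize : ∀ t, t ∈ tuples (ball S.length (size t)) (n + 1) := fun t i =>
    Finset.le_sup (f := fun i => S.length (t i)) (Finset.mem_univ i)
  choose A hA hAbd hAbound using fun t => hQ (P.eval (size t) * (n + 2)) _
    (hψ.mem_faceTuples _) (hψ.isCycle _ (isCycle_bd (of t)))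
    (linearMap_bd_mem_boundedChains (hP _) (hsize t))
  refine ⟨A, Q.comp (P * Polynomial.C (n + 2)), hA, hAbd, fun d t ht =>
    boundedChains_mono ?_ (hAbound t)⟩
  simp only [Polynomial.eval_comp, Polynomial.eval_mul, Polynomial.eval_C]
  exact natPolynomial_eval_mono Q (Nat.mul_le_mul_right _
    (natPolynomial_eval_mono P (Finset.sup_le fun i _ => ht i)))

theorem IsFillingMap.exists_succ (hφ : ∀ g v, φ (g • v) = g * φ v) (hK : IsSimplicialEG G K)
    {ψ : OrdChain G n →ₗ[ℤ] OrdChain V n} (hψ : IsFillingMap S K φ ψ)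
    (hfill : HasPolynomialFillings K (S.length ∘ φ) n) :
    ∃ ψ' : OrdChain G (n + 1) →ₗ[ℤ] OrdChain V (n + 1), IsFillingMap S K φ ψ' ∧
      ∀ c, bd n (ψ' c) = ψ (bd n c) := by
  obtain ⟨A, P, hA, hAbd, hAP⟩ := hψ.exists_filling_bd hfill
  have hbd := bd_equivariantExtension hψ.equivariant hAbd
  refine ⟨equivariantExtension A, ⟨map_smul_equivariantExtension A,
    equivariantExtension_mem_faceTuples hK hA, fun c hc => ?_,
    polyBounded_equivariantExtension hφ hAP⟩, hbd⟩
  change bd n (equivariantExtension A c) = 0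
  rw [hbd, show bd n c = 0 from hc, map_zero]

theorem exists_fillingMaps (hφ : ∀ g v, φ (g • v) = g * φ v) (hK : IsSimplicialEG G K) (v₀ : V)
    (hfill : ∀ n, HasPolynomialFillings K (S.length ∘ φ) n) :
    ∃ ψ : ∀ n, OrdChain G n →ₗ[ℤ] OrdChain V n, ψ 0 = map (· • v₀) ∧
      (∀ n, IsFillingMap S K φ (ψ n)) ∧ ∀ n c, bd n (ψ (n + 1) c) = ψ n (bd n c) := by
  choose next hnext hnextbd using fun (n : ℕ)
    (ψ : {ψ : OrdChain G n →ₗ[ℤ] OrdChain V n // IsFillingMap S K φ ψ}) =>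
    ψ.2.exists_succ hφ hK (hfill n)
  let seq : ∀ n, {ψ : OrdChain G n →ₗ[ℤ] OrdChain V n // IsFillingMap S K φ ψ} := fun n =>
    Nat.rec ⟨_, isFillingMap_zero v₀⟩ (fun n ψ => ⟨next n ψ, hnext n ψ⟩) n
  exact ⟨fun n => (seq n).1, rfl, fun n => (seq n).2, fun n c => hnextbd n (seq n) c⟩

end FillingMap

/-- A polynomially bounded equivariant chain map on the augmented chains of `G` whose values
involve only finitely many orbits of tuples in each degree. Such a map arises as a composition
`C_•(G) → C_•(EG) → C_•(G)` through the simplicial chains of a model with finite skeleta. -/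
structure IsCocompactChainMap {G : Type u} [Group G] (S : FinSymmGenSet G)
    (θ : ∀ n, OrdChain G n →ₗ[ℤ] OrdChain G n) : Prop where
  zero : θ 0 = LinearMap.id
  bd_comm : ∀ n c, bd n (θ (n + 1) c) = θ n (bd n c)
  equivariant : ∀ n (g : G) c, map (g * ·) (θ n c) = θ n (map (g * ·) c)
  polyBounded : ∀ n, PolyBounded S.length S.length (θ n)
  finite_orbits : ∀ n, ∃ F : Finset (Fin n → G), ∀ c,
    θ n c ∈ supp {t | ∃ t' ∈ F, ∃ g : G, t = (g * ·) ∘ t'}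

section

variable {G : Type u} [Group G] {V : Type u} [MulAction G V] {K : AbstractSimplicialComplex V}
  {S : FinSymmGenSet G} {φ : V → G}

theorem isCocompactChainMap_map_comp (hφ : ∀ g v, φ (g • v) = g * φ v)
    (hF : HasFiniteSkeleta G K) {ψ : ∀ n, OrdChain G n →ₗ[ℤ] OrdChain V n} {v₀ : V}
    (hψ₀ : ψ 0 = map (· • v₀)) (hψ : ∀ n, IsFillingMap S K φ (ψ n))
    (hψbd : ∀ n c, bd n (ψ (n + 1) c) = ψ n (bd n c)) :
    IsCocompactChainMap S fun n => map φ ∘ₗ ψ n where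
  zero := hom_ext fun t => by
    rw [LinearMap.comp_apply, hψ₀, map_of, map_of, LinearMap.id_apply]
    exact congrArg of (funext fun i => i.elim0)
  bd_comm n c := by rw [LinearMap.comp_apply, LinearMap.comp_apply, ← map_bd, hψbd]
  equivariant n g c := by
    simp only [LinearMap.comp_apply, ← (hψ n).equivariant, map_map, Function.comp_def, hφ]
  polyBounded n := by
    obtain ⟨P, hP⟩ := (hψ n).polyBounded
    exact ⟨P, fun d t ht => map_mem_boundedChains (f := φ) (ℓ := S.length ∘ φ) (ℓ' := S.length)
      (fun _ hv => hv) le_rfl (hP d t ht)⟩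
  finite_orbits n := by
    classical
    obtain ⟨F, hF⟩ := exists_finset_faceTuples hF n
    refine ⟨F.image (φ ∘ ·), fun c => map_mem (fun t ht => ?_) ((hψ n).mem_faceTuples c)⟩
    obtain ⟨t', ht', g, rfl⟩ := hF t ht
    exact ⟨φ ∘ t', Finset.mem_image_of_mem _ ht', g, funext fun i => hφ _ _⟩

end

end OrdChain

theorem HasPolynomiallyBoundedDehnFunctions.exists_isCocompactChainMap {G : Type u} [Group G]
    (h : HasPolynomiallyBoundedDehnFunctions G) (S : FinSymmGenSet G) :
    ∃ θ, OrdChain.IsCocompactChainMap S θ := by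
  obtain ⟨V, _, _, K, hK, hF, hD⟩ := h
  obtain ⟨φ, hφ⟩ := exists_equivariant_map hK.free
  have := hK.contractible
  have hne : Nonempty K.Realization := inferInstance
  let v₀ : V := Realization.topVertex hne.some
  obtain ⟨ψ, hψ₀, hψ, hψbd⟩ := OrdChain.exists_fillingMaps hφ hK v₀
    (OrdChain.hasPolynomialFillings (S := S) hφ hK hF hD v₀)
  exact ⟨_, OrdChain.isCocompactChainMap_map_comp hφ hF hψ₀ hψ hψbd⟩

/-! ## Tuples with trivial product -/

section TrivialClass

open OrdChain

variable {G : Type u} [Group G] {n m : ℕ}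

/-- The tuple `(tₙ⁻¹ t₀, t₀⁻¹ t₁, …, tₙ₋₁⁻¹ tₙ)` of successive quotients of `t`, which has product
`1` and depends only on the `G`-orbit of `t`. -/
def quotientTuple (t : Fin (n + 1) → G) : Fin (n + 1) → G :=
  Fin.cons ((t (Fin.last n))⁻¹ * t 0) fun i => (t i.castSucc)⁻¹ * t i.succ

theorem tupleProd_eq_partialProd (g : Fin (n + 1) → G) :
    tupleProd g = Fin.partialProd g (Fin.last (n + 1)) := by
  rw [Fin.partialProd, Fin.val_last, List.take_of_length_le (by simp)]
  rfl

theorem partialProd_quotientTuple (t : Fin (n + 1) → G) (i : Fin (n + 1)) :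
    Fin.partialProd (quotientTuple t) i.succ = (t (Fin.last n))⁻¹ * t i := by
  induction i using Fin.induction with
  | zero =>
    rw [Fin.partialProd_succ, Fin.castSucc_zero, Fin.partialProd_zero, one_mul]
    rfl
  | succ i ih =>
    rw [Fin.partialProd_succ, ← Fin.succ_castSucc, ih, quotientTuple, Fin.cons_succ]
    group

theorem tupleProd_quotientTuple (t : Fin (n + 1) → G) : tupleProd (quotientTuple t) = 1 := by
  rw [tupleProd_eq_partialProd, ← Fin.succ_last, partialProd_quotientTuple, inv_mul_cancel]

theorem quotientTuple_apply (t : Fin (n + 1) → G) (a : ℕ → G) (ha : ∀ i, t i = a i)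
    (k : Fin (n + 1)) :
    quotientTuple t k = (a (if (k : ℕ) = 0 then n else k - 1))⁻¹ * a k := by
  refine Fin.cases ?_ (fun k => ?_) k <;> simp [quotientTuple, ha]

theorem hochschildFace_quotientTuple (j : Fin (n + 2)) (t : Fin (n + 2) → G) :
    hochschildFace j (quotientTuple t) = quotientTuple (j.removeNth t) := by
  obtain ⟨a, ha⟩ : ∃ a : ℕ → G, ∀ m : Fin (n + 2), t m = a m :=
    ⟨fun m => if h : m < n + 2 then t ⟨m, h⟩ else 1, fun m => by simp [m.2]⟩
  have hb : ∀ k : Fin (n + 1), j.removeNth t k =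
      (fun k : ℕ => if k < j then a k else a (k + 1)) k := by
    intro k
    rw [Fin.removeNth_apply, ha]
    simp only [Fin.succAbove, Fin.lt_def, Fin.val_castSucc]
    split_ifs <;> simp
  funext k
  rw [hochschildFace_apply, quotientTuple_apply (j.removeNth t)
    (fun k : ℕ => if k < j then a k else a (k + 1)) hb]
  simp only [quotientTuple_apply _ _ ha, Fin.ext_iff, Fin.val_last, Fin.val_castSucc, Fin.val_succ,
    Fin.val_zero]
  have hcancel : ∀ x y z : G, x⁻¹ * y * (y⁻¹ * z) = x⁻¹ * z := fun x y z => by group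
  grind

/-- The tuple of successive quotients of `t`, as a tuple of class `[e]`. -/
def toClassTuple (t : Fin (n + 1) → G) : ClassTuple (ConjClasses.mk (1 : G)) n :=
  ⟨quotientTuple t, by rw [tupleProd_quotientTuple]⟩

theorem face_toClassTuple (j : Fin (n + 2)) (t : Fin (n + 2) → G) :
    (toClassTuple t).face j = toClassTuple (j.removeNth t) :=
  Subtype.ext (hochschildFace_quotientTuple j t)

theorem toClassTuple_mul (g : G) (t : Fin (n + 1) → G) :
    toClassTuple ((g * ·) ∘ t) = toClassTuple t := by
  refine Subtype.ext (funext fun k => ?_)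
  refine Fin.cases ?_ (fun k => ?_) k <;>
    simp [toClassTuple, quotientTuple, mul_assoc]

/-- The tuple `(g₀, g₀ g₁, …, g₀ ⋯ gₙ)` of partial products, the representative with last entry
`1` of the orbit that corresponds to `g`. -/
def ClassTuple.lift (g : ClassTuple (ConjClasses.mk (1 : G)) n) : Fin (n + 1) → G :=
  fun i => Fin.partialProd g.1 i.succ

theorem toClassTuple_lift (g : ClassTuple (ConjClasses.mk (1 : G)) n) :
    toClassTuple g.lift = g := by
  have hg : Fin.partialProd g.1 (Fin.last (n + 1)) = 1 := by
    rw [← tupleProd_eq_partialProd]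
    have := g.2
    rwa [ConjClasses.mk_eq_mk_iff_isConj, isConj_one_left] at this
  refine Subtype.ext (funext fun k => ?_)
  refine Fin.cases ?_ (fun k => ?_) k
  · have := Fin.partialProd_succ g.1 0
    rw [Fin.castSucc_zero, Fin.partialProd_zero, one_mul] at this
    simpa [toClassTuple, quotientTuple, ClassTuple.lift, hg] using this
  · exact Fin.partialProd_right_inv g.1 k.succ

theorem lift_toClassTuple (t : Fin (n + 1) → G) :
    (toClassTuple t).lift = ((t (Fin.last n))⁻¹ * ·) ∘ t :=
  funext fun i => partialProd_quotientTuple t i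

theorem one_le_weight (S : FinSymmGenSet G) {x : ConjClasses G} (g : ClassTuple x n) :
    1 ≤ g.weight S :=
  Finset.prod_pos fun i _ => Nat.add_pos_left one_pos (S.length (g.1 i))

theorem FinSymmGenSet.one_add_length_list_prod_le (S : FinSymmGenSet G) (l : List G) :
    1 + S.length l.prod ≤ (l.map fun g => 1 + S.length g).prod := by
  induction l with
  | nil => simp [S.length_one]
  | cons a l ih =>
    rw [List.prod_cons, List.map_cons, List.prod_cons]
    refine le_trans ?_ (Nat.mul_le_mul_left _ ih)
    have := S.length_mul_le a l.prod
    nlinarith [Nat.zero_le (S.length a * S.length l.prod)]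

theorem lift_mem_tuples_ball (S : FinSymmGenSet G) (g : ClassTuple (ConjClasses.mk (1 : G)) n) :
    g.lift ∈ tuples (ball S.length (g.weight S)) (n + 1) := by
  intro i
  let l := List.ofFn g.1
  have hweight : g.weight S = (l.map fun g => 1 + S.length g).prod := by
    rw [List.map_ofFn, List.prod_ofFn]
    rfl
  have hprefix : ((l.take i.succ).map fun g => 1 + S.length g).prod ≤ g.weight S := by
    rw [hweight]
    conv_rhs => rw [← List.take_append_drop (i.succ : ℕ) l, List.map_append, List.prod_append]
    refine Nat.le_mul_of_pos_right _ (List.prod_pos fun a ha => ?_)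
    obtain ⟨b, -, rfl⟩ := List.mem_map.mp ha
    exact Nat.add_pos_left one_pos _
  exact (Nat.le_add_left _ 1).trans ((S.one_add_length_list_prod_le _).trans hprefix)

theorem weight_toClassTuple_le (S : FinSymmGenSet G) {r : ℕ} {t : Fin (n + 1) → G}
    (ht : t ∈ tuples (ball S.length r) (n + 1)) :
    (toClassTuple t).weight S ≤ (1 + 2 * r) ^ (n + 1) := by
  have hentry : ∀ i j, 1 + S.length ((t i)⁻¹ * t j) ≤ 1 + 2 * r := fun i j => by
    rw [two_mul]
    exact Nat.add_le_add_left ((S.length_mul_le _ _).trans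
      (Nat.add_le_add ((S.length_inv_le _).trans (ht i)) (ht j))) 1
  refine (Finset.prod_le_pow_card _ _ (1 + 2 * r) fun k _ => ?_).trans (by simp)
  exact Fin.cases (hentry _ _) (fun k => hentry _ _) k

/-- The space of Hochschild `n`-chains of `ℂG` of class `[e]`. -/
abbrev HochschildChain (G : Type u) [Group G] (n : ℕ) : Type u :=
  ClassTuple (ConjClasses.mk (1 : G)) n →₀ ℂ

/-- The linear map that sends a tuple of points of `G`, seen as a generator of a chain complex with
free `G`-action, to its orbit, seen as a Hochschild chain of class `[e]`. -/
def toClass : OrdChain G (n + 1) →ₗ[ℤ] HochschildChain G n :=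
  lift fun t => Finsupp.single (toClassTuple t) 1

theorem toClass_of (t : Fin (n + 1) → G) :
    toClass (of t) = Finsupp.single (toClassTuple t) 1 := by
  rw [toClass, lift_of]

theorem toClass_map_mul (g : G) (c : OrdChain G (n + 1)) :
    toClass (map (g * ·) c) = toClass c := by
  suffices h : toClass ∘ₗ map (g * ·) = toClass (G := G) (n := n) from LinearMap.congr_fun h c
  exact hom_ext fun t => by
    rw [LinearMap.comp_apply, map_of, toClass_of, toClass_of, toClassTuple_mul]

/-- The map of Hochschild chains of class `[e]` induced by a map of chains on `G`. It is computed on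
the representative `ClassTuple.lift` of each orbit, hence meaningful for equivariant maps. -/
def descend (F : OrdChain G (n + 1) →ₗ[ℤ] OrdChain G (m + 1)) :
    HochschildChain G n →ₗ[ℂ] HochschildChain G m :=
  Finsupp.linearCombination ℂ fun g => toClass (F (of g.lift))

theorem descend_single (F : OrdChain G (n + 1) →ₗ[ℤ] OrdChain G (m + 1))
    (g : ClassTuple (ConjClasses.mk (1 : G)) n) :
    descend F (Finsupp.single g 1) = toClass (F (of g.lift)) := by
  rw [descend, Finsupp.linearCombination_single, one_smul]

theorem descend_toClass {F : OrdChain G (n + 1) →ₗ[ℤ] OrdChain G (m + 1)}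
    (hF : ∀ (g : G) c, map (g * ·) (F c) = F (map (g * ·) c)) (c : OrdChain G (n + 1)) :
    descend F (toClass c) = toClass (F c) := by
  suffices h : (descend F).toAddMonoidHom.toIntLinearMap ∘ₗ toClass = toClass ∘ₗ F from
    LinearMap.congr_fun h c
  refine hom_ext fun t => ?_
  change descend F (toClass (of t)) = toClass (F (of t))
  rw [toClass_of, descend_single, lift_toClassTuple, ← map_of, ← hF, toClass_map_mul]

theorem single_eq_toClass (g : ClassTuple (ConjClasses.mk (1 : G)) n) :
    Finsupp.single g 1 = toClass (of g.lift) := by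
  rw [toClass_of, toClassTuple_lift]

/-- The Hochschild boundary on the chains of class `[e]`. -/
abbrev hochschildBd (n : ℕ) : HochschildChain G (n + 1) →ₗ[ℂ] HochschildChain G n :=
  alternatingSum (M := HochschildChain G)
    (fun _ j => Finsupp.lmapDomain ℂ ℂ (ClassTuple.face j)) n

theorem hochschildBd_toClass (c : OrdChain G (n + 2)) :
    hochschildBd n (toClass c) = toClass (bd (n + 1) c) := by
  suffices h : (hochschildBd n).toAddMonoidHom.toIntLinearMap ∘ₗ toClass =
      toClass ∘ₗ bd (X := G) (n + 1) from LinearMap.congr_fun h c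
  refine hom_ext fun t => ?_
  change hochschildBd n (toClass (of t)) = toClass (bd (n + 1) (of t))
  simp only [toClass_of, bd_of, map_sum, hochschildBd, alternatingSum, LinearMap.sum_apply]
  refine Finset.sum_congr rfl fun j _ => ?_
  rw [LinearMap.smul_apply, Finsupp.lmapDomain_apply, Finsupp.mapDomain_single, face_toClassTuple,
    map_smul, toClass_of, ← Int.cast_smul_eq_zsmul ℂ]
  push_cast
  rfl

end TrivialClass

/-! ## Bounded operators between weighted `ℓ¹`-spaces -/

namespace RapidDecay

variable {I J L : Type u} {w : I → ℕ} {w' : J → ℕ} {w'' : L → ℕ}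

/-- The norm `∑ᵢ |c i| w(i)^k`. -/
def rdNorm (k : ℕ) (c : RapidDecay w) : ℝ := ∑' i, ‖c.1 i‖ * (w i : ℝ) ^ k

theorem rdNorm_nonneg (k : ℕ) (c : RapidDecay w) : 0 ≤ rdNorm k c :=
  tsum_nonneg fun i => by positivity

theorem rdNorm_add_le (k : ℕ) (a b : RapidDecay w) :
    rdNorm k (a + b) ≤ rdNorm k a + rdNorm k b := by
  rw [rdNorm, rdNorm, rdNorm, ← (a.2 k).tsum_add (b.2 k)]
  refine ((a + b).2 k).tsum_le_tsum (fun i => ?_) ((a.2 k).add (b.2 k))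
  rw [← add_mul]
  exact mul_le_mul_of_nonneg_right (norm_add_le _ _) (by positivity)

theorem rdNorm_smul (k : ℕ) (r : ℂ) (a : RapidDecay w) :
    rdNorm k (r • a) = ‖r‖ * rdNorm k a := by
  rw [rdNorm, rdNorm, ← tsum_mul_left]
  refine tsum_congr fun i => ?_
  rw [← mul_assoc, ← norm_mul]
  rfl

theorem rdNorm_zero (k : ℕ) : rdNorm k (0 : RapidDecay w) = 0 := by
  simpa using rdNorm_smul k 0 (0 : RapidDecay w)

theorem rdNorm_mono (hw : ∀ i, 1 ≤ w i) {k l : ℕ} (h : k ≤ l) (c : RapidDecay w) :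
    rdNorm k c ≤ rdNorm l c :=
  (c.2 k).tsum_le_tsum (fun i => mul_le_mul_of_nonneg_left
    (pow_le_pow_right₀ (by exact_mod_cast hw i) h) (norm_nonneg _)) (c.2 l)

theorem rdNorm_sum_le {K : Type*} (k : ℕ) (s : Finset K) (f : K → RapidDecay w) :
    rdNorm k (∑ x ∈ s, f x) ≤ ∑ x ∈ s, rdNorm k (f x) := by
  classical
  induction s using Finset.induction_on with
  | empty => simp [rdNorm_zero]
  | insert a s ha ih =>
    rw [Finset.sum_insert ha, Finset.sum_insert ha]
    exact (rdNorm_add_le _ _ _).trans (by linarith)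

theorem rdNorm_incl_single (k : ℕ) (i : I) (z : ℂ) :
    rdNorm k (incl w (Finsupp.single i z)) = ‖z‖ * (w i : ℝ) ^ k := by
  classical
  rw [rdNorm, tsum_eq_single i]
  · change ‖Finsupp.single i z i‖ * _ = _
    rw [Finsupp.single_eq_same]
  · intro j hj
    change ‖Finsupp.single i z j‖ * _ = _
    rw [Finsupp.single_eq_of_ne hj, norm_zero, zero_mul]

theorem eq_zero_of_rdNorm_eq_zero {c : RapidDecay w} (h : rdNorm 0 c = 0) : c = 0 := by
  refine Subtype.ext (funext fun i => ?_)
  have hterms := (hasSum_zero_iff_of_nonneg fun i => by positivity).mp ((c.2 0).hasSum_iff.mpr h)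
  simpa using congrFun hterms i

theorem incl_injective (w : I → ℕ) : Function.Injective (incl w) := fun _ _ h =>
  DFunLike.coe_injective (congrArg Subtype.val h)

theorem rdNorm_sub_incl_indicator (k : ℕ) (c : RapidDecay w) (s : Finset I) :
    rdNorm k (c - incl w (Finsupp.indicator s fun i _ => c.1 i)) =
      rdNorm k c - ∑ i ∈ s, ‖c.1 i‖ * (w i : ℝ) ^ k := by
  classical
  let f : I → ℝ := fun i => if i ∈ s then ‖c.1 i‖ * (w i : ℝ) ^ k else 0
  have hf : HasSum f (∑ i ∈ s, ‖c.1 i‖ * (w i : ℝ) ^ k) := by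
    rw [← Finset.sum_congr rfl fun i hi => if_pos hi]
    exact hasSum_sum_of_ne_finset_zero fun i hi => if_neg hi
  rw [rdNorm, rdNorm, ← hf.tsum_eq, ← (c.2 k).tsum_sub hf.summable]
  refine tsum_congr fun i => ?_
  change ‖c.1 i - Finsupp.indicator s (fun i _ => c.1 i) i‖ * _ = _ - f i
  rw [Finsupp.indicator_apply]
  split_ifs with hi <;> simp [f, hi]

theorem tendsto_rdNorm_sub_incl_indicator (k : ℕ) (c : RapidDecay w) :
    Filter.Tendsto (fun s => rdNorm k (c - incl w (Finsupp.indicator s fun i _ => c.1 i)))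
      Filter.atTop (𝓝 0) := by
  simp only [rdNorm_sub_incl_indicator]
  rw [← sub_self (rdNorm k c)]
  exact (c.2 k).hasSum.const_sub _

/-- An operator is bounded if each of the norms of its values is bounded by some norm of the
argument. -/
def IsBoundedOp (T : RapidDecay w →ₗ[ℂ] RapidDecay w') : Prop :=
  ∀ k, ∃ (C : ℝ) (m : ℕ), 0 ≤ C ∧ ∀ c, rdNorm k (T c) ≤ C * rdNorm m c

namespace IsBoundedOp

theorem id : IsBoundedOp (LinearMap.id : RapidDecay w →ₗ[ℂ] RapidDecay w) :=
  fun k => ⟨1, k, zero_le_one, fun c => by simp⟩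

theorem comp {T : RapidDecay w' →ₗ[ℂ] RapidDecay w''} {T' : RapidDecay w →ₗ[ℂ] RapidDecay w'}
    (hT : IsBoundedOp T) (hT' : IsBoundedOp T') : IsBoundedOp (T ∘ₗ T') := by
  intro k
  obtain ⟨C, m, hC, h⟩ := hT k
  obtain ⟨C', m', hC', h'⟩ := hT' m
  refine ⟨C * C', m', mul_nonneg hC hC', fun c => (h _).trans ?_⟩
  rw [mul_assoc]
  exact mul_le_mul_of_nonneg_left (h' c) hC

theorem smul {T : RapidDecay w →ₗ[ℂ] RapidDecay w'} (hT : IsBoundedOp T) (r : ℂ) :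
    IsBoundedOp (r • T) := by
  intro k
  obtain ⟨C, m, hC, h⟩ := hT k
  refine ⟨‖r‖ * C, m, by positivity, fun c => ?_⟩
  rw [LinearMap.smul_apply, rdNorm_smul, mul_assoc]
  exact mul_le_mul_of_nonneg_left (h c) (norm_nonneg r)

theorem zero : IsBoundedOp (0 : RapidDecay w →ₗ[ℂ] RapidDecay w') :=
  fun k => ⟨0, 0, le_rfl, fun c => by simp [rdNorm_zero]⟩

theorem add (hw : ∀ i, 1 ≤ w i) {T T' : RapidDecay w →ₗ[ℂ] RapidDecay w'} (hT : IsBoundedOp T)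
    (hT' : IsBoundedOp T') : IsBoundedOp (T + T') := by
  intro k
  obtain ⟨C, m, hC, h⟩ := hT k
  obtain ⟨C', m', hC', h'⟩ := hT' k
  refine ⟨C + C', max m m', add_nonneg hC hC', fun c => (rdNorm_add_le _ _ _).trans ?_⟩
  rw [add_mul]
  exact add_le_add
    ((h c).trans (mul_le_mul_of_nonneg_left (rdNorm_mono hw (le_max_left _ _) c) hC))
    ((h' c).trans (mul_le_mul_of_nonneg_left (rdNorm_mono hw (le_max_right _ _) c) hC'))

theorem sub (hw : ∀ i, 1 ≤ w i) {T T' : RapidDecay w →ₗ[ℂ] RapidDecay w'} (hT : IsBoundedOp T)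
    (hT' : IsBoundedOp T') : IsBoundedOp (T - T') := by
  have h : T - T' = T + (-1 : ℂ) • T' := LinearMap.ext fun c => by
    rw [LinearMap.sub_apply, LinearMap.add_apply, LinearMap.smul_apply, neg_one_smul,
      sub_eq_add_neg]
  rw [h]
  exact hT.add hw (hT'.smul (-1))

theorem sum (hw : ∀ i, 1 ≤ w i) {K : Type*} (s : Finset K)
    {T : K → RapidDecay w →ₗ[ℂ] RapidDecay w'} (hT : ∀ x, IsBoundedOp (T x)) :
    IsBoundedOp (∑ x ∈ s, T x) := by
  classical
  induction s using Finset.induction_on with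
  | empty => simpa using zero
  | insert a s ha ih =>
    rw [Finset.sum_insert ha]
    exact (hT a).add hw ih

theorem eq_zero {T : RapidDecay w →ₗ[ℂ] RapidDecay w'} (hT : IsBoundedOp T)
    (h : T ∘ₗ incl w = 0) : T = 0 := by
  refine LinearMap.ext fun c => eq_zero_of_rdNorm_eq_zero ((rdNorm_nonneg _ _).antisymm' ?_)
  obtain ⟨C, m, -, hC⟩ := hT 0
  have hlim := (tendsto_rdNorm_sub_incl_indicator m c).const_mul C
  rw [mul_zero] at hlim
  refine ge_of_tendsto' hlim fun s => ?_
  have hT_sub : T (c - incl w (Finsupp.indicator s fun i _ => c.1 i)) = T c := by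
    rw [map_sub, ← LinearMap.comp_apply, h, LinearMap.zero_apply, sub_zero]
  exact hT_sub ▸ hC _

theorem ext (hw : ∀ i, 1 ≤ w i) {T T' : RapidDecay w →ₗ[ℂ] RapidDecay w'} (hT : IsBoundedOp T)
    (hT' : IsBoundedOp T') (h : ∀ y, T (incl w y) = T' (incl w y)) : T = T' :=
  sub_eq_zero.mp ((hT.sub hw hT').eq_zero (LinearMap.ext fun y => by simp [h y]))

end IsBoundedOp

theorem isBoundedOp_push (f : I → J) (hf : ∀ i, w' (f i) ≤ w i) :
    IsBoundedOp (push f hf) := by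
  refine fun k => ⟨1, k, zero_le_one, fun c => ?_⟩
  rw [one_mul]
  have hs : Summable fun p : (Σ j : J, {i // f i = j}) => ‖c.1 p.2‖ * (w p.2 : ℝ) ^ k :=
    (Equiv.sigmaFiberEquiv f).summable_iff.mpr (c.2 k)
  have hs0 : ∀ j, Summable fun i : {i // f i = j} => ‖c.1 i‖ := fun j =>
    (summable_fiber c f j).norm
  have htot : rdNorm k c = ∑' j, ∑' i : {i // f i = j}, ‖c.1 i‖ * (w i : ℝ) ^ k := by
    rw [← hs.tsum_sigma, rdNorm, ← (Equiv.sigmaFiberEquiv f).tsum_eq]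
    rfl
  rw [htot]
  refine ((push f hf c).2 k).tsum_le_tsum (fun j => ?_) hs.sigma
  calc ‖∑' i : {i // f i = j}, c.1 i‖ * (w' j : ℝ) ^ k
      ≤ (∑' i : {i // f i = j}, ‖c.1 i‖) * (w' j : ℝ) ^ k :=
        mul_le_mul_of_nonneg_right (norm_tsum_le_tsum_norm (hs0 j)) (by positivity)
    _ = ∑' i : {i // f i = j}, ‖c.1 i‖ * (w' j : ℝ) ^ k := tsum_mul_right.symm
    _ ≤ ∑' i : {i // f i = j}, ‖c.1 i‖ * (w i : ℝ) ^ k := by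
        refine Summable.tsum_le_tsum (fun i => ?_) ((hs0 j).mul_right _) (hs.sigma_factor j)
        obtain ⟨i, rfl⟩ := i
        have := hf i
        gcongr

/-- Every norm of the image of the basis element `i` is bounded by a polynomial in `w i`; this is
the condition under which a linear map of finitely supported functions extends to the
completions. -/
def IsBoundedMatrix (w : I → ℕ) (w' : J → ℕ) (A : (I →₀ ℂ) →ₗ[ℂ] (J →₀ ℂ)) : Prop :=
  ∀ k, ∃ (C : ℝ) (m : ℕ), 0 ≤ C ∧
    ∀ i, rdNorm k (incl w' (A (Finsupp.single i 1))) ≤ C * (w i : ℝ) ^ m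

section Extend

variable {A : (I →₀ ℂ) →ₗ[ℂ] (J →₀ ℂ)}

theorem IsBoundedMatrix.summable (hA : IsBoundedMatrix w w' A) (k : ℕ) (c : RapidDecay w) :
    Summable fun p : I × J => ‖c.1 p.1‖ * (‖A (Finsupp.single p.1 1) p.2‖ * (w' p.2 : ℝ) ^ k) := by
  obtain ⟨C, m, -, hC⟩ := hA k
  have hnonneg : ∀ i j, 0 ≤ ‖c.1 i‖ * (‖A (Finsupp.single i 1) j‖ * (w' j : ℝ) ^ k) :=
    fun i j => by positivity
  have hrow : ∀ i, Summable fun j => ‖c.1 i‖ * (‖A (Finsupp.single i 1) j‖ * (w' j : ℝ) ^ k) :=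
    fun i => ((incl w' (A (Finsupp.single i 1))).2 k).mul_left _
  have hrow_le : ∀ i, ∑' j, ‖c.1 i‖ * (‖A (Finsupp.single i 1) j‖ * (w' j : ℝ) ^ k) ≤
      C * (‖c.1 i‖ * (w i : ℝ) ^ m) := fun i => by
    rw [tsum_mul_left, mul_left_comm]
    exact mul_le_mul_of_nonneg_left (hC i) (norm_nonneg _)
  exact (summable_prod_of_nonneg fun p => hnonneg p.1 p.2).mpr ⟨hrow,
    Summable.of_nonneg_of_le (fun i => tsum_nonneg (hnonneg i)) hrow_le ((c.2 m).mul_left C)⟩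

theorem IsBoundedMatrix.summable_entry (hA : IsBoundedMatrix w w' A) (c : RapidDecay w) (j : J) :
    Summable fun i => c.1 i * A (Finsupp.single i 1) j := by
  refine Summable.of_norm ?_
  have := (hA.summable 0 c).prod_symm.prod_factor j
  simpa using this

theorem IsBoundedMatrix.norm_tsum_mul_le (hA : IsBoundedMatrix w w' A) (k : ℕ)
    (c : RapidDecay w) (j : J) :
    ‖∑' i, c.1 i * A (Finsupp.single i 1) j‖ * (w' j : ℝ) ^ k ≤
      ∑' i, ‖c.1 i‖ * (‖A (Finsupp.single i 1) j‖ * (w' j : ℝ) ^ k) := by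
  refine (mul_le_mul_of_nonneg_right (norm_tsum_le_tsum_norm (hA.summable_entry c j).norm)
    (by positivity)).trans_eq ?_
  rw [← tsum_mul_right]
  exact tsum_congr fun i => by rw [norm_mul, mul_assoc]

/-- The continuous extension of a linear map with polynomial bounds. -/
def extend (hA : IsBoundedMatrix w w' A) : RapidDecay w →ₗ[ℂ] RapidDecay w' where
  toFun c := ⟨fun j => ∑' i, c.1 i * A (Finsupp.single i 1) j, fun k =>
    Summable.of_nonneg_of_le (fun j => by positivity) (fun j => hA.norm_tsum_mul_le k c j)
      (hA.summable k c).prod_symm.prod⟩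
  map_add' a b := Subtype.ext <| funext fun j => by
    refine (tsum_congr fun i => ?_).trans
      ((hA.summable_entry a j).tsum_add (hA.summable_entry b j))
    exact add_mul _ _ _
  map_smul' r a := Subtype.ext <| funext fun j =>
    (tsum_congr fun i => mul_assoc _ _ _).trans tsum_mul_left

theorem extend_apply (hA : IsBoundedMatrix w w' A) (c : RapidDecay w) (j : J) :
    (extend hA c).1 j = ∑' i, c.1 i * A (Finsupp.single i 1) j := rfl

theorem extend_incl (hA : IsBoundedMatrix w w' A) (y : I →₀ ℂ) :
    extend hA (incl w y) = incl w' (A y) := by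
  classical
  suffices h : extend hA ∘ₗ incl w = incl w' ∘ₗ A from LinearMap.congr_fun h y
  refine Finsupp.lhom_ext' fun i => LinearMap.ext_ring (Subtype.ext (funext fun j => ?_))
  change ∑' i', Finsupp.single i (1 : ℂ) i' * A (Finsupp.single i' 1) j = A (Finsupp.single i 1) j
  rw [tsum_eq_single i]
  · simp
  · intro i' hi'
    rw [Finsupp.single_eq_of_ne hi', zero_mul]

theorem isBoundedOp_extend (hA : IsBoundedMatrix w w' A) : IsBoundedOp (extend hA) := by
  intro k
  obtain ⟨C, m, hC, hCm⟩ := hA k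
  refine ⟨C, m, hC, fun c => ?_⟩
  have hs := hA.summable k c
  have hrow_le : ∀ i, ‖c.1 i‖ * rdNorm k (incl w' (A (Finsupp.single i 1))) ≤
      C * (‖c.1 i‖ * (w i : ℝ) ^ m) := fun i => by
    rw [mul_left_comm]
    exact mul_le_mul_of_nonneg_left (hCm i) (norm_nonneg _)
  calc rdNorm k (extend hA c)
      ≤ ∑' j, ∑' i, ‖c.1 i‖ * (‖A (Finsupp.single i 1) j‖ * (w' j : ℝ) ^ k) :=
        ((extend hA c).2 k).tsum_le_tsum (fun j => hA.norm_tsum_mul_le k c j) hs.prod_symm.prod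
    _ = ∑' i, ∑' j, ‖c.1 i‖ * (‖A (Finsupp.single i 1) j‖ * (w' j : ℝ) ^ k) :=
        Summable.tsum_comm hs
    _ = ∑' i, ‖c.1 i‖ * rdNorm k (incl w' (A (Finsupp.single i 1))) :=
        tsum_congr fun i => tsum_mul_left
    _ ≤ ∑' i, C * (‖c.1 i‖ * (w i : ℝ) ^ m) :=
        Summable.tsum_le_tsum hrow_le (Summable.of_nonneg_of_le
          (fun i => mul_nonneg (norm_nonneg _) (rdNorm_nonneg _ _)) hrow_le
          ((c.2 m).mul_left C)) ((c.2 m).mul_left C)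
    _ = C * rdNorm m c := tsum_mul_left

theorem extend_mem_range_incl (hA : IsBoundedMatrix w w' A) {F : Set J} (hF : F.Finite)
    (h : ∀ i, ∀ j ∉ F, A (Finsupp.single i 1) j = 0) (c : RapidDecay w) :
    extend hA c ∈ LinearMap.range (incl w') := by
  refine ⟨Finsupp.onFinset hF.toFinset (extend hA c).1 fun j hj => ?_, rfl⟩
  by_contra hjF
  refine hj ?_
  rw [extend_apply, tsum_congr fun i => ?_, tsum_zero]
  rw [h i j (by simpa using hjF), mul_zero]

end Extend

end RapidDecay

/-! ## The comparison map for the class of the neutral element -/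

theorem natPolynomial_eval_le_mul_pow (P : Polynomial ℕ) {d : ℕ} (hd : 1 ≤ d) :
    P.eval d ≤ P.eval 1 * d ^ P.natDegree := by
  rw [Polynomial.eval_eq_sum_range, Polynomial.eval_eq_sum_range, Finset.sum_mul]
  refine Finset.sum_le_sum fun i hi => ?_
  rw [one_pow, mul_one]
  exact Nat.mul_le_mul_left _
    (Nat.pow_le_pow_right hd (Nat.lt_succ_iff.mp (Finset.mem_range.mp hi)))

/-- A homotopy of chain maps between `ℕ`-indexed chain complexes, from its components. -/
def homotopyOfComponents {C : Type*} [Category* C] [Preadditive C] {K L : ChainComplex C ℕ}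
    {f g : K ⟶ L} (h : ∀ n, K.X n ⟶ L.X (n + 1)) (h_zero : f.f 0 = h 0 ≫ L.d 1 0 + g.f 0)
    (h_succ : ∀ n, f.f (n + 1) =
      K.d (n + 1) n ≫ h n + h (n + 1) ≫ L.d (n + 2) (n + 1) + g.f (n + 1)) : Homotopy f g :=
  Homotopy.equivSubZero.symm <| (Homotopy.ofEq (HomologicalComplex.hom_ext _ _ fun n => by
    cases n with
    | zero =>
      rw [Homotopy.nullHomotopicMap'_f_of_not_rel_left rfl (fun l hl => Nat.succ_ne_zero l hl),
        HomologicalComplex.sub_f_apply, sub_eq_iff_eq_add]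
      exact h_zero
    | succ n =>
      rw [Homotopy.nullHomotopicMap'_f rfl rfl, HomologicalComplex.sub_f_apply,
        sub_eq_iff_eq_add]
      exact h_succ n)).trans (Homotopy.nullHomotopy' fun i _ hij => hij ▸ h i)

section Comparison

open OrdChain RapidDecay

variable {G : Type u} [Group G] {S : FinSymmGenSet G} {n m : ℕ}

theorem rdNorm_incl_toClass_le {r k : ℕ} {c : OrdChain G (n + 1)}
    (hc : c ∈ supp (tuples (ball S.length r) (n + 1))) :
    rdNorm k (incl (fun g => g.weight S) (toClass c)) ≤
      ((lOne c * ((1 + 2 * r) ^ (n + 1)) ^ k : ℕ) : ℝ) := by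
  have htoClass : toClass c =
      ∑ t ∈ c.support, Finsupp.single (toClassTuple t) ((c t : ℤ) : ℂ) := by
    rw [toClass, OrdChain.lift, Finsupp.linearCombination_apply, Finsupp.sum]
    refine Finset.sum_congr rfl fun t _ => ?_
    rw [Finsupp.smul_single, zsmul_one]
  rw [htoClass, map_sum, lOne_eq_sum, Finset.sum_mul]
  push_cast
  refine (rdNorm_sum_le _ _ _).trans (Finset.sum_le_sum fun t ht => ?_)
  rw [rdNorm_incl_single, Complex.norm_intCast, Nat.cast_natAbs, Int.cast_abs]
  refine mul_le_mul_of_nonneg_left ?_ (abs_nonneg _)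
  exact_mod_cast Nat.pow_le_pow_left (weight_toClassTuple_le S (hc ht)) k

theorem isBoundedMatrix_descend {F : OrdChain G (n + 1) →ₗ[ℤ] OrdChain G (m + 1)}
    (hF : PolyBounded S.length S.length F) :
    IsBoundedMatrix (fun g => g.weight S) (fun g => g.weight S) (descend F) := by
  intro k
  obtain ⟨P, hP⟩ := hF
  let R : Polynomial ℕ := P * ((1 + 2 * P) ^ (m + 1)) ^ k
  refine ⟨((R.eval 1 : ℕ) : ℝ), R.natDegree, Nat.cast_nonneg _, fun g => ?_⟩
  obtain ⟨hnorm, hsupp⟩ := hP (g.weight S) g.lift (lift_mem_tuples_ball S g)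
  rw [descend_single]
  refine (rdNorm_incl_toClass_le hsupp).trans ?_
  have hle : lOne (F (of g.lift)) * ((1 + 2 * P.eval (g.weight S)) ^ (m + 1)) ^ k ≤
      R.eval (g.weight S) := by
    simp only [R, Polynomial.eval_mul, Polynomial.eval_pow, Polynomial.eval_add,
      Polynomial.eval_one, Polynomial.eval_ofNat]
    exact Nat.mul_le_mul_right _ hnorm
  exact_mod_cast hle.trans (natPolynomial_eval_le_mul_pow R (one_le_weight S g))

theorem linearMap_ext_toClass {M : Type*} [AddCommGroup M] [Module ℂ M]
    {A A' : HochschildChain G n →ₗ[ℂ] M} (h : ∀ c, A (toClass c) = A' (toClass c)) : A = A' :=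
  Finsupp.lhom_ext' fun g => LinearMap.ext_ring (by
    simpa only [LinearMap.comp_apply, Finsupp.lsingle_apply, single_eq_toClass] using h (of g.lift))

/-- The space of Hochschild `n`-chains of `ℓ¹_∞ G` of class `[e]`. -/
abbrev RdHochschildChain (S : FinSymmGenSet G) (n : ℕ) :
    Submodule ℂ (ClassTuple (ConjClasses.mk (1 : G)) n → ℂ) :=
  RapidDecay fun g => g.weight S

variable (S) in
/-- The boundary of the completed Hochschild complex of class `[e]`. -/
abbrev rdHochschildBd (n : ℕ) : RdHochschildChain S (n + 1) →ₗ[ℂ] RdHochschildChain S n :=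
  alternatingSum (M := fun n => RdHochschildChain S n)
    (fun _ j => push (ClassTuple.face j) (ClassTuple.weight_face_le S j)) n

theorem rdHochschildBd_incl (y : HochschildChain G (n + 1)) :
    rdHochschildBd S n (incl _ y) = incl _ (hochschildBd n y) := by
  simp only [rdHochschildBd, hochschildBd, alternatingSum, LinearMap.sum_apply,
    LinearMap.smul_apply, map_sum, map_smul]
  refine Finset.sum_congr rfl fun j _ => ?_
  congr 1
  exact LinearMap.congr_fun
    (push_comp_incl (ClassTuple.face j) (ClassTuple.weight_face_le S j)) y

theorem isBoundedOp_rdHochschildBd : IsBoundedOp (rdHochschildBd (G := G) S n) := by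
  simp only [rdHochschildBd, alternatingSum]
  exact IsBoundedOp.sum (one_le_weight S) _ fun j => (isBoundedOp_push _ _).smul _

theorem hochschildComplex_d (n : ℕ) : (hochschildComplex (ConjClasses.mk (1 : G))).d (n + 1) n =
    ModuleCat.ofHom (hochschildBd n) := by
  simp only [hochschildComplex, alternatingComplex, ChainComplex.of_d, hochschildBd]

theorem rdHochschildComplex_d (n : ℕ) :
    (rdHochschildComplex S (ConjClasses.mk (1 : G))).d (n + 1) n =
      ModuleCat.ofHom (rdHochschildBd S n) := by
  simp only [rdHochschildComplex, alternatingComplex, ChainComplex.of_d, rdHochschildBd]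

/-! ### The homotopy equivalence given by a cocompact chain map -/

namespace OrdChain.IsCocompactChainMap

variable {θ : ∀ n, OrdChain G n →ₗ[ℤ] OrdChain G n}

/-- The chain homotopy between the identity and `θ` obtained by coning off from the first vertex of
each simplex, a choice which makes it equivariant. -/
abbrev contraction (θ : ∀ n, OrdChain G n →ₗ[ℤ] OrdChain G n) (n : ℕ) :
    OrdChain G n →ₗ[ℤ] OrdChain G (n + 1) :=
  coneHomotopy θ (fun _ t => t 0) n

theorem map_contraction (hθ : IsCocompactChainMap S θ) (g : G) (c : OrdChain G n) :
    map (g * ·) (contraction θ n c) = contraction θ n (map (g * ·) c) :=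
  map_coneHomotopy (fun n c => hθ.equivariant n g c) (fun _ _ => rfl) c

theorem hochschildBd_comp_descend (hθ : IsCocompactChainMap S θ) (n : ℕ) :
    hochschildBd n ∘ₗ descend (θ (n + 2)) = descend (θ (n + 1)) ∘ₗ hochschildBd n :=
  linearMap_ext_toClass fun c => by
    simp only [LinearMap.comp_apply, descend_toClass (hθ.equivariant _), hochschildBd_toClass,
      hθ.bd_comm]

theorem hochschildBd_zero_comp_descend_contraction (hθ : IsCocompactChainMap S θ) :
    hochschildBd 0 ∘ₗ descend (contraction θ 1) = LinearMap.id - descend (θ 1) :=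
  linearMap_ext_toClass fun c => by
    have hzero : contraction θ 0 = 0 := rfl
    simp only [LinearMap.comp_apply, LinearMap.sub_apply, LinearMap.id_apply,
      descend_toClass (hθ.equivariant _), descend_toClass hθ.map_contraction,
      hochschildBd_toClass, bd_coneHomotopy hθ.zero hθ.bd_comm, hzero, map_sub,
      LinearMap.zero_apply, sub_zero]

theorem hochschildBd_succ_comp_descend_contraction (hθ : IsCocompactChainMap S θ) (n : ℕ) :
    hochschildBd (n + 1) ∘ₗ descend (contraction θ (n + 2)) =
      LinearMap.id - descend (θ (n + 2)) - descend (contraction θ (n + 1)) ∘ₗ hochschildBd n :=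
  linearMap_ext_toClass fun c => by
    simp only [LinearMap.comp_apply, LinearMap.sub_apply, LinearMap.id_apply,
      descend_toClass (hθ.equivariant _), descend_toClass hθ.map_contraction,
      hochschildBd_toClass, bd_coneHomotopy hθ.zero hθ.bd_comm, map_sub]

/-- The continuous extension of the chain map induced by `θ`. -/
def rdChainMap (hθ : IsCocompactChainMap S θ) (n : ℕ) :
    RdHochschildChain S n →ₗ[ℂ] RdHochschildChain S n :=
  extend (isBoundedMatrix_descend (hθ.polyBounded (n + 1)))

/-- The continuous extension of the homotopy induced by `contraction`. -/
def rdContraction (hθ : IsCocompactChainMap S θ) (n : ℕ) :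
    RdHochschildChain S n →ₗ[ℂ] RdHochschildChain S (n + 1) :=
  extend (isBoundedMatrix_descend (polyBounded_coneHomotopy hθ.polyBounded (n + 1)))

theorem rdChainMap_incl (hθ : IsCocompactChainMap S θ) (y : HochschildChain G n) :
    hθ.rdChainMap n (incl _ y) = incl _ (descend (θ (n + 1)) y) :=
  extend_incl _ y

theorem rdContraction_incl (hθ : IsCocompactChainMap S θ) (y : HochschildChain G n) :
    hθ.rdContraction n (incl _ y) = incl _ (descend (contraction θ (n + 1)) y) :=
  extend_incl _ y

theorem rdHochschildBd_comp_rdChainMap (hθ : IsCocompactChainMap S θ) (n : ℕ) :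
    rdHochschildBd S n ∘ₗ hθ.rdChainMap (n + 1) = hθ.rdChainMap n ∘ₗ rdHochschildBd S n :=
  IsBoundedOp.ext (one_le_weight S) (isBoundedOp_rdHochschildBd.comp (isBoundedOp_extend _))
    ((isBoundedOp_extend _).comp isBoundedOp_rdHochschildBd) fun y => by
      simpa only [LinearMap.comp_apply, rdChainMap_incl, rdHochschildBd_incl] using
        congrArg (incl _) (LinearMap.congr_fun (hθ.hochschildBd_comp_descend n) y)

theorem rdHochschildBd_zero_comp_rdContraction (hθ : IsCocompactChainMap S θ) :
    rdHochschildBd S 0 ∘ₗ hθ.rdContraction 0 = LinearMap.id - hθ.rdChainMap 0 :=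
  IsBoundedOp.ext (one_le_weight S) (isBoundedOp_rdHochschildBd.comp (isBoundedOp_extend _))
    (IsBoundedOp.id.sub (one_le_weight S) (isBoundedOp_extend _)) fun y => by
      simpa only [LinearMap.comp_apply, LinearMap.sub_apply, LinearMap.id_apply, map_sub,
        rdChainMap_incl, rdContraction_incl, rdHochschildBd_incl] using
        congrArg (incl _) (LinearMap.congr_fun hθ.hochschildBd_zero_comp_descend_contraction y)

theorem rdHochschildBd_succ_comp_rdContraction (hθ : IsCocompactChainMap S θ) (n : ℕ) :
    rdHochschildBd S (n + 1) ∘ₗ hθ.rdContraction (n + 1) =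
      LinearMap.id - hθ.rdChainMap (n + 1) - hθ.rdContraction n ∘ₗ rdHochschildBd S n :=
  IsBoundedOp.ext (one_le_weight S) (isBoundedOp_rdHochschildBd.comp (isBoundedOp_extend _))
    ((IsBoundedOp.id.sub (one_le_weight S) (isBoundedOp_extend _)).sub (one_le_weight S)
      ((isBoundedOp_extend _).comp isBoundedOp_rdHochschildBd)) fun y => by
      simpa only [LinearMap.comp_apply, LinearMap.sub_apply, LinearMap.id_apply, map_sub,
        rdChainMap_incl, rdContraction_incl, rdHochschildBd_incl] using
        congrArg (incl _) (LinearMap.congr_fun (hθ.hochschildBd_succ_comp_descend_contraction n) y)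

theorem rdChainMap_mem_range_incl (hθ : IsCocompactChainMap S θ) (c : RdHochschildChain S n) :
    hθ.rdChainMap n c ∈ LinearMap.range (incl _) := by
  obtain ⟨F, hF⟩ := hθ.finite_orbits (n + 1)
  let T : Set (ClassTuple (ConjClasses.mk (1 : G)) n) := toClassTuple '' (F : Set (Fin (n + 1) → G))
  refine extend_mem_range_incl _ (F := T) (F.finite_toSet.image _) (fun g j hj => ?_) c
  rw [descend_single]
  have hsupp : toClass (θ (n + 1) (of g.lift)) ∈ (Finsupp.supported ℂ ℂ T).restrictScalars ℤ := by
    refine map_mem_of_mem_supported toClass ?_ (hF (of g.lift))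
    rintro _ ⟨t, ht, g', rfl⟩
    rw [toClass_of, toClassTuple_mul]
    exact Finsupp.single_mem_supported ℂ 1 ⟨t, ht, rfl⟩
  exact Finsupp.notMem_support_iff.mp fun hmem => hj (hsupp hmem)

/-- `rdChainMap`, with values in the finitely supported chains; this is where the cocompactness of
`θ` enters. -/
def compression (hθ : IsCocompactChainMap S θ) (n : ℕ) :
    RdHochschildChain S n →ₗ[ℂ] HochschildChain G n :=
  (LinearEquiv.ofInjective (incl _) (incl_injective _)).symm.toLinearMap ∘ₗ
    (hθ.rdChainMap n).codRestrict _ hθ.rdChainMap_mem_range_incl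

theorem incl_compression (hθ : IsCocompactChainMap S θ) (c : RdHochschildChain S n) :
    incl _ (hθ.compression n c) = hθ.rdChainMap n c :=
  congrArg Subtype.val ((LinearEquiv.ofInjective (incl _) (incl_injective _)).apply_symm_apply
    ((hθ.rdChainMap n).codRestrict _ hθ.rdChainMap_mem_range_incl c))

theorem compression_incl (hθ : IsCocompactChainMap S θ) (y : HochschildChain G n) :
    hθ.compression n (incl _ y) = descend (θ (n + 1)) y :=
  incl_injective _ (by rw [incl_compression, rdChainMap_incl])

theorem hochschildBd_compression (hθ : IsCocompactChainMap S θ)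
    (c : RdHochschildChain S (n + 1)) :
    hochschildBd n (hθ.compression (n + 1) c) = hθ.compression n (rdHochschildBd S n c) :=
  incl_injective _ (by
    rw [← rdHochschildBd_incl, incl_compression, incl_compression]
    exact LinearMap.congr_fun (hθ.rdHochschildBd_comp_rdChainMap n) c)

/-- The maps `compression` as a chain map, a homotopy inverse of the comparison map. -/
def compressionHom (hθ : IsCocompactChainMap S θ) :
    rdHochschildComplex S (ConjClasses.mk (1 : G)) ⟶ hochschildComplex (ConjClasses.mk (1 : G)) :=
  ChainComplex.ofHom (fun n => ModuleCat.ofHom (hθ.compression n)) fun n => by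
    rw [hochschildComplex_d, rdHochschildComplex_d]
    exact ModuleCat.hom_ext (LinearMap.ext hθ.hochschildBd_compression)

theorem eq_hochschildBd_zero_add_compression (hθ : IsCocompactChainMap S θ)
    (y : HochschildChain G 0) :
    y = hochschildBd 0 (descend (contraction θ 1) y) + hθ.compression 0 (incl _ y) := by
  rw [compression_incl, ← LinearMap.comp_apply, hθ.hochschildBd_zero_comp_descend_contraction,
    LinearMap.sub_apply, LinearMap.id_apply, sub_add_cancel]

theorem eq_hochschildBd_succ_add_compression (hθ : IsCocompactChainMap S θ)
    (y : HochschildChain G (n + 1)) :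
    y = descend (contraction θ (n + 1)) (hochschildBd n y) +
      hochschildBd (n + 1) (descend (contraction θ (n + 2)) y) +
      hθ.compression (n + 1) (incl _ y) := by
  rw [compression_incl, ← LinearMap.comp_apply (hochschildBd (n + 1)),
    hθ.hochschildBd_succ_comp_descend_contraction]
  simp only [LinearMap.sub_apply, LinearMap.id_apply, LinearMap.comp_apply]
  abel

theorem eq_rdHochschildBd_zero_add_incl_compression (hθ : IsCocompactChainMap S θ)
    (c : RdHochschildChain S 0) :
    c = rdHochschildBd S 0 (hθ.rdContraction 0 c) + incl _ (hθ.compression 0 c) := by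
  rw [incl_compression, ← LinearMap.comp_apply, hθ.rdHochschildBd_zero_comp_rdContraction,
    LinearMap.sub_apply, LinearMap.id_apply, sub_add_cancel]

theorem eq_rdHochschildBd_succ_add_incl_compression (hθ : IsCocompactChainMap S θ)
    (c : RdHochschildChain S (n + 1)) :
    c = hθ.rdContraction n (rdHochschildBd S n c) +
      rdHochschildBd S (n + 1) (hθ.rdContraction (n + 1) c) +
      incl _ (hθ.compression (n + 1) c) := by
  rw [incl_compression, ← LinearMap.comp_apply (rdHochschildBd S (n + 1)),
    hθ.rdHochschildBd_succ_comp_rdContraction]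
  simp only [LinearMap.sub_apply, LinearMap.id_apply, LinearMap.comp_apply]
  abel

/-- The homotopy `contraction` as a homotopy between the identity and the compression of finitely
supported chains. -/
def homotopyIdComparisonComp (hθ : IsCocompactChainMap S θ) :
    Homotopy (𝟙 _) (hochschildComparison S (ConjClasses.mk (1 : G)) ≫ hθ.compressionHom) :=
  homotopyOfComponents (fun n => ModuleCat.ofHom (descend (contraction θ (n + 1))))
    (by
      rw [hochschildComplex_d]
      exact ModuleCat.hom_ext (LinearMap.ext hθ.eq_hochschildBd_zero_add_compression))
    fun n => by
      rw [hochschildComplex_d, hochschildComplex_d]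
      exact ModuleCat.hom_ext (LinearMap.ext hθ.eq_hochschildBd_succ_add_compression)

/-- The homotopy `rdContraction` as a homotopy between the identity and the compression of rapidly
decaying chains. -/
def homotopyIdCompressionComp (hθ : IsCocompactChainMap S θ) :
    Homotopy (𝟙 _) (hθ.compressionHom ≫ hochschildComparison S (ConjClasses.mk (1 : G))) :=
  homotopyOfComponents (fun n => ModuleCat.ofHom (hθ.rdContraction n))
    (by
      rw [rdHochschildComplex_d]
      exact ModuleCat.hom_ext (LinearMap.ext hθ.eq_rdHochschildBd_zero_add_incl_compression))
    fun n => by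
      rw [rdHochschildComplex_d, rdHochschildComplex_d]
      exact ModuleCat.hom_ext (LinearMap.ext hθ.eq_rdHochschildBd_succ_add_incl_compression)

/-- The comparison map as a homotopy equivalence, with inverse `compressionHom`. -/
def comparisonHomotopyEquiv (hθ : IsCocompactChainMap S θ) :
    HomotopyEquiv (hochschildComplex (ConjClasses.mk (1 : G)))
      (rdHochschildComplex S (ConjClasses.mk (1 : G))) where
  hom := hochschildComparison S _
  inv := hθ.compressionHom
  homotopyHomInvId := hθ.homotopyIdComparisonComp.symm
  homotopyInvHomId := hθ.homotopyIdCompressionComp.symm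

end OrdChain.IsCocompactChainMap

end Comparison

end

theorem mainTheorem5 {G : Type u} [Group G] (S : FinSymmGenSet G)
    (hF : IsTypeFInfty G) (hD : HasPolynomiallyBoundedDehnFunctions G) (n : ℕ) :
    IsIso (HHcomparison S (ConjClasses.mk (1 : G)) n) := by
  obtain ⟨θ, hθ⟩ := hD.exists_isCocompactChainMap S
  exact (hθ.comparisonHomotopyEquiv.toHomologyIso n).isIso_hom
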